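/- **Setting.** Let $D_1,D_2\ge 1$ and let $\mathcal S_j$ ($j=1,2$) be either $\mathbb R^{D_j}$ or the unit sphere $\Omega_{D_j}\subset\mathbb R^{D_j+1}$, with Lebesgue (resp. surface) measure $\omega_j$; let $I_{(j)}$ denote the identity matrix of the ambient dimension of $\mathcal S_j$. Let $\mathbf Z_i=(\mathbf X_i,\mathbf Y_i)$, $i\ge 1$, be i.i.d. with density $f\ge 0$ with respect to $\omega_1\otimes\omega_2$ on $\mathcal S_1\times\mathcal S_2$; whenever $\mathcal S_j=\mathbb R^{D_j}$, the projection of $f$ on $\mathcal S_j$ has compact support. Extend $f$ to the ambient space by $f(x,\cdot)=f(x/\|x\|,\cdot)$ if $\mathcal S_1$ is a sphere, and likewise in $y$. *(A1)* On the set where this extension is defined ($x\ne0$ if $\mathcal S_1$ is a sphere, $y\neq 0$ if $\mathcal S_2$ is a sphere) the extended $f$ is three times continuously differentiable; its derivatives of orders 1, 2, 3 are square integrable on $\mathcal S_1\times\mathcal S_2$, and its fourth-order derivatives exist and are bounded on $\mathcal S_1\times\mathcal S_2$. *(A2)* For $j=1,2$ let $p_j:[0,\infty)\to[0,\infty)$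 be the kernel profile of the $j$-th factor (written $k$ if $\mathcal S_j=\mathbb R^{D_j}$, $L$ if $\mathcal S_j=\Omega_{D_j}$). It is non-increasing and $C^3$, with existing and bounded fourth derivative. If $\mathcal S_j=\mathbb R^{D_j}$, then $0<\int k(\|x\|^2/2)\,dx$, and the functions $\|x\|^2|\partial^\tau K(x)|$ and $|\partial^\tau K(x)|^2$, with $K(x)=k(\|x\|^2/2)$, are integrable on $\mathbb R^{D_j}$ for all $|\tau|\le 3$. If $\mathcal S_j=\Omega_{D_j}$, then $0<\int_0^\infty |L^{(\ell)}(r)|\,r^{q/2-1}dr<\infty$ for all integers $q\ge1$ and $\ell=0,1,2,3$. *Notation.* $k_j(s)=p_j(s/2)$. The normalizing constant is $C_j(h)=C_{k,D_j}h^{-D_j}$ with $C_{k,D_j}^{-1}=\int_{\mathbb R^{D_j}}k(\|x\|^2/2)\,dx$ if $\mathcal S_j=\mathbb R^{D_j}$, and $C_j(h)^{-1}=\int_{\Omega_{D_j}}L\big(\tfrac{1-x^Ty}{h^2}\big)\,\omega_j(dy)$ (independent of $x\in\Omega_{D_j}$) if $\mathcal S_j=\Omega_{D_j}$. For $h_1,h_2>0$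 and $z=(x,y)$ put $$\hat f_{\mathbf h}(z)=\frac{C_1(h_1)C_2(h_2)}n\sum_{i=1}^n k_1\Big(\Big\|\frac{x-\mathbf X_i}{h_1}\Big\|^2\Big)k_2\Big(\Big\|\frac{y-\mathbf Y_i}{h_2}\Big\|^2\Big),\qquad \mathbf H=\mathrm{Diag}(h_1^2I_{(1)},h_2^2I_{(2)}),$$ $$G_x=-\frac{2C_1(h_1)C_2(h_2)}{nh_1^2}\sum_{i=1}^n k_1'\Big(\Big\|\frac{x-\mathbf X_i}{h_1}\Big\|^2\Big)k_2\Big(\Big\|\frac{y-\mathbf Y_i}{h_2}\Big\|^2\Big),\qquad G_y=-\frac{2C_1(h_1)C_2(h_2)}{nh_2^2}\sum_{i=1}^n k_1\Big(\Big\|\frac{x-\mathbf X_i}{h_1}\Big\|^2\Big)k_2'\Big(\Big\|\frac{y-\mathbf Y_i}{h_2}\Big\|^2\Big),$$ $\tilde D(z)=\mathrm{Diag}(G_xI_{(1)},G_yI_{(2)})$. Let $\nabla$ be the gradient in the ambient space and $\mathtt{grad}=\mathcal P_z\nabla$ the Riemannian gradient, where $\mathcal P_z=\mathrm{Diag}(\mathcal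 P_1,\mathcal P_2)$ with $\mathcal P_1=I_{(1)}$ if $\mathcal S_1=\mathbb R^{D_1}$ and $\mathcal P_1=I_{(1)}-xx^T$ if $\mathcal S_1=\Omega_{D_1}$, and likewise $\mathcal P_2$ in $y$. The mean shift vector is $$\Xi(z)=\left(\frac{\sum_i \mathbf X_i\,k_1'(\|\frac{x-\mathbf X_i}{h_1}\|^2)k_2(\|\frac{y-\mathbf Y_i}{h_2}\|^2)}{\sum_i k_1'(\|\frac{x-\mathbf X_i}{h_1}\|^2)k_2(\|\frac{y-\mathbf Y_i}{h_2}\|^2)}-x,\ \ \frac{\sum_i \mathbf Y_i\,k_1(\|\frac{x-\mathbf X_i}{h_1}\|^2)k_2'(\|\frac{y-\mathbf Y_i}{h_2}\|^2)}{\sum_i k_1(\|\frac{x-\mathbf X_i}{h_1}\|^2)k_2'(\|\frac{y-\mathbf Y_i}{h_2}\|^2)}-y\right).$$ **Proposition 3.** Fix $z=(x,y)\in\mathcal S_1\times\mathcal S_2$ with $f(z)>0$. 1. For all $n$, $h_1,h_2>0$ and every sample: $\Xi(z)=\tilde D(z)^{-1}\nabla\hat f_{\mathbf h}(z)$ whenever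 $\tilde D(z)$ is invertible, and $$\mathcal P_z\mathbf H^{-1}\tilde D(z)^{-1}\nabla\hat f_{\mathbf h}(z)=\tilde D(z)^{-1}\mathbf H^{-1}\,\mathtt{grad}\,\hat f_{\mathbf h}(z),$$ where the inverse of a singular matrix is read as the zero matrix. 2. Let $\tilde F(z)=\mathrm{Diag}(\tilde F_1I_{(1)},\tilde F_2I_{(2)})$ with $$\tilde F_j=\begin{cases}-C_{k,D_j}\displaystyle\int_{\mathbb R^{D_j}}k'(\|u\|^2/2)\,du\cdot f(z)&\text{if }\mathcal S_j=\mathbb R^{D_j},\\[2mm] -\dfrac{\int_0^\infty L'(r)r^{D_j/2-1}dr}{\int_0^\infty L(r)r^{D_j/2-1}dr}\cdot f(z)&\text{if }\mathcal S_j=\Omega_{D_j}.\end{cases}$$ Then $\tilde F(z)$ is invertible. If positive $h=h(n)$, $h_1=h_1(n)$, $h_2=h_2(n)$ satisfy $h_1\asymp h$, $h_2\asymp h$ (each bounded above and below by positive constant multiples of $h$ for large $n$), $h\to0$ and $nh^{D_1+D_2+2}\to\infty$ as $n\to\infty$, then $\tilde D(z)$ is invertible with probability tending to one and $$[\mathbf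 H\tilde D(z)]^{-1}\,\mathtt{grad}\,\hat f_{\mathbf h}(z)-\tilde F(z)^{-1}\,\mathtt{grad}\,f(z)=O(h^2)+O_P\left(\sqrt{\frac1{nh^{D_1+D_2+2}}}\right),$$ where the $O(h^2)$ term is nonrandom. -/

import Mathlib

open MeasureTheory ProbabilityTheory Filter Topology Asymptotics Matrix Set
open scoped BigOperators

namespace ProdKDE

noncomputable section

/-- A factor of the product space is either a Euclidean space `ℝ^D` or a unit sphere
`Ω_D ⊆ ℝ^(D+1)` of intrinsic dimension `D`. -/
inductive Geometry where
  | linear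
  | directional
  deriving DecidableEq

/-- Dimension of the smallest Euclidean space containing the factor. -/
def ambDim : Geometry → ℕ → ℕ
  | .linear, D => D
  | .directional, D => D + 1

/-- The ambient Euclidean space of a factor. -/
abbrev Amb (g : Geometry) (D : ℕ) : Type := EuclideanSpace ℝ (Fin (ambDim g D))

/-- The factor `ℝ^D` or `Ω_D`, as a subset of its ambient space. -/
def space : (g : Geometry) → (D : ℕ) → Set (Amb g D)
  | .linear, _ => Set.univ
  | .directional, _ => Metric.sphere 0 1

/-- Lebesgue measure on `ℝ^D`, surface measure on `Ω_D`, as a measure on the ambient space. -/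
def refMeasure : (g : Geometry) → (D : ℕ) → Measure (Amb g D)
  | .linear, D => (volume : Measure (EuclideanSpace ℝ (Fin D)))
  | .directional, D =>
      ((volume : Measure (EuclideanSpace ℝ (Fin (D + 1)))).toSphere).map
        (Subtype.val : Metric.sphere (0 : EuclideanSpace ℝ (Fin (D + 1))) 1 → _)

/-- `x ↦ x / ‖x‖` for a sphere, the identity for a Euclidean space. -/
def retract : (g : Geometry) → (D : ℕ) → Amb g D → Amb g D
  | .linear, _, x => x
  | .directional, _, x => ‖x‖⁻¹ • x

/-- The part of the ambient space of a factor on which `retract` is meaningful. -/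
def punctured : (g : Geometry) → (D : ℕ) → Set (Amb g D)
  | .linear, _ => Set.univ
  | .directional, _ => {x | x ≠ 0}

/-! ### Kernels -/

/-- The factor's kernel profile `k_j` as a function of the squared norm:
`k_j(s) = p(s/2)`, where `p` is the linear profile `k` or the directional profile `L`. -/
def sqProfile (p : ℝ → ℝ) (s : ℝ) : ℝ := p (s / 2)

/-- The derivative `k_j'` on `[0, ∞)` (one-sided at `0`). -/
def sqProfileDeriv (p : ℝ → ℝ) (s : ℝ) : ℝ := derivWithin (sqProfile p) (Set.Ici 0) s

/-- `C_{k,D}`: the constant for which `x ↦ C_{k,D} k(‖x‖²/2)` has integral one over `ℝ^D`. -/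
def linConst (D : ℕ) (p : ℝ → ℝ) : ℝ :=
  (∫ x : EuclideanSpace ℝ (Fin D), p (‖x‖ ^ 2 / 2))⁻¹

/-- The normalizing constant of the kernel at bandwidth `h`: `C_{k,D} / h^D` in the linear case and
`(∫_{Ω_D} L((1 - xᵀy)/h²) ω(dy))⁻¹` in the directional case. The latter integral does not depend
on `x ∈ Ω_D`, and `x` is taken to be the first vector of the standard basis. -/
def normConst : (g : Geometry) → (D : ℕ) → (ℝ → ℝ) → ℝ → ℝ
  | .linear, D, p, h => linConst D p / h ^ D
  | .directional, D, p, h =>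
      (∫ y : EuclideanSpace ℝ (Fin (D + 1)),
        p ((1 - inner ℝ (EuclideanSpace.single (0 : Fin (D + 1)) (1 : ℝ)) y) / h ^ 2)
          ∂(refMeasure .directional D))⁻¹

/-- The kernel function `K_j`, which depends on the bandwidth through its normalizing constant. -/
def kernelFn (g : Geometry) (D : ℕ) (p : ℝ → ℝ) (h : ℝ) (u : Amb g D) : ℝ :=
  normConst g D p h * sqProfile p (‖u‖ ^ 2)

/-- Conditions on a kernel profile `p : [0, ∞) → [0, ∞)` for a factor of the given geometry and
intrinsic dimension. Only the values of `p` on `[0, ∞)` matter. -/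
structure KernelCond (g : Geometry) (D : ℕ) (p : ℝ → ℝ) : Prop where
  nonneg : ∀ r, 0 ≤ r → 0 ≤ p r
  anti : AntitoneOn p (Set.Ici 0)
  smooth : ContDiffOn ℝ 3 p (Set.Ici 0)
  diff_four : DifferentiableOn ℝ (iteratedDerivWithin 3 p (Set.Ici 0)) (Set.Ici 0)
  bdd_four : ∃ M : ℝ, ∀ r, 0 ≤ r → |iteratedDerivWithin 4 p (Set.Ici 0) r| ≤ M
  /-- The linear kernel is not identically zero, so that it can be normalized. -/
  lin_pos : g = .linear → 0 < ∫ x : EuclideanSpace ℝ (Fin D), p (‖x‖ ^ 2 / 2)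
  lin_moment : g = .linear → ∀ ℓ : ℕ, ℓ ≤ 3 →
    Integrable (fun x : EuclideanSpace ℝ (Fin D) =>
      ‖x‖ ^ 2 * ‖iteratedFDeriv ℝ ℓ
        (fun u : EuclideanSpace ℝ (Fin D) => p (‖u‖ ^ 2 / 2)) x‖)
  lin_sq : g = .linear → ∀ ℓ : ℕ, ℓ ≤ 3 →
    Integrable (fun x : EuclideanSpace ℝ (Fin D) =>
      ‖iteratedFDeriv ℝ ℓ (fun u : EuclideanSpace ℝ (Fin D) => p (‖u‖ ^ 2 / 2)) x‖ ^ 2)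
  dir_integrable : g = .directional → ∀ ℓ : ℕ, ℓ ≤ 3 → ∀ q : ℕ, 1 ≤ q →
    IntegrableOn (fun r : ℝ =>
      |iteratedDerivWithin ℓ p (Set.Ici 0) r| * r ^ ((q : ℝ) / 2 - 1)) (Set.Ioi 0)
  dir_pos : g = .directional → ∀ ℓ : ℕ, ℓ ≤ 3 → ∀ q : ℕ, 1 ≤ q →
    0 < ∫ r in Set.Ioi (0 : ℝ),
      |iteratedDerivWithin ℓ p (Set.Ici 0) r| * r ^ ((q : ℝ) / 2 - 1)

/-! ### The product space, total and Riemannian gradients -/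

variable {g₁ g₂ : Geometry} {D₁ D₂ : ℕ}

/-- The product space `S₁ × S₂` inside its ambient space. -/
def prodSpace (g₁ g₂ : Geometry) (D₁ D₂ : ℕ) : Set (Amb g₁ D₁ × Amb g₂ D₂) :=
  space g₁ D₁ ×ˢ space g₂ D₂

/-- The measure `ω₁ ⊗ ω₂`. -/
def prodMeasure (g₁ g₂ : Geometry) (D₁ D₂ : ℕ) : Measure (Amb g₁ D₁ × Amb g₂ D₂) :=
  (refMeasure g₁ D₁).prod (refMeasure g₂ D₂)

/-- Coordinates of the ambient space of `S₁ × S₂`, in two blocks. -/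
abbrev Idx (g₁ g₂ : Geometry) (D₁ D₂ : ℕ) : Type :=
  Fin (ambDim g₁ D₁) ⊕ Fin (ambDim g₂ D₂)

/-- The extension of a function from `S₁ × S₂` to its ambient space, constant along the rays of
each directional factor. -/
def radialExt (f : Amb g₁ D₁ × Amb g₂ D₂ → ℝ) (z : Amb g₁ D₁ × Amb g₂ D₂) : ℝ :=
  f (retract g₁ D₁ z.1, retract g₂ D₂ z.2)

/-- The total gradient `(∇_x F, ∇_y F)` in the ambient space. -/
def totalGrad (F : Amb g₁ D₁ × Amb g₂ D₂ → ℝ) (z : Amb g₁ D₁ × Amb g₂ D₂) :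
    Idx g₁ g₂ D₁ D₂ → ℝ :=
  Sum.elim (fun i => gradient (fun x => F (x, z.2)) z.1 i)
    (fun i => gradient (fun y => F (z.1, y)) z.2 i)

/-- The projection matrix onto the tangent space of one factor: `I` for `ℝ^D` and `I - x xᵀ` for
`Ω_D`. -/
def tangentProj : (g : Geometry) → (D : ℕ) → Amb g D →
    Matrix (Fin (ambDim g D)) (Fin (ambDim g D)) ℝ
  | .linear, _, _ => 1
  | .directional, _, x => 1 - Matrix.vecMulVec (fun i => x i) (fun i => x i)

/-- The projection matrix `P_z` onto the tangent space of `S₁ × S₂` at `z`. -/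
def projMatrix (z : Amb g₁ D₁ × Amb g₂ D₂) :
    Matrix (Idx g₁ g₂ D₁ D₂) (Idx g₁ g₂ D₁ D₂) ℝ :=
  Matrix.fromBlocks (tangentProj g₁ D₁ z.1) 0 0 (tangentProj g₂ D₂ z.2)

/-- The Riemannian gradient on `S₁ × S₂` of (the restriction of) an ambient function `F`:
the projection of the total gradient onto the tangent space. -/
def riemGrad (F : Amb g₁ D₁ × Amb g₂ D₂ → ℝ) (z : Amb g₁ D₁ × Amb g₂ D₂) :
    Idx g₁ g₂ D₁ D₂ → ℝ :=
  projMatrix z *ᵥ totalGrad F z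

/-- `Diag(a I, b I)` with blocks of the ambient sizes of the two factors. -/
def twoBlock (g₁ g₂ : Geometry) (D₁ D₂ : ℕ) (a b : ℝ) :
    Matrix (Idx g₁ g₂ D₁ D₂) (Idx g₁ g₂ D₁ D₂) ℝ :=
  Matrix.fromBlocks (a • 1) 0 0 (b • 1)

/-- Conditions on the density `f` on `S₁ × S₂`. Only the values of `f` on `S₁ × S₂` matter. -/
structure DensityCond (f : Amb g₁ D₁ × Amb g₂ D₂ → ℝ) : Prop where
  nonneg : ∀ z ∈ prodSpace g₁ g₂ D₁ D₂, 0 ≤ f z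
  total : ∫ z, f z ∂(prodMeasure g₁ g₂ D₁ D₂) = 1
  compact₁ : g₁ = .linear → ∃ K : Set (Amb g₁ D₁), IsCompact K ∧
    ∀ z ∈ prodSpace g₁ g₂ D₁ D₂, z.1 ∉ K → f z = 0
  compact₂ : g₂ = .linear → ∃ K : Set (Amb g₂ D₂), IsCompact K ∧
    ∀ z ∈ prodSpace g₁ g₂ D₁ D₂, z.2 ∉ K → f z = 0
  smooth : ContDiffOn ℝ 3 (radialExt f) (punctured g₁ D₁ ×ˢ punctured g₂ D₂)
  sq_integrable : ∀ ℓ : ℕ, 1 ≤ ℓ → ℓ ≤ 3 →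
    MemLp (fun z => iteratedFDeriv ℝ ℓ (radialExt f) z) 2 (prodMeasure g₁ g₂ D₁ D₂)
  diff_four : ∀ z ∈ prodSpace g₁ g₂ D₁ D₂,
    DifferentiableAt ℝ (iteratedFDeriv ℝ 3 (radialExt f)) z
  bdd_four : ∃ M : ℝ, ∀ z ∈ prodSpace g₁ g₂ D₁ D₂, ‖iteratedFDeriv ℝ 4 (radialExt f) z‖ ≤ M

/-! ### The kernel density estimator and the mean shift vector -/

/-- The product-kernel density estimator from the first `n` points of the data `Z`,
as a function on the ambient space. -/
def kde (p₁ p₂ : ℝ → ℝ) (h₁ h₂ : ℝ) (n : ℕ) (Z : ℕ → Amb g₁ D₁ × Amb g₂ D₂)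
    (z : Amb g₁ D₁ × Amb g₂ D₂) : ℝ :=
  (1 / (n : ℝ)) * ∑ i ∈ Finset.range n,
    kernelFn g₁ D₁ p₁ h₁ (h₁⁻¹ • (z.1 - (Z i).1)) *
      kernelFn g₂ D₂ p₂ h₂ (h₂⁻¹ • (z.2 - (Z i).2))

/-- The factor `G_x`. -/
def Gx (p₁ p₂ : ℝ → ℝ) (h₁ h₂ : ℝ) (n : ℕ) (Z : ℕ → Amb g₁ D₁ × Amb g₂ D₂)
    (z : Amb g₁ D₁ × Amb g₂ D₂) : ℝ :=
  -(2 * (normConst g₁ D₁ p₁ h₁ * normConst g₂ D₂ p₂ h₂) / ((n : ℝ) * h₁ ^ 2)) *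
    ∑ i ∈ Finset.range n,
      sqProfileDeriv p₁ (‖h₁⁻¹ • (z.1 - (Z i).1)‖ ^ 2) *
        sqProfile p₂ (‖h₂⁻¹ • (z.2 - (Z i).2)‖ ^ 2)

/-- The factor `G_y`. -/
def Gy (p₁ p₂ : ℝ → ℝ) (h₁ h₂ : ℝ) (n : ℕ) (Z : ℕ → Amb g₁ D₁ × Amb g₂ D₂)
    (z : Amb g₁ D₁ × Amb g₂ D₂) : ℝ :=
  -(2 * (normConst g₁ D₁ p₁ h₁ * normConst g₂ D₂ p₂ h₂) / ((n : ℝ) * h₂ ^ 2)) *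
    ∑ i ∈ Finset.range n,
      sqProfile p₁ (‖h₁⁻¹ • (z.1 - (Z i).1)‖ ^ 2) *
        sqProfileDeriv p₂ (‖h₂⁻¹ • (z.2 - (Z i).2)‖ ^ 2)

/-- The bandwidth matrix `H`. -/
def bandwidthMatrix (g₁ g₂ : Geometry) (D₁ D₂ : ℕ) (h₁ h₂ : ℝ) :
    Matrix (Idx g₁ g₂ D₁ D₂) (Idx g₁ g₂ D₁ D₂) ℝ :=
  twoBlock g₁ g₂ D₁ D₂ (h₁ ^ 2) (h₂ ^ 2)

/-- The matrix `D̃(z) = Diag(G_x I, G_y I)`. -/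
def Dtilde (p₁ p₂ : ℝ → ℝ) (h₁ h₂ : ℝ) (n : ℕ) (Z : ℕ → Amb g₁ D₁ × Amb g₂ D₂)
    (z : Amb g₁ D₁ × Amb g₂ D₂) : Matrix (Idx g₁ g₂ D₁ D₂) (Idx g₁ g₂ D₁ D₂) ℝ :=
  twoBlock g₁ g₂ D₁ D₂ (Gx p₁ p₂ h₁ h₂ n Z z) (Gy p₁ p₂ h₁ h₂ n Z z)

/-- The weights `k₁'(‖(x - X_i)/h₁‖²) K₂((y - Y_i)/h₂)` in the first block of the mean shift
vector. -/
def weightX (p₁ p₂ : ℝ → ℝ) (h₁ h₂ : ℝ) (z w : Amb g₁ D₁ × Amb g₂ D₂) : ℝ :=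
  sqProfileDeriv p₁ (‖h₁⁻¹ • (z.1 - w.1)‖ ^ 2) *
    kernelFn g₂ D₂ p₂ h₂ (h₂⁻¹ • (z.2 - w.2))

/-- The weights `K₁((x - X_i)/h₁) k₂'(‖(y - Y_i)/h₂‖²)` in the second block of the mean shift
vector. -/
def weightY (p₁ p₂ : ℝ → ℝ) (h₁ h₂ : ℝ) (z w : Amb g₁ D₁ × Amb g₂ D₂) : ℝ :=
  kernelFn g₁ D₁ p₁ h₁ (h₁⁻¹ • (z.1 - w.1)) *
    sqProfileDeriv p₂ (‖h₂⁻¹ • (z.2 - w.2)‖ ^ 2)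

/-- The mean shift vector `Ξ(z)`: weighted sample mean minus current point, block by block. -/
def meanShift (p₁ p₂ : ℝ → ℝ) (h₁ h₂ : ℝ) (n : ℕ) (Z : ℕ → Amb g₁ D₁ × Amb g₂ D₂)
    (z : Amb g₁ D₁ × Amb g₂ D₂) : Idx g₁ g₂ D₁ D₂ → ℝ :=
  Sum.elim
    (fun j => (∑ i ∈ Finset.range n, (Z i).1 j * weightX p₁ p₂ h₁ h₂ z (Z i)) /
      (∑ i ∈ Finset.range n, weightX p₁ p₂ h₁ h₂ z (Z i)) - z.1 j)
    (fun j => (∑ i ∈ Finset.range n, (Z i).2 j * weightY p₁ p₂ h₁ h₂ z (Z i)) /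
      (∑ i ∈ Finset.range n, weightY p₁ p₂ h₁ h₂ z (Z i)) - z.2 j)

/-! ### The limit matrix and stochastic order -/

/-- The kernel-dependent factor in the limit matrix:
`-C_{k,D} ∫ k'(‖x‖²/2) dx` for a linear kernel and
`-(∫₀^∞ L'(r) r^(D/2-1) dr) / (∫₀^∞ L(r) r^(D/2-1) dr)` for a directional kernel. -/
def kernelRatio : Geometry → ℕ → (ℝ → ℝ) → ℝ
  | .linear, D, p =>
      -linConst D p * ∫ x : EuclideanSpace ℝ (Fin D), derivWithin p (Set.Ici 0) (‖x‖ ^ 2 / 2)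
  | .directional, D, p =>
      -((∫ r in Set.Ioi (0 : ℝ), derivWithin p (Set.Ici 0) r * r ^ ((D : ℝ) / 2 - 1)) /
        (∫ r in Set.Ioi (0 : ℝ), p r * r ^ ((D : ℝ) / 2 - 1)))

/-- The limit matrix `F̃(z) = Diag(F̃₁ I, F̃₂ I)`. -/
def Ftilde (p₁ p₂ : ℝ → ℝ) (f : Amb g₁ D₁ × Amb g₂ D₂ → ℝ) (z : Amb g₁ D₁ × Amb g₂ D₂) :
    Matrix (Idx g₁ g₂ D₁ D₂) (Idx g₁ g₂ D₁ D₂) ℝ :=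
  twoBlock g₁ g₂ D₁ D₂ (kernelRatio g₁ D₁ p₁ * f z) (kernelRatio g₂ D₂ p₂ * f z)

/-- `X_n = O_P(r_n)`: the sequence `X_n / r_n` is bounded in probability. -/
def IsBigOP {Ω : Type*} [MeasurableSpace Ω] {V : Type*} [Norm V] (P : Measure Ω)
    (X : ℕ → Ω → V) (r : ℕ → ℝ) : Prop :=
  ∀ ε : ℝ, 0 < ε → ∃ M : ℝ, ∀ᶠ n in atTop, P {ω | M * r n < ‖X n ω‖} ≤ ENNReal.ofReal ε

end

end ProdKDE

open ProdKDE

/-! The exact identities are algebra. Differentiating a radial kernel in its centre produces `k'`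
times the vector to the data point, so each block of the ambient gradient is `G_x` or `G_y` times a
weighted mean minus the current point. All diagonal matrices involved are scalar on each block,
hence commute with the block-diagonal tangential projection; a singular `D̃` makes both sides
vanish.

For the rate, `H D̃` has the scalars `h₁² G_x` and `h₂² G_y`, which are empirical means of products
of two kernel weights without the diverging factor `h⁻²`. The claim therefore concerns a ratio of
empirical means: gradient coordinates over these scalars. Each mean splits into its expectation,
which yields the nonrandom `O(h²)`, and a centred part controlled by Chebyshev's inequality.

The bias rests on the notion `ApproxKernel`: mass `w₀ + O(h²)`, first moment `O(h²)`, second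
absolute moment `O(h²)`. Integrating a second-order Taylor expansion against a product of two such
weights gives bias `O(h²)` (`abs_integral_prod_kernel_sub_le`). On a Euclidean space the moments
follow by scaling and oddness. On a sphere the mass comes from the substitution `r = (1 - cos θ)/h²`
in the distribution of a coordinate, and the first moment is bounded by the second through
reflection in the axis of the pole.

The gradient weights carry `h⁻²`, so a direct expansion would lose two orders. Instead the
derivative is moved to the density by integration by parts along a Killing field, a translation or
an infinitesimal rotation. Such a field is divergence free, equals the prescribed tangent vector at
`z`, and differentiates the kernel into exactly the required inner product
(`inner_sub_killingField`). What remains is a plain kernel average of a twice continuously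
differentiable derivative of `f`.

Second moments are of order `h^-(D₁+D₂)` for the scalars and `h^-(D₁+D₂+2)` for the gradient, whence
the stochastic rate. The limits of the denominators are positive: the profile is non-increasing and
its derivative cannot vanish identically. Quotients are Lipschitz near such limits, and both error
orders pass to the ratio (`exists_bias_isBigOP_ratio`). -/

namespace ProdKDE

/-! ### Surface measure as a cone integral, and its invariance. -/

section Sphere

/-- Integration in polar coordinates around the origin. -/
theorem lintegral_eq_lintegral_toSphere {E : Type*} [NormedAddCommGroup E] [NormedSpace ℝ E]
    [MeasurableSpace E] [BorelSpace E] [FiniteDimensional ℝ E] [Nontrivial E]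
    (μ : Measure E) [μ.IsAddHaarMeasure] {G : E → ENNReal} (hG : Measurable G) :
    ∫⁻ w, G w ∂μ = ∫⁻ r in Ioi (0 : ℝ), ENNReal.ofReal (r ^ (Module.finrank ℝ E - 1)) *
      ∫⁻ y : Metric.sphere (0 : E) 1, G (r • (y : E)) ∂μ.toSphere := by
  -- The origin is a null set; off it, `w ↦ (w/‖w‖, ‖w‖)` carries `μ` to the product of the sphere
  -- measure and a power-weighted radial measure.
  have h1 : ∫⁻ w, G w ∂μ = ∫⁻ w : ({(0)}ᶜ : Set E), G w ∂(μ.comap (↑)) := by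
    rw [lintegral_subtype_comap (measurableSet_singleton _).compl G,
      restrict_compl_singleton]
  have hm : Measurable fun q : Metric.sphere (0 : E) 1 × Ioi (0 : ℝ) =>
      G ((q.2 : ℝ) • (q.1 : E)) := by fun_prop
  have h2 : ∫⁻ w : ({(0)}ᶜ : Set E), G w ∂(μ.comap (↑)) =
      ∫⁻ q, G ((q.2 : ℝ) • (q.1 : E))
        ∂μ.toSphere.prod (Measure.volumeIoiPow (Module.finrank ℝ E - 1)) := by
    rw [← μ.measurePreserving_homeomorphUnitSphereProd.lintegral_comp hm]
    refine lintegral_congr fun w => ?_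
    congr 1
    have hw : ‖(w : E)‖ ≠ 0 := norm_ne_zero_iff.2 w.2
    simp [smul_smul, hw]
  rw [h1, h2, lintegral_prod_symm _ hm.aemeasurable, Measure.volumeIoiPow,
    lintegral_withDensity_eq_lintegral_mul _ (by fun_prop) (by fun_prop)]
  rw [← lintegral_subtype_comap measurableSet_Ioi (fun r : ℝ =>
    ENNReal.ofReal (r ^ (Module.finrank ℝ E - 1)) *
      ∫⁻ y : Metric.sphere (0 : E) 1, G (r • (y : E)) ∂μ.toSphere)]
  rfl

theorem lintegral_Ioo_pow (n : ℕ) :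
    ∫⁻ r in Ioo (0 : ℝ) 1, ENNReal.ofReal (r ^ n) = ENNReal.ofReal (1 / (n + 1)) := by
  rw [Measure.restrict_congr_set Ioo_ae_eq_Ioc,
    ← ofReal_integral_eq_lintegral_ofReal (intervalIntegral.intervalIntegrable_pow _).1,
    ← intervalIntegral.integral_of_le zero_le_one]
  · simp
  · filter_upwards [ae_restrict_mem measurableSet_Ioc] with y hy
    exact pow_nonneg hy.1.le _

/-- The surface measure of the unit sphere, as a measure on the ambient space. -/
noncomputable def surfaceMeasure (E : Type*) [NormedAddCommGroup E] [InnerProductSpace ℝ E]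
    [MeasurableSpace E] [BorelSpace E] [FiniteDimensional ℝ E] : Measure E :=
  ((volume : Measure E).toSphere).map (Subtype.val : Metric.sphere (0 : E) 1 → E)

variable {E : Type*} [NormedAddCommGroup E] [InnerProductSpace ℝ E]
  [MeasurableSpace E] [BorelSpace E] [FiniteDimensional ℝ E]

instance isFiniteMeasure_surfaceMeasure : IsFiniteMeasure (surfaceMeasure E) := by
  unfold surfaceMeasure
  infer_instance

/-- The surface measure of a function is a cone integral. -/
theorem lintegral_surfaceMeasure [Nontrivial E] {G : E → ENNReal} (hG : Measurable G) :
    ∫⁻ y, G y ∂(surfaceMeasure E) = Module.finrank ℝ E *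
      ∫⁻ w : E, (Metric.ball (0 : E) 1).indicator (fun w => G (‖w‖⁻¹ • w)) w := by
  have hmeas : Measurable ((Metric.ball (0 : E) 1).indicator (fun w => G (‖w‖⁻¹ • w))) :=
    (by fun_prop : Measurable fun w : E => G (‖w‖⁻¹ • w)).indicator measurableSet_ball
  have hmap : ∫⁻ y, G y ∂(surfaceMeasure E) =
      ∫⁻ y : Metric.sphere (0 : E) 1, G y ∂(volume : Measure E).toSphere :=
    lintegral_map hG measurable_subtype_coe
  rw [lintegral_eq_lintegral_toSphere _ hmeas]
  -- The cone function is constant along each ray inside the ball. The radial integral of `r^(n-1)`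
  -- over `(0,1)` is `1/n`, which cancels the factor `finrank`.
  have : ∀ r ∈ Ioi (0 : ℝ), ENNReal.ofReal (r ^ (Module.finrank ℝ E - 1)) *
      ∫⁻ y : Metric.sphere (0 : E) 1,
        (Metric.ball (0 : E) 1).indicator (fun w => G (‖w‖⁻¹ • w)) (r • (y : E))
          ∂(volume : Measure E).toSphere =
      (Ioo (0 : ℝ) 1).indicator (fun r => ENNReal.ofReal (r ^ (Module.finrank ℝ E - 1)) *
        ∫⁻ y, G y ∂(surfaceMeasure E)) r := by
    intro r hr
    have hr' : 0 < r := hr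
    rw [hmap]
    by_cases h : r < 1
    · rw [indicator_of_mem (show r ∈ Ioo (0 : ℝ) 1 from ⟨hr', h⟩)]
      congr 1
      refine lintegral_congr fun y => ?_
      have hy : ‖(y : E)‖ = 1 := by simp
      rw [indicator_of_mem (by simp [norm_smul, abs_of_pos hr', h])]
      simp only [norm_smul, hy, Real.norm_eq_abs, abs_of_pos hr', smul_smul]
      simp [hr'.ne']
    · rw [indicator_of_notMem (fun h' => h h'.2)]
      convert mul_zero _
      exact (lintegral_congr fun y => indicator_of_notMem
        (by simpa [norm_smul, abs_of_pos hr'] using h) _).trans lintegral_zero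
  have hn : 0 < Module.finrank ℝ E := Module.finrank_pos
  rw [setLIntegral_congr_fun measurableSet_Ioi this, setLIntegral_indicator measurableSet_Ioo,
    inter_eq_left.2 Ioo_subset_Ioi_self, lintegral_mul_const _ (by fun_prop),
    lintegral_Ioo_pow, ← mul_assoc, ← ENNReal.ofReal_natCast,
    ← ENNReal.ofReal_mul (by positivity), Nat.cast_pred hn, sub_add_cancel,
    mul_one_div_cancel (by positivity)]
  simp

theorem ae_surfaceMeasure_mem_sphere :
    ∀ᵐ y ∂(surfaceMeasure E), y ∈ Metric.sphere (0 : E) 1 :=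
  (ae_map_iff measurable_subtype_coe.aemeasurable
      Metric.isClosed_sphere.measurableSet).2 (Eventually.of_forall fun y => y.2)

/-- The surface measure is invariant under linear isometries. -/
theorem measurePreserving_surfaceMeasure [Nontrivial E] (T : E ≃ₗᵢ[ℝ] E) :
    MeasurePreserving T (surfaceMeasure E) (surfaceMeasure E) := by
  have hT : Measurable T := T.continuous.measurable
  refine ⟨hT, Measure.ext_of_lintegral _ fun G hG => ?_⟩
  -- Both sides become Lebesgue integrals over the unit ball, where invariance under isometries is
  -- known.
  rw [lintegral_map hG hT, lintegral_surfaceMeasure (G := fun y => G (T y)) (hG.comp hT),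
    lintegral_surfaceMeasure hG]
  congr 1
  have hGm : Measurable fun w : E => G (‖w‖⁻¹ • w) := hG.comp (by fun_prop)
  rw [← T.measurePreserving.lintegral_comp (hGm.indicator measurableSet_ball)]
  refine lintegral_congr fun w => ?_
  by_cases hw : ‖w‖ < 1
  · rw [indicator_of_mem (by simpa using hw), indicator_of_mem (by simpa using hw)]
    simp
  · rw [indicator_of_notMem (by simpa using hw), indicator_of_notMem (by simpa using hw)]

/-- Polar decomposition of a function of the first coordinate and the norm. -/
theorem lintegral_first_coord (D : ℕ) {g : ℝ → ℝ → ENNReal}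
    (hg : Measurable (Function.uncurry g)) :
    ∫⁻ w : EuclideanSpace ℝ (Fin (D + 1)), g (w 0) (‖w‖ ^ 2) =
      ∫⁻ s : ℝ, ∫⁻ v : EuclideanSpace ℝ (Fin D), g s (s ^ 2 + ‖v‖ ^ 2) := by
  have hg' : Measurable fun w : EuclideanSpace ℝ (Fin (D + 1)) => g (w 0) (‖w‖ ^ 2) :=
    hg.comp (by fun_prop : Measurable fun w : EuclideanSpace ℝ (Fin (D + 1)) => (w 0, ‖w‖ ^ 2))
  rw [← (PiLp.volume_preserving_toLp (Fin (D + 1))).lintegral_comp hg']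
  have hsum : ∀ w : Fin (D + 1) → ℝ, ‖WithLp.toLp 2 w‖ ^ 2 =
      w 0 ^ 2 + ‖WithLp.toLp 2 (fun i : Fin D => w i.succ)‖ ^ 2 := by
    intro w
    simp [EuclideanSpace.norm_sq_eq, Fin.sum_univ_succ]
  have hg2 : Measurable fun q : ℝ × (Fin D → ℝ) =>
      g q.1 (q.1 ^ 2 + ‖(WithLp.toLp 2 q.2 : EuclideanSpace ℝ (Fin D))‖ ^ 2) :=
    hg.comp (by fun_prop : Measurable fun q : ℝ × (Fin D → ℝ) =>
      (q.1, q.1 ^ 2 + ‖(WithLp.toLp 2 q.2 : EuclideanSpace ℝ (Fin D))‖ ^ 2))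
  have h2 := (volume_preserving_piFinSuccAbove (fun _ : Fin (D + 1) => ℝ) 0).lintegral_comp hg2
  calc _ = ∫⁻ a : Fin (D + 1) → ℝ, g (a 0) (a 0 ^ 2 +
        ‖(WithLp.toLp 2 (fun i : Fin D => a i.succ) : EuclideanSpace ℝ (Fin D))‖ ^ 2) := by
        refine lintegral_congr fun a => ?_
        rw [hsum]
    _ = ∫⁻ q : ℝ × (Fin D → ℝ), g q.1 (q.1 ^ 2 +
        ‖(WithLp.toLp 2 q.2 : EuclideanSpace ℝ (Fin D))‖ ^ 2) := by
        rw [← h2]; rfl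
    _ = _ := by
        rw [Measure.volume_eq_prod, lintegral_prod _ hg2.aemeasurable]
        refine lintegral_congr fun s => ?_
        rw [← (PiLp.volume_preserving_toLp (Fin D)).lintegral_comp
          (f := fun v : EuclideanSpace ℝ (Fin D) => g s (s ^ 2 + ‖v‖ ^ 2))
          (hg.comp (by fun_prop : Measurable fun v : EuclideanSpace ℝ (Fin D) =>
            (s, s ^ 2 + ‖v‖ ^ 2)))]

end Sphere

/-! ### The law of one coordinate on the sphere. -/

section SphereCoordinate

/-- The distribution of a coordinate on the unit sphere, up to a constant. -/
theorem lintegral_surfaceMeasure_first_coord (d : ℕ) {φ : ℝ → ENNReal} (hφ : Measurable φ) :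
    ∫⁻ y, φ (y 0) ∂(surfaceMeasure (EuclideanSpace ℝ (Fin (d + 2)))) =
      (volume : Measure (EuclideanSpace ℝ (Fin (d + 1)))).toSphere univ *
        ∫⁻ θ in Ioo 0 Real.pi, ENNReal.ofReal (Real.sin θ ^ d) * φ (Real.cos θ) := by
  set σ := (volume : Measure (EuclideanSpace ℝ (Fin (d + 1)))).toSphere univ with hσ
  -- The cone integrand in terms of the first coordinate `s` and the squared norm `q`. The other `d
  -- + 1` coordinates are then put in polar form with radius `r`, leaving an integral over the half
  -- plane of pairs `(s, r)`.
  let g : ℝ → ℝ → ENNReal := fun s q => (Iio (1 : ℝ)).indicator (fun q => φ (s / √q)) q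
  have hg : Measurable (Function.uncurry g) := by
    have : Function.uncurry g = (Prod.snd ⁻¹' Iio (1 : ℝ)).indicator
        (fun p : ℝ × ℝ => φ (p.1 / √p.2)) := by
      ext p
      rfl
    rw [this]
    exact (hφ.comp (by fun_prop)).indicator (measurable_snd measurableSet_Iio)
  have hcone : ∫⁻ w : EuclideanSpace ℝ (Fin (d + 2)),
      (Metric.ball (0 : EuclideanSpace ℝ (Fin (d + 2))) 1).indicator
        (fun w => φ ((‖w‖⁻¹ • w) 0)) w =
      ∫⁻ w : EuclideanSpace ℝ (Fin (d + 2)), g (w 0) (‖w‖ ^ 2) := by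
    refine lintegral_congr fun w => ?_
    by_cases hw : ‖w‖ < 1
    · have h2 : ‖w‖ ^ 2 < 1 := by nlinarith [norm_nonneg w]
      rw [indicator_of_mem (by simpa using hw)]
      simp only [g]
      rw [indicator_of_mem (by simpa using h2), Real.sqrt_sq (norm_nonneg w)]
      congr 1
      simp [div_eq_inv_mul]
    · have h2 : ¬ ‖w‖ ^ 2 < 1 := by nlinarith [norm_nonneg w]
      rw [indicator_of_notMem (by simpa using hw)]
      simp only [g]
      rw [indicator_of_notMem (by simpa using h2)]
  have hinner : ∀ s : ℝ, ∫⁻ v : EuclideanSpace ℝ (Fin (d + 1)), g s (s ^ 2 + ‖v‖ ^ 2) =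
      σ * ∫⁻ r : ℝ, (Ioi (0 : ℝ)).indicator
        (fun r => ENNReal.ofReal (r ^ d) * g s (s ^ 2 + r ^ 2)) r := by
    intro s
    have hm : Measurable fun r : ℝ => g s (s ^ 2 + r ^ 2) :=
      hg.comp (by fun_prop : Measurable fun r : ℝ => (s, s ^ 2 + r ^ 2))
    rw [lintegral_eq_lintegral_toSphere volume
        (G := fun v : EuclideanSpace ℝ (Fin (d + 1)) => g s (s ^ 2 + ‖v‖ ^ 2))
        (hm.comp measurable_norm),
      lintegral_indicator measurableSet_Ioi, ← lintegral_const_mul _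
        (f := fun r : ℝ => ENNReal.ofReal (r ^ d) * g s (s ^ 2 + r ^ 2))
        ((by fun_prop : Measurable fun r : ℝ => ENNReal.ofReal (r ^ d)).mul hm)]
    refine setLIntegral_congr_fun measurableSet_Ioi fun r hr => ?_
    have hr' : 0 < r := hr
    simp only [norm_smul, Real.norm_eq_abs, abs_of_pos hr', norm_eq_of_mem_sphere,
      mul_one, lintegral_const, finrank_euclideanSpace, Fintype.card_fin, Nat.add_sub_cancel]
    rw [← hσ]
    ring
  let F : ℝ × ℝ → ENNReal := fun p => (Ioi (0 : ℝ)).indicator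
    (fun r => ENNReal.ofReal (r ^ d) * g p.1 (p.1 ^ 2 + r ^ 2)) p.2
  have hF : Measurable F := by
    have : F = (Prod.snd ⁻¹' Ioi (0 : ℝ)).indicator
        (fun p : ℝ × ℝ => ENNReal.ofReal (p.2 ^ d) * g p.1 (p.1 ^ 2 + p.2 ^ 2)) := by
      ext p
      rfl
    rw [this]
    refine Measurable.indicator ?_ (measurable_snd measurableSet_Ioi)
    exact (by fun_prop : Measurable fun p : ℝ × ℝ => ENNReal.ofReal (p.2 ^ d)).mul
      (hg.comp (by fun_prop : Measurable fun p : ℝ × ℝ => (p.1, p.1 ^ 2 + p.2 ^ 2)))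
  -- With `s = R cos θ`, `r = R sin θ` the variables separate: `r^d` and the Jacobian `R` give
  -- `R^(d+1) sin^d θ`, and `s/√q = cos θ`. Angles `θ ≤ 0` contribute nothing since `F` lives on `r
  -- > 0`. The radial integral `1/(d+2)` cancels the dimension in the cone formula.
  have hpolar : ∀ p ∈ Ioi (0 : ℝ) ×ˢ Ioo (-Real.pi) Real.pi,
      ENNReal.ofReal p.1 • F (polarCoord.symm p) =
      (Ioo (0 : ℝ) 1).indicator (fun R => ENNReal.ofReal (R ^ (d + 1))) p.1 *
        (Ioo 0 Real.pi).indicator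
          (fun θ => ENNReal.ofReal (Real.sin θ ^ d) * φ (Real.cos θ)) p.2 := by
    rintro ⟨R, θ⟩ ⟨hR, hθ⟩
    have hR' : 0 < R := hR
    simp only [polarCoord_symm_apply, F]
    by_cases hθ0 : 0 < θ
    · have hs : 0 < Real.sin θ := Real.sin_pos_of_pos_of_lt_pi hθ0 hθ.2
      rw [indicator_of_mem (show R * Real.sin θ ∈ Ioi (0 : ℝ) from mul_pos hR' hs),
        indicator_of_mem (show θ ∈ Ioo 0 Real.pi from ⟨hθ0, hθ.2⟩)]
      have hq : (R * Real.cos θ) ^ 2 + (R * Real.sin θ) ^ 2 = R ^ 2 := by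
        linear_combination R ^ 2 * Real.sin_sq_add_cos_sq θ
      simp only [g]
      rw [hq]
      by_cases h1 : R < 1
      · rw [indicator_of_mem (show R ^ 2 ∈ Iio (1 : ℝ) by simp only [mem_Iio]; nlinarith),
          indicator_of_mem (show R ∈ Ioo (0 : ℝ) 1 from ⟨hR', h1⟩), Real.sqrt_sq hR'.le,
          mul_div_cancel_left₀ _ hR'.ne', smul_eq_mul, ← mul_assoc, ← mul_assoc,
          ← ENNReal.ofReal_mul hR'.le, ← ENNReal.ofReal_mul (by positivity)]
        congr 2
        ring
      · rw [indicator_of_notMem (show R ^ 2 ∉ Iio (1 : ℝ) by simp only [mem_Iio]; nlinarith),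
          indicator_of_notMem (fun h => h1 h.2)]
        simp
    · have hs : Real.sin θ ≤ 0 := Real.sin_nonpos_of_nonpos_of_neg_pi_le (not_lt.1 hθ0) hθ.1.le
      rw [indicator_of_notMem (show R * Real.sin θ ∉ Ioi (0 : ℝ) by
          simp only [mem_Ioi, not_lt]; nlinarith),
        indicator_of_notMem (show θ ∉ Ioo 0 Real.pi from fun h => hθ0 h.1)]
      simp
  have hφm : Measurable fun θ => ENNReal.ofReal (Real.sin θ ^ d) * φ (Real.cos θ) :=
    (by fun_prop : Measurable fun θ : ℝ => ENNReal.ofReal (Real.sin θ ^ d)).mul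
      (hφ.comp (by fun_prop))
  have hRm : Measurable fun R : ℝ => ENNReal.ofReal (R ^ (d + 1)) := by fun_prop
  calc _ = (d + 2 : ENNReal) * ∫⁻ s : ℝ, σ * ∫⁻ r : ℝ, F (s, r) := by
        rw [lintegral_surfaceMeasure (G := fun y : EuclideanSpace ℝ (Fin (d + 2)) => φ (y 0))
          (hφ.comp (by fun_prop)), hcone, lintegral_first_coord (d + 1) hg]
        simp only [hinner, finrank_euclideanSpace, Fintype.card_fin, F]
        push_cast
        rfl
    _ = (d + 2 : ENNReal) * (σ * ∫⁻ p : ℝ × ℝ, F p) := by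
        rw [Measure.volume_eq_prod, lintegral_prod _ hF.aemeasurable,
          lintegral_const_mul _ hF.lintegral_prod_right']
    _ = (d + 2 : ENNReal) * (σ * (ENNReal.ofReal (1 / (d + 2)) *
          ∫⁻ θ in Ioo 0 Real.pi, ENNReal.ofReal (Real.sin θ ^ d) * φ (Real.cos θ))) := by
        congr 2
        rw [← lintegral_comp_polarCoord_symm, polarCoord_target,
          setLIntegral_congr_fun (measurableSet_Ioi.prod measurableSet_Ioo) hpolar,
          Measure.volume_eq_prod, ← Measure.prod_restrict, lintegral_prod_mul
            (hRm.indicator measurableSet_Ioo).aemeasurable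
            (hφm.indicator measurableSet_Ioo).aemeasurable,
          setLIntegral_indicator measurableSet_Ioo, setLIntegral_indicator measurableSet_Ioo,
          inter_eq_left.2 Ioo_subset_Ioi_self, inter_eq_left.2
            (Ioo_subset_Ioo_left (by linarith [Real.pi_pos])), lintegral_Ioo_pow]
        push_cast
        ring_nf
    _ = _ := by
        rw [show ∀ a b c e : ENNReal, a * (b * (c * e)) = a * c * (b * e) by intros; ring]
        rw [show (d + 2 : ENNReal) = ENNReal.ofReal (d + 2) by
          rw [ENNReal.ofReal_add (by positivity) (by positivity)]; simp,
          ← ENNReal.ofReal_mul (by positivity), mul_one_div_cancel (by positivity)]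
        simp

/-- The distribution on `[-1, 1]` of a coordinate of a point of the unit sphere, up to a
constant. -/
noncomputable def coordMeasure (d : ℕ) : Measure ℝ :=
  ((volume.restrict (Ioo 0 Real.pi)).withDensity fun θ => ENNReal.ofReal (Real.sin θ ^ d)).map
    Real.cos

/-- A reflection taking the first basis vector to `x` preserves the surface measure, so an arbitrary
pole reduces to the first coordinate. -/
theorem map_inner_surfaceMeasure (d : ℕ) (x : EuclideanSpace ℝ (Fin (d + 2))) (hx : ‖x‖ = 1) :
    (surfaceMeasure (EuclideanSpace ℝ (Fin (d + 2)))).map (fun y => inner ℝ x y) =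
      (volume : Measure (EuclideanSpace ℝ (Fin (d + 1)))).toSphere univ • coordMeasure d := by
  set e : EuclideanSpace ℝ (Fin (d + 2)) := EuclideanSpace.single 0 1
  have he : ‖e‖ = ‖x‖ := by simp [e, hx]
  set T := (ℝ ∙ (e - x))ᗮ.reflection
  have hT : T e = x := Submodule.reflection_sub he
  have hinner : ∀ y, inner ℝ x (T y) = y 0 := by
    intro y
    rw [← hT, LinearIsometryEquiv.inner_map_map]
    simp [e, EuclideanSpace.inner_single_left]
  refine Measure.ext_of_lintegral _ fun φ hφ => ?_
  rw [lintegral_map hφ (by fun_prop), lintegral_smul_measure, coordMeasure,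
    lintegral_map hφ (by fun_prop), lintegral_withDensity_eq_lintegral_mul _ (by fun_prop)
      (by fun_prop), ← (measurePreserving_surfaceMeasure T).lintegral_comp (by fun_prop)]
  simp only [hinner]
  rw [lintegral_surfaceMeasure_first_coord d hφ]
  rfl

/-- Integrals over the sphere of zonal functions. -/
theorem integral_zonal (d : ℕ) (x : EuclideanSpace ℝ (Fin (d + 2))) (hx : ‖x‖ = 1)
    {φ : ℝ → ℝ} (hφ : Measurable φ) :
    ∫ y, φ (inner ℝ x y) ∂(surfaceMeasure (EuclideanSpace ℝ (Fin (d + 2)))) =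
      (volume : Measure (EuclideanSpace ℝ (Fin (d + 1)))).toSphere.real univ *
        ∫ θ in Ioo 0 Real.pi, Real.sin θ ^ d * φ (Real.cos θ) := by
  rw [← integral_map (φ := fun y => inner ℝ x y) (f := φ) (by fun_prop)
    hφ.aestronglyMeasurable, map_inner_surfaceMeasure d x hx, integral_smul_measure, coordMeasure,
    integral_map (by fun_prop) hφ.aestronglyMeasurable,
    integral_withDensity_eq_integral_toReal_smul (by fun_prop) (by simp), smul_eq_mul]
  congr 1
  refine setIntegral_congr_fun measurableSet_Ioo fun θ hθ => ?_
  simp only [smul_eq_mul]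
  rw [ENNReal.toReal_ofReal (pow_nonneg (Real.sin_nonneg_of_mem_Icc (Ioo_subset_Icc_self hθ)) _)]

end SphereCoordinate

/-! ### Second-order asymptotics of zonal integrals. -/

section ZonalAsymptotics

/-- Continuous profiles all of whose moments on `(0, ∞)` are finite and which decay faster than
every power. -/
structure RapidDecay (ψ : ℝ → ℝ) : Prop where
  cont : Continuous ψ
  moment : ∀ q : ℕ, 1 ≤ q → IntegrableOn (fun r => |ψ r| * r ^ ((q : ℝ) / 2 - 1)) (Ioi 0)
  decay : ∀ N : ℕ, ∃ M, ∀ r, 0 ≤ r → |ψ r| * r ^ N ≤ M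

namespace RapidDecay

variable {ψ : ℝ → ℝ}

theorem abs (h : RapidDecay ψ) : RapidDecay fun r => |ψ r| where
  cont := h.cont.abs
  moment q hq := by simpa using h.moment q hq
  decay N := by simpa using h.decay N

theorem neg (h : RapidDecay ψ) : RapidDecay fun r => -ψ r where
  cont := h.cont.neg
  moment q hq := by simpa using h.moment q hq
  decay N := by simpa using h.decay N

theorem bounded (h : RapidDecay ψ) : ∃ M, ∀ r, 0 ≤ r → |ψ r| ≤ M := by
  simpa using h.decay 0

theorem sq (h : RapidDecay ψ) : RapidDecay fun r => ψ r ^ 2 := by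
  obtain ⟨B, hB⟩ := h.bounded
  have hB0 : 0 ≤ B := (abs_nonneg _).trans (hB 0 le_rfl)
  refine ⟨h.cont.pow 2, fun q hq => ?_, fun N => ?_⟩
  · refine ((h.moment q hq).const_mul B).mono' ?_ ?_
    · exact (((h.cont.pow 2).abs.measurable).mul (by fun_prop)).aestronglyMeasurable
    · filter_upwards [ae_restrict_mem measurableSet_Ioi] with r hr
      have hr' : 0 < r := hr
      have := hB r hr'.le
      rw [Real.norm_eq_abs, abs_mul, abs_abs, abs_pow, abs_of_nonneg (Real.rpow_nonneg hr'.le _),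
        ← mul_assoc, _root_.sq]
      gcongr
  · obtain ⟨M, hM⟩ := h.decay N
    refine ⟨B * M, fun r hr => ?_⟩
    rw [abs_pow, _root_.sq, mul_assoc]
    exact mul_le_mul (hB r hr) (hM r hr) (by positivity) hB0

/-- Multiplication by `r` raises the moment index `q` by two. Second moments of a zonal kernel are
thereby zonal integrals of another rapidly decaying profile. -/
theorem id_mul (h : RapidDecay ψ) : RapidDecay fun r => r * ψ r := by
  refine ⟨continuous_id.mul h.cont, fun q hq => ?_, fun N => ?_⟩
  · refine (h.moment (q + 2) (by omega)).congr_fun (fun r hr => ?_) measurableSet_Ioi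
    have hr' : 0 < r := hr
    have : ((q + 2 : ℕ) : ℝ) / 2 - 1 = ((q : ℝ) / 2 - 1) + 1 := by push_cast; ring
    simp only [abs_mul, abs_of_pos hr']
    rw [this, Real.rpow_add_one hr'.ne']
    ring
  · obtain ⟨M, hM⟩ := h.decay (N + 1)
    refine ⟨M, fun r hr => ?_⟩
    rw [abs_mul, abs_of_nonneg hr]
    calc _ = |ψ r| * r ^ (N + 1) := by ring
      _ ≤ M := hM r hr

theorem integrableOn_rpow (h : RapidDecay ψ) {q : ℕ} (hq : 1 ≤ q) :
    IntegrableOn (fun r => ψ r * r ^ ((q : ℝ) / 2 - 1)) (Ioi 0) := by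
  refine (h.moment q hq).mono' ?_ ?_
  · exact (h.cont.measurable.mul (by fun_prop)).aestronglyMeasurable
  · filter_upwards [ae_restrict_mem measurableSet_Ioi] with r hr
    have hr' : 0 < r := hr
    rw [Real.norm_eq_abs, abs_mul, abs_of_nonneg (Real.rpow_nonneg hr'.le _)]

end RapidDecay

/-- Controls the Jacobian factor `(2 - h²r)^a` against its limit. The base stays in `[1, 2]`, away
from the singularity present when `a < 0`, so the mean value inequality applies. -/
theorem exists_rpow_sub_le (a : ℝ) :
    ∃ L, 0 ≤ L ∧ ∀ s ∈ Icc (0 : ℝ) 1, |(2 - s) ^ a - 2 ^ a| ≤ L * s := by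
  obtain ⟨L, hL⟩ := isCompact_Icc.exists_bound_of_continuousOn
    (f := fun x : ℝ => a * x ^ (a - 1)) (s := Icc 1 2)
    (by
      refine continuousOn_const.mul (continuousOn_id.rpow_const fun x hx => Or.inl ?_)
      have : (1 : ℝ) ≤ x := hx.1
      simp only [id]
      positivity)
  refine ⟨L, (norm_nonneg _).trans (hL 1 (by simp)), fun s hs => ?_⟩
  have := (convex_Icc (1 : ℝ) 2).norm_image_sub_le_of_norm_hasDerivWithin_le
    (f := fun x : ℝ => x ^ a) (f' := fun x => a * x ^ (a - 1)) (C := L)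
    (fun x hx => (Real.hasDerivAt_rpow_const (Or.inl (by linarith [hx.1]))).hasDerivWithinAt)
    hL (x := 2) (y := 2 - s) (by norm_num) ⟨by linarith [hs.2], by linarith [hs.1]⟩
  simpa [abs_of_nonneg hs.1] using this

/-- Stopping the substitution at the equator keeps `h²r < 1`, so that `2 - h²r` never approaches
zero. -/
theorem image_one_sub_cos_div {h : ℝ} (hh : 0 < h) :
    (fun θ => (1 - Real.cos θ) / h ^ 2) '' Ioo 0 (Real.pi / 2) = Ioo 0 (1 / h ^ 2) := by
  have hh2 : 0 < h ^ 2 := by positivity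
  ext r
  constructor
  · rintro ⟨θ, hθ, rfl⟩
    have h1 : Real.cos θ < 1 := by
      simpa using Real.cos_lt_cos_of_nonneg_of_le_pi_div_two le_rfl hθ.2.le hθ.1
    have h2 : 0 < Real.cos θ := Real.cos_pos_of_mem_Ioo ⟨by linarith [hθ.1, Real.pi_pos], hθ.2⟩
    refine ⟨div_pos (by linarith) hh2, ?_⟩
    simp only
    gcongr
    linarith
  · rintro ⟨h0, h1⟩
    rw [lt_div_iff₀ hh2] at h1
    have h0' : 0 < r * h ^ 2 := mul_pos h0 hh2
    refine ⟨Real.arccos (1 - r * h ^ 2), ⟨?_, ?_⟩, ?_⟩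
    · exact Real.arccos_pos.2 (by linarith)
    · exact Real.arccos_lt_pi_div_two.2 (by linarith)
    · simp only
      rw [Real.cos_arccos (by linarith) (by linarith)]
      field_simp
      ring

/-- The change of variables `r = (1 - cos θ) / h²` on the hemisphere. -/
theorem integral_sin_pow_mul_hemisphere (d : ℕ) (ψ : ℝ → ℝ) {h : ℝ} (hh : 0 < h) :
    ∫ θ in Ioo 0 (Real.pi / 2), Real.sin θ ^ d * ψ ((1 - Real.cos θ) / h ^ 2) =
      h ^ (d + 1) * ∫ r in Ioo 0 (1 / h ^ 2),
        ψ r * (r * (2 - h ^ 2 * r)) ^ (((d + 1 : ℕ) : ℝ) / 2 - 1) := by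
  rw [← image_one_sub_cos_div hh, integral_image_eq_integral_abs_deriv_smul measurableSet_Ioo
    (f' := fun θ => Real.sin θ / h ^ 2), ← integral_const_mul]
  · refine setIntegral_congr_fun measurableSet_Ioo fun θ hθ => ?_
    have hs : 0 < Real.sin θ :=
      Real.sin_pos_of_pos_of_lt_pi hθ.1 (by linarith [hθ.2, Real.pi_pos])
    -- This is `sin² θ = (1 - cos θ)(1 + cos θ)` divided by `h²`, with `1 + cos θ = 2 - h²r`.
    have e1 : (1 - Real.cos θ) / h ^ 2 * (2 - h ^ 2 * ((1 - Real.cos θ) / h ^ 2)) =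
        (Real.sin θ / h) ^ (2 : ℝ) := by
      rw [Real.rpow_two]
      field_simp
      linear_combination -Real.sin_sq_add_cos_sq θ
    have e2 : (2 : ℝ) * (((d + 1 : ℕ) : ℝ) / 2 - 1) = (d : ℝ) - 1 := by push_cast; ring
    simp only [smul_eq_mul]
    rw [e1, ← Real.rpow_mul (by positivity), e2, Real.rpow_sub_one (by positivity),
      Real.rpow_natCast, abs_of_pos (by positivity), div_pow]
    field_simp
    ring
  · intro θ _
    have := ((Real.hasDerivAt_cos θ).const_sub 1).div_const (h ^ 2)
    simpa using this.hasDerivWithinAt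
  · intro a ha b hb hab
    have : Real.cos a = Real.cos b := by
      simp only at hab
      field_simp at hab
      linarith
    exact Real.injOn_cos ⟨ha.1.le, by linarith [ha.2, Real.pi_pos]⟩
      ⟨hb.1.le, by linarith [hb.2, Real.pi_pos]⟩ this

/-- Second-order expansion of the integral of a zonal function concentrating at a pole. -/
theorem exists_sin_pow_integral_sub_le (d : ℕ) {ψ : ℝ → ℝ} (hψ : RapidDecay ψ) :
    ∃ C, ∀ h ∈ Ioc (0 : ℝ) 1,
      |(∫ θ in Ioo 0 Real.pi, Real.sin θ ^ d * ψ ((1 - Real.cos θ) / h ^ 2)) / h ^ (d + 1) -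
        2 ^ (((d + 1 : ℕ) : ℝ) / 2 - 1) *
          ∫ r in Ioi (0 : ℝ), ψ r * r ^ (((d + 1 : ℕ) : ℝ) / 2 - 1)| ≤ C * h ^ 2 := by
  set a : ℝ := ((d + 1 : ℕ) : ℝ) / 2 - 1 with ha
  obtain ⟨L, hL0, hL⟩ := exists_rpow_sub_le a
  -- On the far hemisphere `r ≥ 1/h²`, so decay of order `d + 3` gives at most `M h^(2(d+3)) ≤ M
  -- h^(d+3)`; division by `h^(d+1)` leaves `O(h²)`.
  obtain ⟨M, hM⟩ := hψ.decay (d + 3)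
  have hM0 : 0 ≤ M := (mul_nonneg (abs_nonneg _) (by positivity)).trans (hM 1 (by norm_num))
  have hint : IntegrableOn (fun r => ψ r * r ^ a) (Ioi 0) := hψ.integrableOn_rpow (by omega)
  have hint1 : IntegrableOn (fun r => |ψ r| * r ^ (a + 1)) (Ioi 0) := by
    have := hψ.moment (d + 3) (by omega)
    rwa [show ((d + 3 : ℕ) : ℝ) / 2 - 1 = a + 1 by rw [ha]; push_cast; ring] at this
  set I1 := ∫ r in Ioi (0 : ℝ), |ψ r| * r ^ (a + 1) with hI1
  have hpos : ∀ r ∈ Ioi (0 : ℝ), 0 ≤ |ψ r| * r ^ (a + 1) := fun r hr =>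
    mul_nonneg (abs_nonneg _) (Real.rpow_nonneg (le_of_lt hr) _)
  have hI10 : 0 ≤ I1 := setIntegral_nonneg measurableSet_Ioi hpos
  have hmono : ∀ s ⊆ Ioi (0 : ℝ), MeasurableSet s →
      ∫ r in s, |ψ r| * r ^ (a + 1) ≤ I1 := fun s hs hsm =>
    setIntegral_mono_set hint1 ((ae_restrict_mem measurableSet_Ioi).mono hpos)
      (Eventually.of_forall hs)
  -- The three terms account for the far hemisphere, the Jacobian error on the near one, and the
  -- tail of the limit integral beyond `1/h²`.
  refine ⟨Real.pi / 2 * M + L * I1 + 2 ^ a * I1, fun h hh => ?_⟩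
  have hh0 : 0 < h := hh.1
  have hh1 : h ≤ 1 := hh.2
  have hT : 0 < 1 / h ^ 2 := by positivity
  have hcont : Continuous fun θ : ℝ => Real.sin θ ^ d * ψ ((1 - Real.cos θ) / h ^ 2) :=
    (Real.continuous_sin.pow d).mul (hψ.cont.comp (by fun_prop))
  have hintc : ∀ u v : ℝ, IntegrableOn (fun θ : ℝ => Real.sin θ ^ d *
      ψ ((1 - Real.cos θ) / h ^ 2)) (Ioo u v) := fun u v =>
    (hcont.continuousOn.integrableOn_Icc (a := u) (b := v)).mono_set Ioo_subset_Icc_self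
  have hintc' : ∀ u v : ℝ, IntegrableOn (fun θ : ℝ => Real.sin θ ^ d *
      ψ ((1 - Real.cos θ) / h ^ 2)) (Ico u v) := fun u v =>
    (hcont.continuousOn.integrableOn_Icc (a := u) (b := v)).mono_set Ico_subset_Icc_self
  -- the far hemisphere
  have hfar : |∫ θ in Ico (Real.pi / 2) Real.pi, Real.sin θ ^ d *
      ψ ((1 - Real.cos θ) / h ^ 2)| ≤ Real.pi / 2 * M * h ^ (d + 3) := by
    have hb : ∀ θ ∈ Ico (Real.pi / 2) Real.pi,
        ‖Real.sin θ ^ d * ψ ((1 - Real.cos θ) / h ^ 2)‖ ≤ M * h ^ (d + 3) := by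
      intro θ hθ
      have hc : Real.cos θ ≤ 0 := Real.cos_nonpos_of_pi_div_two_le_of_le hθ.1
        (by linarith [hθ.2, Real.pi_pos])
      set r := (1 - Real.cos θ) / h ^ 2
      have hr : 1 / h ^ 2 ≤ r := by
        simp only [r]
        gcongr
        linarith
      have h1 := hM r (hT.le.trans hr)
      have h2 : |ψ r| * (1 / h ^ 2) ^ (d + 3) ≤ M := le_trans (by gcongr) h1
      have h3 : |ψ r| ≤ M * (h ^ 2) ^ (d + 3) := by
        rwa [one_div, inv_pow, ← div_eq_mul_inv, div_le_iff₀ (by positivity)] at h2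
      have h4 : (h ^ 2) ^ (d + 3) ≤ h ^ (d + 3) := by
        gcongr
        nlinarith
      have hs : |Real.sin θ| ^ d ≤ 1 := pow_le_one₀ (abs_nonneg _) (Real.abs_sin_le_one θ)
      rw [norm_mul, norm_pow, Real.norm_eq_abs, Real.norm_eq_abs]
      calc _ ≤ 1 * |ψ r| := by gcongr
        _ ≤ M * (h ^ 2) ^ (d + 3) := by rw [one_mul]; exact h3
        _ ≤ _ := by gcongr
    have := norm_setIntegral_le_of_norm_le_const (μ := volume)
      (s := Ico (Real.pi / 2) Real.pi) (by simp) hb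
    rw [Real.norm_eq_abs] at this
    refine this.trans (le_of_eq ?_)
    rw [Measure.real, Real.volume_Ico, ENNReal.toReal_ofReal (by linarith [Real.pi_pos])]
    ring
  have hsplit : ∫ θ in Ioo 0 Real.pi, Real.sin θ ^ d * ψ ((1 - Real.cos θ) / h ^ 2) =
      (∫ θ in Ioo 0 (Real.pi / 2), Real.sin θ ^ d * ψ ((1 - Real.cos θ) / h ^ 2)) +
      ∫ θ in Ico (Real.pi / 2) Real.pi, Real.sin θ ^ d * ψ ((1 - Real.cos θ) / h ^ 2) := by
    rw [← setIntegral_union _ measurableSet_Ico (hintc _ _) (hintc' _ _),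
      Ioo_union_Ico_eq_Ioo (by linarith [Real.pi_pos]) (by linarith [Real.pi_pos])]
    exact Set.disjoint_left.2 fun θ h1 h2 => absurd h1.2 (not_lt.2 h2.1)
  -- the near hemisphere
  have hdiff : ∀ r ∈ Ioo 0 (1 / h ^ 2),
      |ψ r * (r * (2 - h ^ 2 * r)) ^ a - 2 ^ a * (ψ r * r ^ a)| ≤
        L * h ^ 2 * (|ψ r| * r ^ (a + 1)) := by
    intro r hr
    have hr0 : 0 < r := hr.1
    have hr1 : h ^ 2 * r ≤ 1 := by
      have := hr.2
      rw [lt_div_iff₀ (by positivity)] at this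
      linarith
    have h1 := hL (h ^ 2 * r) ⟨by positivity, hr1⟩
    rw [Real.mul_rpow hr0.le (by linarith), Real.rpow_add_one hr0.ne']
    calc _ = |ψ r| * r ^ a * |(2 - h ^ 2 * r) ^ a - 2 ^ a| := by
          rw [← abs_of_nonneg (Real.rpow_nonneg hr0.le a), ← abs_mul, ← abs_mul,
            abs_of_nonneg (Real.rpow_nonneg hr0.le a)]
          congr 1
          ring
      _ ≤ |ψ r| * r ^ a * (L * (h ^ 2 * r)) := by gcongr
      _ = _ := by ring
  have hnear0 : IntegrableOn (fun r => ψ r * (r * (2 - h ^ 2 * r)) ^ a -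
      2 ^ a * (ψ r * r ^ a)) (Ioo 0 (1 / h ^ 2)) := by
    refine ((hint1.mono_set Ioo_subset_Ioi_self).const_mul (L * h ^ 2)).mono' ?_ ?_
    · have := hψ.cont.measurable
      exact Measurable.aestronglyMeasurable (by fun_prop)
    · filter_upwards [ae_restrict_mem measurableSet_Ioo] with r hr using hdiff r hr
  have hnear : |(∫ r in Ioo 0 (1 / h ^ 2), (ψ r * (r * (2 - h ^ 2 * r)) ^ a -
      2 ^ a * (ψ r * r ^ a)))| ≤ L * h ^ 2 * I1 := by
    rw [← Real.norm_eq_abs]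
    calc _ ≤ ∫ r in Ioo 0 (1 / h ^ 2), L * h ^ 2 * (|ψ r| * r ^ (a + 1)) := by
          refine norm_integral_le_of_norm_le
            ((hint1.mono_set Ioo_subset_Ioi_self).const_mul (L * h ^ 2)) ?_
          filter_upwards [ae_restrict_mem measurableSet_Ioo] with r hr using hdiff r hr
      _ ≤ _ := by
          rw [integral_const_mul]
          gcongr
          exact hmono _ Ioo_subset_Ioi_self measurableSet_Ioo
  -- Beyond `1/h²` one has `1 ≤ h² r`, which trades one extra power of `r` for the factor `h²`.
  have htail : |∫ r in Ici (1 / h ^ 2), ψ r * r ^ a| ≤ h ^ 2 * I1 := by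
    have hsub : Ici (1 / h ^ 2) ⊆ Ioi (0 : ℝ) := fun r hr => hT.trans_le hr
    rw [← Real.norm_eq_abs]
    calc _ ≤ ∫ r in Ici (1 / h ^ 2), h ^ 2 * (|ψ r| * r ^ (a + 1)) := by
          refine norm_integral_le_of_norm_le ((hint1.mono_set hsub).const_mul (h ^ 2)) ?_
          filter_upwards [ae_restrict_mem measurableSet_Ici] with r hr
          have hr0 : 0 < r := hsub hr
          have hr1 : 1 ≤ h ^ 2 * r := by
            have : 1 / h ^ 2 ≤ r := hr
            rw [div_le_iff₀ (by positivity)] at this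
            linarith
          rw [norm_mul, Real.norm_eq_abs, Real.norm_eq_abs,
            abs_of_nonneg (Real.rpow_nonneg hr0.le a), Real.rpow_add_one hr0.ne']
          calc _ = (|ψ r| * r ^ a) * 1 := by ring
            _ ≤ (|ψ r| * r ^ a) * (h ^ 2 * r) := by gcongr
            _ = _ := by ring
      _ ≤ _ := by
          rw [integral_const_mul]
          gcongr
          exact hmono _ hsub measurableSet_Ici
  have hsplit2 : ∫ r in Ioi (0 : ℝ), ψ r * r ^ a =
      (∫ r in Ioo 0 (1 / h ^ 2), ψ r * r ^ a) + ∫ r in Ici (1 / h ^ 2), ψ r * r ^ a := by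
    rw [← setIntegral_union _ measurableSet_Ici (hint.mono_set Ioo_subset_Ioi_self)
      (hint.mono_set fun r hr => hT.trans_le hr), Ioo_union_Ici_eq_Ioi hT]
    exact Set.disjoint_left.2 fun θ h1 h2 => absurd h1.2 (not_lt.2 h2)
  have hnear1 : IntegrableOn (fun r => 2 ^ a * (ψ r * r ^ a)) (Ioo 0 (1 / h ^ 2)) :=
    (hint.mono_set Ioo_subset_Ioi_self).const_mul _
  have hnear2 : IntegrableOn (fun r => ψ r * (r * (2 - h ^ 2 * r)) ^ a) (Ioo 0 (1 / h ^ 2)) := by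
    refine (hnear0.add hnear1).congr_fun (fun r _ => ?_) measurableSet_Ioo
    simp
  rw [integral_sub hnear2 hnear1, integral_const_mul] at hnear
  rw [hsplit, integral_sin_pow_mul_hemisphere d ψ hh0, ← ha, hsplit2, add_div,
    mul_div_cancel_left₀ _ (by positivity)]
  set A := ∫ r in Ioo 0 (1 / h ^ 2), ψ r * (r * (2 - h ^ 2 * r)) ^ a
  set B := ∫ r in Ioo 0 (1 / h ^ 2), ψ r * r ^ a
  set T := ∫ r in Ici (1 / h ^ 2), ψ r * r ^ a
  set F := ∫ θ in Ico (Real.pi / 2) Real.pi, Real.sin θ ^ d * ψ ((1 - Real.cos θ) / h ^ 2)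
  have hF : |F / h ^ (d + 1)| ≤ Real.pi / 2 * M * h ^ 2 := by
    rw [abs_div, abs_of_pos (by positivity : 0 < h ^ (d + 1)), div_le_iff₀ (by positivity)]
    calc _ ≤ _ := hfar
      _ = _ := by ring
  have hT2 : |2 ^ a * T| ≤ 2 ^ a * (h ^ 2 * I1) := by
    rw [abs_mul, abs_of_nonneg (by positivity : (0 : ℝ) ≤ 2 ^ a)]
    gcongr
  calc |A + F / h ^ (d + 1) - 2 ^ a * (B + T)|
      = |(A - 2 ^ a * B) + F / h ^ (d + 1) - 2 ^ a * T| := by congr 1; ring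
    _ ≤ |A - 2 ^ a * B| + |F / h ^ (d + 1)| + |2 ^ a * T| :=
        (abs_sub _ _).trans (by gcongr; exact abs_add_le _ _)
    _ ≤ L * h ^ 2 * I1 + Real.pi / 2 * M * h ^ 2 + 2 ^ a * (h ^ 2 * I1) := by gcongr
    _ = _ := by ring

end ZonalAsymptotics

/-! ### Approximate kernels, and zonal kernels as examples. -/

section ApproxKernel

/-- A weight function concentrated near `x` at scale `h` in dimension `D`, of approximate mass
`w₀`, with quantitative moment bounds. -/
structure ApproxKernel {E : Type*} [NormedAddCommGroup E] [NormedSpace ℝ E] [MeasurableSpace E]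
    (μ : Measure E) (x : E) (D : ℕ) (W : E → ℝ) (w₀ C h : ℝ) : Prop where
  cont : Continuous W
  int : Integrable W μ
  int_second : Integrable (fun y => |W y| * ‖y - x‖ ^ 2) μ
  int_sq : Integrable (fun y => W y ^ 2) μ
  int_sq_second : Integrable (fun y => W y ^ 2 * ‖y - x‖ ^ 2) μ
  mass : |∫ y, W y ∂μ - w₀| ≤ C * h ^ 2
  first : ‖∫ y, W y • (y - x) ∂μ‖ ≤ C * h ^ 2
  second : ∫ y, |W y| * ‖y - x‖ ^ 2 ∂μ ≤ C * h ^ 2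
  abs : ∫ y, |W y| ∂μ ≤ C
  sq : ∫ y, W y ^ 2 ∂μ ≤ C / h ^ D
  sq_second : ∫ y, W y ^ 2 * ‖y - x‖ ^ 2 ∂μ ≤ C * h ^ 2 / h ^ D

/-- Quotients of quantities converging at rate `h²` converge at rate `h²`. -/
theorem exists_div_sub_div_le {A B : ℝ → ℝ} {α β Ca Cb : ℝ} (hβ : 0 < β)
    (hA : ∀ h ∈ Ioc (0 : ℝ) 1, |A h - α| ≤ Ca * h ^ 2)
    (hB : ∀ h ∈ Ioc (0 : ℝ) 1, |B h - β| ≤ Cb * h ^ 2) :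
    ∃ C, ∀ᶠ h in 𝓝[>] (0 : ℝ), β / 2 ≤ B h ∧ |A h / B h - α / β| ≤ C * h ^ 2 := by
  have hCa : 0 ≤ Ca := by simpa using (abs_nonneg _).trans (hA 1 (by simp))
  have hCb : 0 ≤ Cb := by simpa using (abs_nonneg _).trans (hB 1 (by simp))
  refine ⟨(Ca * β + |α| * Cb) / (β / 2 * β), ?_⟩
  have h1 : ∀ᶠ h in 𝓝[>] (0 : ℝ), Cb * h ^ 2 < β / 2 := by
    have : Tendsto (fun h : ℝ => Cb * h ^ 2) (𝓝[>] 0) (𝓝 (Cb * 0 ^ 2)) :=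
      ((continuous_const.mul (continuous_id.pow 2)).tendsto 0).mono_left nhdsWithin_le_nhds
    exact this.eventually (gt_mem_nhds (by simpa using by linarith))
  filter_upwards [h1, Ioc_mem_nhdsGT (zero_lt_one (α := ℝ))] with h h2 hh
  have hb := hB h hh
  have ha := hA h hh
  have hBl : β / 2 ≤ B h := by linarith [(abs_le.1 hb).1]
  have hB0 : 0 < B h := by linarith
  refine ⟨hBl, ?_⟩
  have e : A h / B h - α / β = ((A h - α) * β - α * (B h - β)) / (B h * β) := by
    field_simp
    ring
  rw [e, abs_div, abs_of_pos (mul_pos hB0 hβ), div_mul_eq_mul_div]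
  have hn : |(A h - α) * β - α * (B h - β)| ≤ (Ca * β + |α| * Cb) * h ^ 2 := by
    calc _ ≤ |(A h - α) * β| + |α * (B h - β)| := abs_sub _ _
      _ = |A h - α| * β + |α| * |B h - β| := by rw [abs_mul, abs_mul, abs_of_pos hβ]
      _ ≤ Ca * h ^ 2 * β + |α| * (Cb * h ^ 2) := by gcongr
      _ = _ := by ring
  gcongr

variable {d : ℕ}

local notation "𝔼" => EuclideanSpace ℝ (Fin (d + 2))

/-- Unit vectors satisfy `‖x - y‖² = 2(1 - ⟨x, y⟩)`, so the directional argument of `L` and the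
linear argument of `k` are the same function of the distance. Both geometries can then share one
kernel formula. -/
theorem norm_sub_sq_div_of_mem_sphere {x y : 𝔼} (hx : ‖x‖ = 1) (hy : ‖y‖ = 1) (h : ℝ) :
    ‖x - y‖ ^ 2 / (2 * h ^ 2) = (1 - inner ℝ x y) / h ^ 2 := by
  rw [norm_sub_sq_real, hx, hy, show (1 : ℝ) ^ 2 - 2 * inner ℝ x y + 1 ^ 2 =
    2 * (1 - inner ℝ x y) by ring, mul_div_mul_left _ _ two_ne_zero]

/-- The integral over the sphere of a profile of the scaled squared distance to a point. -/
noncomputable def zonalIntegral (d : ℕ) (ψ : ℝ → ℝ) (h : ℝ) : ℝ :=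
  (volume : Measure (EuclideanSpace ℝ (Fin (d + 1)))).toSphere.real univ *
    ∫ θ in Ioo 0 Real.pi, Real.sin θ ^ d * ψ ((1 - Real.cos θ) / h ^ 2)

theorem integral_sphere_profile {ψ : ℝ → ℝ} (hψ : Continuous ψ) {x : 𝔼} (hx : ‖x‖ = 1) (h : ℝ) :
    ∫ y, ψ (‖x - y‖ ^ 2 / (2 * h ^ 2)) ∂(surfaceMeasure 𝔼) = zonalIntegral d ψ h := by
  have hm := hψ.measurable
  rw [zonalIntegral, ← integral_zonal d x hx (φ := fun t => ψ ((1 - t) / h ^ 2)) (by fun_prop)]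
  refine integral_congr_ae ?_
  filter_upwards [ae_surfaceMeasure_mem_sphere] with y hy
  rw [norm_sub_sq_div_of_mem_sphere hx (by simpa using hy)]

theorem exists_zonalIntegral_sub_le (d : ℕ) {ψ : ℝ → ℝ} (hψ : RapidDecay ψ) :
    ∃ C, ∀ h ∈ Ioc (0 : ℝ) 1, |zonalIntegral d ψ h / h ^ (d + 1) -
      (volume : Measure (EuclideanSpace ℝ (Fin (d + 1)))).toSphere.real univ *
      (2 ^ (((d + 1 : ℕ) : ℝ) / 2 - 1) *
          ∫ r in Ioi (0 : ℝ), ψ r * r ^ (((d + 1 : ℕ) : ℝ) / 2 - 1))| ≤ C * h ^ 2 := by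
  obtain ⟨C, hC⟩ := exists_sin_pow_integral_sub_le d hψ
  set S := (volume : Measure (EuclideanSpace ℝ (Fin (d + 1)))).toSphere.real univ with hS
  have hS0 : 0 ≤ S := measureReal_nonneg
  refine ⟨S * C, fun h hh => ?_⟩
  rw [zonalIntegral, ← hS, mul_div_assoc, ← mul_sub, abs_mul, abs_of_nonneg hS0, mul_assoc]
  gcongr
  exact hC h hh

theorem exists_zonalIntegral_le (d : ℕ) {ψ : ℝ → ℝ} (hψ : RapidDecay ψ) :
    ∃ C, 0 ≤ C ∧ ∀ h ∈ Ioc (0 : ℝ) 1, zonalIntegral d ψ h ≤ C * h ^ (d + 1) := by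
  obtain ⟨C, hC⟩ := exists_zonalIntegral_sub_le d hψ
  set J := (volume : Measure (EuclideanSpace ℝ (Fin (d + 1)))).toSphere.real univ *
      (2 ^ (((d + 1 : ℕ) : ℝ) / 2 - 1) *
          ∫ r in Ioi (0 : ℝ), ψ r * r ^ (((d + 1 : ℕ) : ℝ) / 2 - 1))
  have hC0 : 0 ≤ C := by simpa using (abs_nonneg _).trans (hC 1 (by simp))
  refine ⟨|J| + C, by positivity, fun h hh => ?_⟩
  have h0 : 0 < h := hh.1
  have h1 := (abs_le.1 (hC h hh)).2
  rw [← div_le_iff₀ (by positivity)]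
  have : C * h ^ 2 ≤ C * 1 := by
    gcongr
    exact pow_le_one₀ hh.1.le hh.2
  linarith [le_abs_self J]

/-- The first moment of a zonal weight points in the direction of the pole. -/
theorem norm_integral_zonal_smul_sub_le {ψ : ℝ → ℝ} (hψ : Continuous ψ) {x : 𝔼} (hx : ‖x‖ = 1) :
    ‖∫ y, ψ (‖x - y‖ ^ 2) • (y - x) ∂(surfaceMeasure 𝔼)‖ ≤
      ∫ y, |ψ (‖x - y‖ ^ 2)| * ‖y - x‖ ^ 2 ∂(surfaceMeasure 𝔼) := by
  -- Reflection in the axis through `x` preserves the weight and the measure while reversing the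
  -- tangential part of `y - x`.
  set T := (ℝ ∙ x).reflection with hT
  have hTx : T x = x := Submodule.reflection_mem_subspace_eq_self
    (Submodule.mem_span_singleton_self x)
  have hTy : ∀ y, T y = (2 * inner ℝ x y) • x - y := by
    intro y
    rw [hT, Submodule.reflection_singleton_apply, hx]
    simp [two_smul, two_mul, add_smul]
  have hnorm : ∀ y, ‖x - T y‖ = ‖x - y‖ := by
    intro y
    conv_lhs => rw [← hTx, ← map_sub]
    exact T.norm_map _
  have hbd : ∀ F : 𝔼 → 𝔼, Continuous F → Integrable F (surfaceMeasure 𝔼) := by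
    intro F hF
    obtain ⟨C, hC⟩ := (isCompact_sphere (0 : 𝔼) 1).exists_bound_of_continuousOn hF.continuousOn
    refine Integrable.of_bound hF.aestronglyMeasurable C ?_
    filter_upwards [ae_surfaceMeasure_mem_sphere] with y hy using hC y hy
  have hi : Integrable (fun y => ψ (‖x - y‖ ^ 2) • (y - x)) (surfaceMeasure 𝔼) :=
    hbd _ (by fun_prop)
  have hiT : Integrable (fun y => ψ (‖x - y‖ ^ 2) • (T y - x)) (surfaceMeasure 𝔼) :=
    hbd _ (by fun_prop)
  have h1 : ∫ y, ψ (‖x - y‖ ^ 2) • (y - x) ∂(surfaceMeasure 𝔼) =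
      ∫ y, ψ (‖x - y‖ ^ 2) • (T y - x) ∂(surfaceMeasure 𝔼) := by
    rw [← (measurePreserving_surfaceMeasure T).integral_comp
      T.toHomeomorph.measurableEmbedding (fun y => ψ (‖x - y‖ ^ 2) • (y - x))]
    simp only [hnorm]
  -- On the sphere `(y - x) + (T y - x) = -‖y - x‖² x`: symmetrization turns the first moment into a
  -- second moment in the direction of the pole.
  have h2 : (2 : ℝ) • ∫ y, ψ (‖x - y‖ ^ 2) • (y - x) ∂(surfaceMeasure 𝔼) =
      ∫ y, -(ψ (‖x - y‖ ^ 2) * ‖y - x‖ ^ 2) • x ∂(surfaceMeasure 𝔼) := by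
    rw [two_smul]
    conv_lhs => arg 2; rw [h1]
    rw [← integral_add hi hiT]
    refine integral_congr_ae ?_
    filter_upwards [ae_surfaceMeasure_mem_sphere] with y hy
    have hy' : ‖y‖ = 1 := by simpa using hy
    have e : ‖y - x‖ ^ 2 = 2 - 2 * inner ℝ x y := by
      rw [norm_sub_sq_real, hx, hy', real_inner_comm]
      ring
    rw [e, hTy]
    module
  have h3 : ‖(2 : ℝ) • ∫ y, ψ (‖x - y‖ ^ 2) • (y - x) ∂(surfaceMeasure 𝔼)‖ ≤
      ∫ y, |ψ (‖x - y‖ ^ 2)| * ‖y - x‖ ^ 2 ∂(surfaceMeasure 𝔼) := by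
    rw [h2]
    refine (norm_integral_le_integral_norm _).trans (le_of_eq ?_)
    refine integral_congr_ae (Eventually.of_forall fun y => ?_)
    simp [norm_smul, hx]
  rw [norm_smul, Real.norm_eq_abs, abs_two] at h3
  linarith [norm_nonneg (∫ y, ψ (‖x - y‖ ^ 2) • (y - x) ∂(surfaceMeasure 𝔼))]

/-- Normalized zonal kernels on the sphere are approximate kernels. -/
theorem exists_approxKernel_sphere {L ψ : ℝ → ℝ} (hL : RapidDecay L) (hψ : RapidDecay ψ)
    (hLpos : 0 < ∫ r in Ioi (0 : ℝ), L r * r ^ (((d + 1 : ℕ) : ℝ) / 2 - 1))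
    {x : 𝔼} (hx : ‖x‖ = 1) :
    ∃ C, ∀ᶠ h in 𝓝[>] (0 : ℝ), ApproxKernel (surfaceMeasure 𝔼) x (d + 1)
      (fun y => (zonalIntegral d L h)⁻¹ * ψ (‖x - y‖ ^ 2 / (2 * h ^ 2)))
      ((∫ r in Ioi (0 : ℝ), ψ r * r ^ (((d + 1 : ℕ) : ℝ) / 2 - 1)) /
        ∫ r in Ioi (0 : ℝ), L r * r ^ (((d + 1 : ℕ) : ℝ) / 2 - 1)) C h := by
  obtain ⟨CL, hCL⟩ := exists_zonalIntegral_sub_le d hL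
  obtain ⟨Cψ, hCψ⟩ := exists_zonalIntegral_sub_le d hψ
  set S := (volume : Measure (EuclideanSpace ℝ (Fin (d + 1)))).toSphere.real univ
  have hS : 0 < S := by
    have : (volume : Measure (EuclideanSpace ℝ (Fin (d + 1)))).toSphere ≠ 0 :=
      Measure.toSphere_ne_zero _
    have : NeZero (volume : Measure (EuclideanSpace ℝ (Fin (d + 1)))).toSphere := ⟨this⟩
    exact measureReal_univ_pos
  set IL := ∫ r in Ioi (0 : ℝ), L r * r ^ (((d + 1 : ℕ) : ℝ) / 2 - 1)
  set Iψ := ∫ r in Ioi (0 : ℝ), ψ r * r ^ (((d + 1 : ℕ) : ℝ) / 2 - 1)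
  -- The factor common to the limits of both zonal integrals; it cancels in the normalized mass.
  set κ := S * (2 ^ (((d + 1 : ℕ) : ℝ) / 2 - 1)) with hκ
  have hκ0 : 0 < κ := by positivity
  simp only [← mul_assoc] at hCL hCψ
  rw [← hκ] at hCL hCψ
  obtain ⟨C0, hC0⟩ := exists_div_sub_div_le (mul_pos hκ0 hLpos) hCψ hCL
  obtain ⟨C1, hC1, hb1⟩ := exists_zonalIntegral_le d hψ.abs
  obtain ⟨C2, hC2, hb2⟩ := exists_zonalIntegral_le d hψ.abs.id_mul
  obtain ⟨C3, hC3, hb3⟩ := exists_zonalIntegral_le d hψ.sq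
  obtain ⟨C4, hC4, hb4⟩ := exists_zonalIntegral_le d hψ.sq.id_mul
  -- For small `h` the normalizing integral is at least half its limit, so `B / h^(d+1)` bounds the
  -- normalizing constant.
  set B := (κ * IL / 2)⁻¹ with hB
  have hB0 : 0 < B := by positivity
  refine ⟨max C0 (max (2 * B * C2) (max (B * C1) (max (B ^ 2 * C3) (2 * B ^ 2 * C4)))), ?_⟩
  filter_upwards [hC0, Ioc_mem_nhdsGT (zero_lt_one (α := ℝ))] with h hh hh1
  obtain ⟨hlow, hratio⟩ := hh
  have hh0 : 0 < h := hh1.1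
  have hhD : 0 < h ^ (d + 1) := by positivity
  set J := zonalIntegral d L h
  have hJ : κ * IL / 2 * h ^ (d + 1) ≤ J := by rwa [le_div_iff₀ hhD] at hlow
  have hJ0 : 0 < J := lt_of_lt_of_le (by positivity) hJ
  have hJinv : J⁻¹ ≤ B / h ^ (d + 1) := by
    rw [hB, div_eq_mul_inv, ← mul_inv]
    exact inv_anti₀ (by positivity) hJ
  have hJi0 : 0 < J⁻¹ := inv_pos.2 hJ0
  have hbd : ∀ F : 𝔼 → ℝ, Continuous F → Integrable F (surfaceMeasure 𝔼) := by
    intro F hF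
    obtain ⟨C, hC⟩ := (isCompact_sphere (0 : 𝔼) 1).exists_bound_of_continuousOn hF.continuousOn
    refine Integrable.of_bound hF.aestronglyMeasurable C ?_
    filter_upwards [ae_surfaceMeasure_mem_sphere] with y hy using hC y hy
  have hψc := hψ.cont
  set C := max C0 (max (2 * B * C2) (max (B * C1) (max (B ^ 2 * C3) (2 * B ^ 2 * C4)))) with hC
  have hle0 : C0 ≤ C := le_max_left _ _
  have hle1 : 2 * B * C2 ≤ C := (le_max_left _ _).trans (le_max_right _ _)
  have hle2 : B * C1 ≤ C :=
    (le_max_left _ _).trans ((le_max_right _ _).trans (le_max_right _ _))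
  have hle3 : B ^ 2 * C3 ≤ C := (le_max_left _ _).trans
    ((le_max_right _ _).trans ((le_max_right _ _).trans (le_max_right _ _)))
  have hle4 : 2 * B ^ 2 * C4 ≤ C := (le_max_right _ _).trans
    ((le_max_right _ _).trans ((le_max_right _ _).trans (le_max_right _ _)))
  -- Each factor `‖y - x‖²` becomes `2h²` times the argument of the profile, so `id_mul` handles the
  -- second moments.
  have hscale : ∀ y : 𝔼, ‖y - x‖ ^ 2 = 2 * h ^ 2 * (‖x - y‖ ^ 2 / (2 * h ^ 2)) := by
    intro y
    rw [norm_sub_rev]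
    field_simp
  have hsecond : ∫ y : 𝔼, |J⁻¹ * ψ (‖x - y‖ ^ 2 / (2 * h ^ 2))| * ‖y - x‖ ^ 2
      ∂(surfaceMeasure 𝔼) ≤ 2 * B * C2 * h ^ 2 := by
    have e : ∀ y : 𝔼, |J⁻¹ * ψ (‖x - y‖ ^ 2 / (2 * h ^ 2))| * ‖y - x‖ ^ 2 =
        (J⁻¹ * (2 * h ^ 2)) * ((fun r => r * |ψ r|) (‖x - y‖ ^ 2 / (2 * h ^ 2))) := by
      intro y
      rw [hscale y, abs_mul, abs_of_pos hJi0]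
      ring
    simp only [e]
    rw [integral_const_mul, integral_sphere_profile hψ.abs.id_mul.cont hx]
    calc _ ≤ J⁻¹ * (2 * h ^ 2) * (C2 * h ^ (d + 1)) := by
          gcongr
          exact hb2 h hh1
      _ ≤ B / h ^ (d + 1) * (2 * h ^ 2) * (C2 * h ^ (d + 1)) := by
          gcongr
      _ = _ := by field_simp
  refine ⟨by fun_prop, hbd _ (by fun_prop), hbd _ (by fun_prop), hbd _ (by fun_prop),
    hbd _ (by fun_prop), ?_, ?_, ?_, ?_, ?_, ?_⟩
  · rw [integral_const_mul, integral_sphere_profile hψ.cont hx]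
    have e : J⁻¹ * zonalIntegral d ψ h - Iψ / IL =
        zonalIntegral d ψ h / h ^ (d + 1) / (J / h ^ (d + 1)) - κ * Iψ / (κ * IL) := by
      field_simp
    rw [e]
    exact hratio.trans (by gcongr)
  · have := norm_integral_zonal_smul_sub_le
      (ψ := fun s => J⁻¹ * ψ (s / (2 * h ^ 2))) (by have := hψ.cont; fun_prop) hx
    exact this.trans (hsecond.trans (by gcongr))
  · exact hsecond.trans (by gcongr)
  · simp only [abs_mul, abs_of_pos hJi0]
    rw [integral_const_mul, integral_sphere_profile hψ.abs.cont hx]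
    calc _ ≤ J⁻¹ * (C1 * h ^ (d + 1)) := by
          gcongr
          exact hb1 h hh1
      _ ≤ B / h ^ (d + 1) * (C1 * h ^ (d + 1)) := by
          gcongr
      _ = B * C1 := by field_simp
      _ ≤ C := hle2
  · simp only [mul_pow]
    rw [integral_const_mul, integral_sphere_profile hψ.sq.cont hx]
    calc _ ≤ J⁻¹ ^ 2 * (C3 * h ^ (d + 1)) := by
          gcongr
          exact hb3 h hh1
      _ ≤ (B / h ^ (d + 1)) ^ 2 * (C3 * h ^ (d + 1)) := by
          gcongr
      _ = B ^ 2 * C3 / h ^ (d + 1) := by field_simp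
      _ ≤ _ := by gcongr
  · have e : ∀ y : 𝔼, (J⁻¹ * ψ (‖x - y‖ ^ 2 / (2 * h ^ 2))) ^ 2 * ‖y - x‖ ^ 2 =
        (J⁻¹ ^ 2 * (2 * h ^ 2)) * ((fun r => r * ψ r ^ 2) (‖x - y‖ ^ 2 / (2 * h ^ 2))) := by
      intro y
      rw [hscale y]
      ring
    simp only [e]
    rw [integral_const_mul, integral_sphere_profile hψ.sq.id_mul.cont hx]
    calc _ ≤ J⁻¹ ^ 2 * (2 * h ^ 2) * (C4 * h ^ (d + 1)) := by
          gcongr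
          exact hb4 h hh1
      _ ≤ (B / h ^ (d + 1)) ^ 2 * (2 * h ^ 2) * (C4 * h ^ (d + 1)) := by
          gcongr
      _ = 2 * B ^ 2 * C4 * h ^ 2 / h ^ (d + 1) := by field_simp
      _ ≤ _ := by gcongr

end ApproxKernel

/-! ### Rescaled radial kernels on a Euclidean space. -/

section LinearKernel

variable {E : Type*} [NormedAddCommGroup E] [InnerProductSpace ℝ E]
  [MeasurableSpace E] [BorelSpace E] [FiniteDimensional ℝ E]

theorem integral_comp_inv_smul_sub {F : Type*} [NormedAddCommGroup F] [NormedSpace ℝ F]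
    (g : E → F) (x : E) {h : ℝ} (hh : 0 < h) :
    ∫ y, g (h⁻¹ • (x - y)) = h ^ Module.finrank ℝ E • ∫ u, g u := by
  rw [integral_sub_left_eq_self (fun y => g (h⁻¹ • y)) volume x,
    Measure.integral_comp_inv_smul_of_nonneg _ _ hh.le]

theorem integrable_comp_inv_smul_sub {F : Type*} [NormedAddCommGroup F] [NormedSpace ℝ F]
    {g : E → F} (hg : Integrable g) (x : E) {h : ℝ} (hh : 0 < h) :
    Integrable fun y => g (h⁻¹ • (x - y)) :=
  (hg.comp_smul (inv_pos.2 hh).ne').comp_sub_left x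

theorem norm_inv_smul_sq_div_two {E : Type*} [NormedAddCommGroup E] [NormedSpace ℝ E] {x y : E} {h : ℝ} :
    ‖h⁻¹ • (x - y)‖ ^ 2 / 2 = ‖x - y‖ ^ 2 / (2 * h ^ 2) := by
  rw [norm_smul, mul_pow, norm_inv, inv_pow, Real.norm_eq_abs, sq_abs]
  by_cases h0 : h = 0
  · simp [h0]
  · field_simp

/-- Rescaled radial kernels on a Euclidean space are approximate kernels. -/
theorem exists_approxKernel_linear {ψ : ℝ → ℝ} (hψ : Continuous ψ)
    (h0 : Integrable fun u : E => ψ (‖u‖ ^ 2 / 2))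
    (h2 : Integrable fun u : E => |ψ (‖u‖ ^ 2 / 2)| * ‖u‖ ^ 2)
    (hsq : Integrable fun u : E => ψ (‖u‖ ^ 2 / 2) ^ 2)
    (hsq2 : Integrable fun u : E => ψ (‖u‖ ^ 2 / 2) ^ 2 * ‖u‖ ^ 2) (c : ℝ) (x : E) :
    ∃ C, ∀ᶠ h in 𝓝[>] (0 : ℝ), ApproxKernel (volume : Measure E) x (Module.finrank ℝ E)
      (fun y => c / h ^ Module.finrank ℝ E * ψ (‖x - y‖ ^ 2 / (2 * h ^ 2)))
      (c * ∫ u : E, ψ (‖u‖ ^ 2 / 2)) C h := by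
  set D := Module.finrank ℝ E
  set I2 := ∫ u : E, |ψ (‖u‖ ^ 2 / 2)| * ‖u‖ ^ 2
  set I0 := ∫ u : E, |ψ (‖u‖ ^ 2 / 2)|
  set Isq := ∫ u : E, ψ (‖u‖ ^ 2 / 2) ^ 2
  set Isq2 := ∫ u : E, ψ (‖u‖ ^ 2 / 2) ^ 2 * ‖u‖ ^ 2
  have hI2 : 0 ≤ I2 := integral_nonneg fun u => by positivity
  have hI0 : 0 ≤ I0 := integral_nonneg fun u => by positivity
  have hIsq : 0 ≤ Isq := integral_nonneg fun u => by positivity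
  have hIsq2 : 0 ≤ Isq2 := integral_nonneg fun u => by positivity
  refine ⟨|c| * I2 + |c| * I0 + c ^ 2 * Isq + c ^ 2 * Isq2, ?_⟩
  filter_upwards [self_mem_nhdsWithin] with h hh
  have hh0 : 0 < h := hh
  have hD : 0 < h ^ D := by positivity
  have hc2 : 0 ≤ c ^ 2 * Isq := by positivity
  have hc3 : 0 ≤ c ^ 2 * Isq2 := by positivity
  have hc1 : 0 ≤ |c| * I2 := by positivity
  have hc0 : 0 ≤ |c| * I0 := by positivity
  have hscale : ∀ y : E, ‖y - x‖ ^ 2 = h ^ 2 * ‖h⁻¹ • (x - y)‖ ^ 2 := by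
    intro y
    rw [norm_smul, norm_sub_rev, mul_pow, norm_inv, inv_pow, Real.norm_eq_abs, sq_abs]
    field_simp
  simp only [← norm_inv_smul_sq_div_two]
  have e2 : ∀ y : E, |c / h ^ D * ψ (‖h⁻¹ • (x - y)‖ ^ 2 / 2)| * ‖y - x‖ ^ 2 =
      (|c| * h ^ 2 / h ^ D) * (fun u : E => |ψ (‖u‖ ^ 2 / 2)| * ‖u‖ ^ 2) (h⁻¹ • (x - y)) := by
    intro y
    rw [hscale y, abs_mul, abs_div, abs_of_pos hD]
    ring
  have esq2 : ∀ y : E, (c / h ^ D * ψ (‖h⁻¹ • (x - y)‖ ^ 2 / 2)) ^ 2 * ‖y - x‖ ^ 2 =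
      (c ^ 2 * h ^ 2 / (h ^ D) ^ 2) *
        (fun u : E => ψ (‖u‖ ^ 2 / 2) ^ 2 * ‖u‖ ^ 2) (h⁻¹ • (x - y)) := by
    intro y
    rw [hscale y]
    ring
  have esq : ∀ y : E, (c / h ^ D * ψ (‖h⁻¹ • (x - y)‖ ^ 2 / 2)) ^ 2 =
      (c ^ 2 / (h ^ D) ^ 2) * (fun u : E => ψ (‖u‖ ^ 2 / 2) ^ 2) (h⁻¹ • (x - y)) := by
    intro y
    ring
  have hcont : Continuous fun y : E => c / h ^ D * ψ (‖h⁻¹ • (x - y)‖ ^ 2 / 2) := by fun_prop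
  refine ⟨hcont, (integrable_comp_inv_smul_sub h0 x hh0).const_mul _, ?_, ?_, ?_, ?_, ?_, ?_, ?_,
    ?_, ?_⟩
  · simp only [e2]
    exact (integrable_comp_inv_smul_sub h2 x hh0).const_mul _
  · simp only [esq]
    exact (integrable_comp_inv_smul_sub hsq x hh0).const_mul _
  · simp only [esq2]
    exact (integrable_comp_inv_smul_sub hsq2 x hh0).const_mul _
  · rw [integral_const_mul, integral_comp_inv_smul_sub (fun u : E => ψ (‖u‖ ^ 2 / 2)) x hh0,
      smul_eq_mul, show c / h ^ D * (h ^ D * ∫ u : E, ψ (‖u‖ ^ 2 / 2)) =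
        c * ∫ u : E, ψ (‖u‖ ^ 2 / 2) by field_simp, sub_self, abs_zero]
    positivity
  · have e : ∀ y : E, (c / h ^ D * ψ (‖h⁻¹ • (x - y)‖ ^ 2 / 2)) • (y - x) =
        (c / h ^ D * -h) • (fun u : E => ψ (‖u‖ ^ 2 / 2) • u) (h⁻¹ • (x - y)) := by
      intro y
      simp only [smul_smul]
      rw [show c / h ^ D * -h * (ψ (‖h⁻¹ • (x - y)‖ ^ 2 / 2) * h⁻¹) =
        -(c / h ^ D * ψ (‖h⁻¹ • (x - y)‖ ^ 2 / 2)) by field_simp, neg_smul, ← smul_neg, neg_sub]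
    -- The integrand is odd, so the first moment vanishes exactly in the flat case.
    have hodd : ∫ u : E, ψ (‖u‖ ^ 2 / 2) • u = 0 := by
      have := integral_neg_eq_self (fun u : E => ψ (‖u‖ ^ 2 / 2) • u) volume
      simp only [norm_neg, smul_neg, integral_neg] at this
      have h2 : (2 : ℝ) • ∫ u : E, ψ (‖u‖ ^ 2 / 2) • u = 0 := by
        rw [two_smul]
        nth_rewrite 1 [← this]
        exact neg_add_cancel _
      exact (smul_eq_zero.1 h2).resolve_left two_ne_zero
    simp only [e]
    rw [integral_smul, integral_comp_inv_smul_sub (fun u : E => ψ (‖u‖ ^ 2 / 2) • u) x hh0, hodd]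
    simp only [smul_zero, norm_zero]
    positivity
  · simp only [e2]
    rw [integral_const_mul, integral_comp_inv_smul_sub
      (fun u : E => |ψ (‖u‖ ^ 2 / 2)| * ‖u‖ ^ 2) x hh0, smul_eq_mul]
    calc _ = |c| * h ^ 2 / h ^ D * (h ^ D * I2) := rfl
      _ = (|c| * I2) * h ^ 2 := by field_simp
      _ ≤ _ := by gcongr; linarith
  · simp only [abs_mul, abs_div, abs_of_pos hD]
    rw [integral_const_mul, integral_comp_inv_smul_sub
      (fun u : E => |ψ (‖u‖ ^ 2 / 2)|) x hh0, smul_eq_mul]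
    calc _ = |c| / h ^ D * (h ^ D * I0) := rfl
      _ = (|c| * I0) := by field_simp
      _ ≤ _ := by linarith
  · simp only [esq]
    rw [integral_const_mul, integral_comp_inv_smul_sub
      (fun u : E => ψ (‖u‖ ^ 2 / 2) ^ 2) x hh0, smul_eq_mul]
    calc _ = c ^ 2 / (h ^ D) ^ 2 * (h ^ D * Isq) := rfl
      _ = (c ^ 2 * Isq) / h ^ D := by field_simp
      _ ≤ _ := by gcongr; linarith
  · simp only [esq2]
    rw [integral_const_mul, integral_comp_inv_smul_sub
      (fun u : E => ψ (‖u‖ ^ 2 / 2) ^ 2 * ‖u‖ ^ 2) x hh0, smul_eq_mul]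
    calc _ = c ^ 2 * h ^ 2 / (h ^ D) ^ 2 * (h ^ D * Isq2) := rfl
      _ = (c ^ 2 * Isq2) * h ^ 2 / h ^ D := by field_simp
      _ ≤ _ := by gcongr; linarith

end LinearKernel

/-! ### Decay of a profile from integrability of its derivative. -/

section Profile

variable {p : ℝ → ℝ}

/-- The continuous extension of a profile on `[0, ∞)` to the line. -/
noncomputable def clampProfile (p : ℝ → ℝ) (r : ℝ) : ℝ := p (max r 0)

theorem clampProfile_of_nonneg {r : ℝ} (hr : 0 ≤ r) : clampProfile p r = p r := by
  rw [clampProfile, max_eq_left hr]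

theorem continuous_clampProfile (hp : ContinuousOn p (Ici 0)) : Continuous (clampProfile p) :=
  hp.comp_continuous (by fun_prop) fun r => le_max_right r 0

/-- A function with integrable moments, whose derivative also has integrable moments, decays
faster than every power. -/
theorem exists_mul_pow_le {p p' : ℝ → ℝ} (hp : ∀ r, 0 ≤ r → HasDerivWithinAt p (p' r) (Ici 0) r)
    (hp'c : ContinuousOn p' (Ici 0)) (N : ℕ)
    (h0 : IntegrableOn (fun r => |p r| * (N * r ^ (N - 1))) (Ioi 0))
    (h1 : IntegrableOn (fun r => |p' r| * r ^ N) (Ioi 0)) :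
    ∃ M, ∀ r, 0 ≤ r → |p r| * r ^ N ≤ M := by
  have hpc : ContinuousOn p (Ici 0) := fun r hr => (hp r hr).continuousWithinAt
  set G : ℝ → ℝ := fun r => p' r * r ^ N + p r * (N * r ^ (N - 1))
  have hG : IntegrableOn (fun r => |p' r| * r ^ N + |p r| * (N * r ^ (N - 1))) (Ioi 0) := h1.add h0
  refine ⟨|p 0 * 0 ^ N| +
    ∫ r in Ioi (0 : ℝ), (|p' r| * r ^ N + |p r| * (N * r ^ (N - 1))), fun r hr => ?_⟩
  -- `p r * r^N` is recovered by integrating its derivative `G`, whose absolute value has finite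
  -- integral over the whole half line; the bound is therefore uniform in `r`.
  have hFTC : ∫ s in (0 : ℝ)..r, G s = p r * r ^ N - p 0 * 0 ^ N := by
    refine intervalIntegral.integral_eq_sub_of_hasDerivAt_of_le hr
      (f := fun s => p s * s ^ N) ?_ ?_ ?_
    · exact (hpc.mono Icc_subset_Ici_self).mul (by fun_prop)
    · intro s hs
      exact ((hp s hs.1.le).hasDerivAt (Ici_mem_nhds hs.1)).mul (hasDerivAt_pow N s)
    · refine ContinuousOn.intervalIntegrable_of_Icc hr ?_
      have a1 := hp'c.mono (fun s (hs : s ∈ Icc 0 r) => hs.1)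
      have a2 := hpc.mono (fun s (hs : s ∈ Icc 0 r) => hs.1)
      fun_prop
  have hbd : |∫ s in (0 : ℝ)..r, G s| ≤
      ∫ r in Ioi (0 : ℝ), (|p' r| * r ^ N + |p r| * (N * r ^ (N - 1))) := by
    rw [intervalIntegral.integral_of_le hr, ← Real.norm_eq_abs]
    refine (norm_integral_le_of_norm_le (hG.mono_set Ioc_subset_Ioi_self) ?_).trans
      (setIntegral_mono_set hG ?_ (Eventually.of_forall Ioc_subset_Ioi_self))
    · filter_upwards [ae_restrict_mem measurableSet_Ioc] with s hs
      have hs0 : 0 < s := hs.1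
      refine (norm_add_le _ _).trans (le_of_eq ?_)
      rw [norm_mul, norm_mul (p s)]
      simp only [Real.norm_eq_abs]
      rw [abs_of_nonneg (by positivity : 0 ≤ s ^ N),
        abs_of_nonneg (by positivity : 0 ≤ (N : ℝ) * s ^ (N - 1))]
    · filter_upwards [ae_restrict_mem measurableSet_Ioi] with s hs
      have hs0 : 0 < s := hs
      simp only [Pi.zero_apply]
      positivity
  have e : |p r| * r ^ N = |p r * r ^ N| := by
    rw [abs_mul, abs_of_nonneg (by positivity : 0 ≤ r ^ N)]
  rw [e, show p r * r ^ N = p 0 * 0 ^ N + ∫ s in (0 : ℝ)..r, G s by rw [hFTC]; ring]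
  exact (abs_add_le _ _).trans (by gcongr)

theorem rapidDecay_clampProfile {p p' : ℝ → ℝ}
    (hp : ∀ r, 0 ≤ r → HasDerivWithinAt p (p' r) (Ici 0) r) (hp'c : ContinuousOn p' (Ici 0))
    (h0 : ∀ q : ℕ, 1 ≤ q → IntegrableOn (fun r => |p r| * r ^ ((q : ℝ) / 2 - 1)) (Ioi 0))
    (h1 : ∀ q : ℕ, 1 ≤ q → IntegrableOn (fun r => |p' r| * r ^ ((q : ℝ) / 2 - 1)) (Ioi 0)) :
    RapidDecay (clampProfile p) := by
  have hpow : ∀ {g : ℝ → ℝ}, (∀ q : ℕ, 1 ≤ q →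
      IntegrableOn (fun r => |g r| * r ^ ((q : ℝ) / 2 - 1)) (Ioi 0)) → ∀ N : ℕ,
      IntegrableOn (fun r => |g r| * r ^ N) (Ioi 0) := by
    intro g hg N
    -- The even index `q = 2N + 2` turns the exponent `q/2 - 1` into the integer `N`.
    have := hg (2 * N + 2) (by omega)
    rw [show ((2 * N + 2 : ℕ) : ℝ) / 2 - 1 = N by push_cast; ring] at this
    simpa only [Real.rpow_natCast] using this
  refine ⟨continuous_clampProfile fun r hr => (hp r hr).continuousWithinAt,
    fun q hq => (h0 q hq).congr_fun (fun r hr => ?_) measurableSet_Ioi, fun N => ?_⟩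
  · simp only [clampProfile_of_nonneg (le_of_lt hr)]
  · obtain ⟨M, hM⟩ := exists_mul_pow_le hp hp'c N
      (by
        have := (hpow h0 (N - 1)).const_mul (N : ℝ)
        simpa only [IntegrableOn, mul_left_comm] using this) (hpow h1 N)
    refine ⟨M, fun r hr => ?_⟩
    rw [clampProfile_of_nonneg hr]
    exact hM r hr

end Profile

/-! ### Consequences of the kernel hypotheses. -/

section KernelConditions

variable {g : Geometry} {D : ℕ} {p : ℝ → ℝ}

namespace KernelCond

theorem hasDerivWithinAt (hp : KernelCond g D p) {r : ℝ} (hr : 0 ≤ r) :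
    HasDerivWithinAt p (derivWithin p (Ici 0) r) (Ici 0) r :=
  ((hp.smooth.differentiableOn (by norm_num)) r hr).hasDerivWithinAt

theorem contDiffOn_derivWithin (hp : KernelCond g D p) :
    ContDiffOn ℝ 2 (derivWithin p (Ici 0)) (Ici 0) :=
  hp.smooth.derivWithin (uniqueDiffOn_Ici 0) (by norm_num)

theorem continuousOn_derivWithin (hp : KernelCond g D p) :
    ContinuousOn (derivWithin p (Ici 0)) (Ici 0) :=
  hp.contDiffOn_derivWithin.continuousOn

theorem derivWithin_nonpos (hp : KernelCond g D p) (r : ℝ) : derivWithin p (Ici 0) r ≤ 0 :=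
  hp.anti.derivWithin_nonpos

theorem rapidDecay (hp : KernelCond .directional D p) : RapidDecay (clampProfile p) := by
  refine rapidDecay_clampProfile (fun r hr => hp.hasDerivWithinAt hr)
    hp.continuousOn_derivWithin (fun q hq => ?_) (fun q hq => ?_)
  · simpa only [iteratedDerivWithin_zero] using hp.dir_integrable rfl 0 (by norm_num) q hq
  · simpa only [iteratedDerivWithin_one] using hp.dir_integrable rfl 1 (by norm_num) q hq

theorem rapidDecay_derivWithin (hp : KernelCond .directional D p) :
    RapidDecay (clampProfile (derivWithin p (Ici 0))) := by
  have h2 : iteratedDerivWithin 2 p (Ici 0) = derivWithin (derivWithin p (Ici 0)) (Ici 0) := by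
    rw [iteratedDerivWithin_succ', iteratedDerivWithin_one]
  have hc := hp.contDiffOn_derivWithin
  refine rapidDecay_clampProfile (p' := iteratedDerivWithin 2 p (Ici 0)) (fun r hr => ?_) ?_
    (fun q hq => ?_) (fun q hq => hp.dir_integrable rfl 2 (by norm_num) q hq)
  · rw [h2]
    exact ((hc.differentiableOn (by norm_num)) r hr).hasDerivWithinAt
  · rw [h2]
    exact (hc.derivWithin (m := 1) (uniqueDiffOn_Ici 0) (by norm_num)).continuousOn
  · simpa only [iteratedDerivWithin_one] using hp.dir_integrable rfl 1 (by norm_num) q hq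

theorem dir_integral_pos (hp : KernelCond .directional D p) (hD : 1 ≤ D) :
    0 < ∫ r in Ioi (0 : ℝ), p r * r ^ ((D : ℝ) / 2 - 1) := by
  have := hp.dir_pos rfl 0 (by norm_num) D hD
  simp only [iteratedDerivWithin_zero] at this
  refine this.trans_le (le_of_eq (setIntegral_congr_fun measurableSet_Ioi fun r hr => ?_))
  simp only [abs_of_nonneg (hp.nonneg r (le_of_lt hr))]

/-- Monotonicity fixes the sign of the derivative, so this integral is minus the one of the absolute
value, which `dir_pos` makes positive. -/
theorem dir_integral_deriv_neg (hp : KernelCond .directional D p) (hD : 1 ≤ D) :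
    ∫ r in Ioi (0 : ℝ), derivWithin p (Ici 0) r * r ^ ((D : ℝ) / 2 - 1) < 0 := by
  have := hp.dir_pos rfl 1 (by norm_num) D hD
  simp only [iteratedDerivWithin_one, abs_of_nonpos (hp.derivWithin_nonpos _), neg_mul,
    integral_neg] at this
  linarith

/-- The inner function `‖u‖²/2` takes values in `[0, ∞)`, so a one-sided derivative of the profile
at zero suffices for full differentiability at the origin. -/
theorem hasFDerivAt_radial (hp : KernelCond g D p) {E : Type*} [NormedAddCommGroup E]
    [InnerProductSpace ℝ E] (u : E) :
    HasFDerivAt (fun u : E => p (‖u‖ ^ 2 / 2))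
      (derivWithin p (Ici 0) (‖u‖ ^ 2 / 2) • innerSL ℝ u) u := by
  have h1 : HasFDerivAt (fun u : E => ‖u‖ ^ 2 / 2) (innerSL ℝ u) u := by
    have := (hasStrictFDerivAt_norm_sq u).hasFDerivAt.mul_const (2⁻¹ : ℝ)
    simp only [div_eq_mul_inv]
    refine this.congr_fderiv ?_
    ext v
    simp
  have h2 := (hp.hasDerivWithinAt (r := ‖u‖ ^ 2 / 2) (by positivity)).comp_hasFDerivWithinAt
    (t := Ici 0) (s := univ) u h1.hasFDerivWithinAt (fun v _ => by
      simp only [mem_Ici]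
      positivity)
  exact hasFDerivWithinAt_univ.1 h2

end KernelCond

end KernelConditions
-- Linear kernels: integrability and sign of the profile derivative.
section LinearCond
variable {D : ℕ} {p : ℝ → ℝ}

local notation "𝔼" => EuclideanSpace ℝ (Fin D)

/-- Reads the order-one hypotheses `lin_moment` and `lin_sq` as integrability of `|p'| ‖u‖³` and
`p'² ‖u‖²`. -/
theorem KernelCond.norm_fderiv_radial (hp : KernelCond .linear D p) (u : 𝔼) :
    ‖iteratedFDeriv ℝ 1 (fun u : 𝔼 => p (‖u‖ ^ 2 / 2)) u‖ =
      |derivWithin p (Ici 0) (‖u‖ ^ 2 / 2)| * ‖u‖ := by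
  rw [norm_iteratedFDeriv_one, (hp.hasFDerivAt_radial u).fderiv, norm_smul, innerSL_apply_norm,
    Real.norm_eq_abs]

/-- A radial function that is bounded near the origin is integrable as soon as it is dominated
outside the unit ball by an integrable function. -/
theorem integrable_of_le_outside_ball {F G : 𝔼 → ℝ} (hF : Continuous F) (hG : Integrable G)
    (hG0 : ∀ u, 0 ≤ G u) (hFG : ∀ u, 1 ≤ ‖u‖ → |F u| ≤ G u) : Integrable F := by
  obtain ⟨B, hB⟩ := (isCompact_closedBall (0 : 𝔼) 1).exists_bound_of_continuousOn hF.continuousOn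
  have hB0 : 0 ≤ B := (norm_nonneg _).trans (hB 0 (by simp))
  have hi : Integrable ((Metric.closedBall (0 : 𝔼) 1).indicator fun _ => B) :=
    (integrable_indicator_iff Metric.isClosed_closedBall.measurableSet).2
      (integrableOn_const (by exact (isCompact_closedBall _ _).measure_lt_top.ne))
  refine (hi.add hG).mono' hF.aestronglyMeasurable (Eventually.of_forall fun u => ?_)
  by_cases hu : ‖u‖ ≤ 1
  · have := hB u (by simpa using hu)
    simp only [Pi.add_apply]
    rw [indicator_of_mem (by simpa using hu)]
    linarith [hG0 u]
  · simp only [Pi.add_apply]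
    rw [indicator_of_notMem (by simpa using hu), zero_add]
    exact hFG u (not_le.1 hu).le

/-- A non-integrable function has Bochner integral zero, which contradicts the positivity in
`lin_pos`. -/
theorem KernelCond.lin_integrable (hp : KernelCond .linear D p) :
    Integrable fun u : 𝔼 => p (‖u‖ ^ 2 / 2) := by
  by_contra h
  exact (hp.lin_pos rfl).ne' (integral_undef h)

theorem KernelCond.continuous_radial_deriv (hp : KernelCond .linear D p) :
    Continuous fun u : 𝔼 => derivWithin p (Ici 0) (‖u‖ ^ 2 / 2) :=
  hp.continuousOn_derivWithin.comp_continuous (by fun_prop) fun u => by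
    simp only [mem_Ici]
    positivity

/-- The hypothesis bounds `|p'| ‖u‖³`, which dominates `|p'|` only outside the unit ball; inside it,
continuity is enough. -/
theorem KernelCond.lin_integrable_deriv (hp : KernelCond .linear D p) :
    Integrable fun u : 𝔼 => derivWithin p (Ici 0) (‖u‖ ^ 2 / 2) := by
  have hm := hp.lin_moment rfl 1 (by norm_num)
  refine integrable_of_le_outside_ball hp.continuous_radial_deriv hm (fun u => by positivity)
    fun u hu => ?_
  rw [hp.norm_fderiv_radial]
  calc _ = 1 * (|derivWithin p (Ici 0) (‖u‖ ^ 2 / 2)| * 1) := by ring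
    _ ≤ _ := by
      gcongr
      exact one_le_pow₀ hu

/-- The integral of the derivative of a linear kernel profile is negative. -/
theorem KernelCond.lin_integral_deriv_neg (hp : KernelCond .linear D p) (hD : 1 ≤ D) :
    ∫ u : 𝔼, derivWithin p (Ici 0) (‖u‖ ^ 2 / 2) < 0 := by
  have hle : ∀ u : 𝔼, 0 ≤ -derivWithin p (Ici 0) (‖u‖ ^ 2 / 2) := fun u =>
    neg_nonneg.2 (hp.derivWithin_nonpos _)
  have hge : 0 ≤ ∫ u : 𝔼, -derivWithin p (Ici 0) (‖u‖ ^ 2 / 2) := integral_nonneg hle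
  rw [integral_neg] at hge
  refine lt_of_le_of_ne (by linarith) fun h0 => ?_
  -- If the integral were zero, the continuous nonnegative integrand would vanish everywhere and the
  -- kernel would be constant. A constant is integrable on a space of infinite measure only if it is
  -- zero, against `lin_pos`.
  have h1 : (fun u : 𝔼 => -derivWithin p (Ici 0) (‖u‖ ^ 2 / 2)) = 0 := by
    refine (hp.continuous_radial_deriv.neg).ae_eq_iff_eq volume continuous_zero |>.1 ?_
    refine (integral_eq_zero_iff_of_nonneg hle hp.lin_integrable_deriv.neg).1 ?_
    rw [integral_neg, h0, neg_zero]
  have h2 : ∀ u : 𝔼, p (‖u‖ ^ 2 / 2) = p (‖(0 : 𝔼)‖ ^ 2 / 2) := by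
    intro u
    refine is_const_of_fderiv_eq_zero (𝕜 := ℝ) (f := fun u : 𝔼 => p (‖u‖ ^ 2 / 2))
      (fun v => (hp.hasFDerivAt_radial v).differentiableAt) (fun v => ?_) u 0
    have := congrFun h1 v
    simp only [Pi.zero_apply, neg_eq_zero] at this
    rw [(hp.hasFDerivAt_radial v).fderiv, this, zero_smul]
  have hi := hp.lin_integrable
  have hpos := hp.lin_pos rfl
  simp only [h2] at hi hpos
  have : Nonempty (Fin D) := ⟨⟨0, hD⟩⟩
  rcases (integrable_const_iff).1 hi with h | h
  · rw [h] at hpos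
    simp at hpos
  · have := h.measure_univ_lt_top
    rw [measure_univ_of_isAddLeftInvariant] at this
    exact lt_irrefl _ this

end LinearCond

/-! ### The kernels of one factor as approximate kernels. -/

section FactorKernel

variable {g : Geometry} {D : ℕ} {p : ℝ → ℝ}

/-- The pole fixed in `normConst` is immaterial, because zonal integrals do not depend on it. -/
theorem normConst_directional (d : ℕ) {p : ℝ → ℝ} (hp : Continuous (clampProfile p)) (h : ℝ) :
    normConst .directional (d + 1) p h = (zonalIntegral d (clampProfile p) h)⁻¹ := by
  set e : EuclideanSpace ℝ (Fin (d + 2)) := EuclideanSpace.single 0 1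
  have he : ‖e‖ = 1 := by simp [e]
  have h1 : ∫ y, p ((1 - inner ℝ e y) / h ^ 2)
      ∂(surfaceMeasure (EuclideanSpace ℝ (Fin (d + 2)))) = zonalIntegral d (clampProfile p) h := by
    rw [← integral_sphere_profile hp he h]
    refine integral_congr_ae ?_
    filter_upwards [ae_surfaceMeasure_mem_sphere] with y hy
    rw [clampProfile_of_nonneg (by positivity),
      norm_sub_sq_div_of_mem_sphere he (mem_sphere_zero_iff_norm.1 hy)]
  rw [← h1]
  rfl

/-- The normalized kernel of a factor, centred at `x`. -/
noncomputable def factorKernel (g : Geometry) (D : ℕ) (p : ℝ → ℝ) (h : ℝ) (x y : Amb g D) : ℝ :=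
  normConst g D p h * clampProfile p (‖x - y‖ ^ 2 / (2 * h ^ 2))

/-- The negative of the derivative of the kernel profile of a factor, with the normalizing constant
of the kernel, centred at `x`. -/
noncomputable def factorKernelDeriv (g : Geometry) (D : ℕ) (p : ℝ → ℝ) (h : ℝ)
    (x y : Amb g D) : ℝ :=
  normConst g D p h * -clampProfile (derivWithin p (Ici 0)) (‖x - y‖ ^ 2 / (2 * h ^ 2))

theorem KernelCond.exists_approxKernel (hD : 1 ≤ D) (hp : KernelCond g D p) {x : Amb g D}
    (hx : x ∈ space g D) : ∃ C, ∀ᶠ h in 𝓝[>] (0 : ℝ),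
      ApproxKernel (refMeasure g D) x D (factorKernel g D p h x) 1 C h := by
  cases g
  · have hcl : ∀ u : EuclideanSpace ℝ (Fin D),
        clampProfile p (‖u‖ ^ 2 / 2) = p (‖u‖ ^ 2 / 2) := fun u =>
      clampProfile_of_nonneg (by positivity)
    have hnn : ∀ u : EuclideanSpace ℝ (Fin D), 0 ≤ p (‖u‖ ^ 2 / 2) := fun u =>
      hp.nonneg _ (by positivity)
    have hle : ∀ u : EuclideanSpace ℝ (Fin D), p (‖u‖ ^ 2 / 2) ≤ p 0 := fun u =>
      hp.anti (by simp) (by simp only [mem_Ici]; positivity) (by positivity)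
    have hcont : Continuous fun u : EuclideanSpace ℝ (Fin D) => p (‖u‖ ^ 2 / 2) := by
      have := continuous_clampProfile hp.smooth.continuousOn
      simp only [← hcl]
      fun_prop
    have hmom : Integrable fun u : EuclideanSpace ℝ (Fin D) => |p (‖u‖ ^ 2 / 2)| * ‖u‖ ^ 2 := by
      have := hp.lin_moment rfl 0 (by norm_num)
      simpa only [norm_iteratedFDeriv_zero, Real.norm_eq_abs, mul_comm] using this
    have hsq : Integrable fun u : EuclideanSpace ℝ (Fin D) => p (‖u‖ ^ 2 / 2) ^ 2 := by
      have := hp.lin_sq rfl 0 (by norm_num)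
      simpa only [norm_iteratedFDeriv_zero, Real.norm_eq_abs, sq_abs] using this
    have hsq2 : Integrable fun u : EuclideanSpace ℝ (Fin D) =>
        p (‖u‖ ^ 2 / 2) ^ 2 * ‖u‖ ^ 2 := by
      refine (hmom.const_mul (p 0)).mono' ((hcont.pow 2).mul (by fun_prop)).aestronglyMeasurable
        (Eventually.of_forall fun u => ?_)
      rw [Real.norm_of_nonneg (by positivity), abs_of_nonneg (hnn u), ← mul_assoc, sq (p _)]
      have := hle u
      have := hnn u
      gcongr
    obtain ⟨C, hC⟩ := exists_approxKernel_linear (E := EuclideanSpace ℝ (Fin D))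
      (continuous_clampProfile hp.smooth.continuousOn)
      (by simpa only [hcl] using hp.lin_integrable) (by simpa only [hcl] using hmom)
      (by simpa only [hcl] using hsq) (by simpa only [hcl] using hsq2) (linConst D p) x
    simp only [hcl, finrank_euclideanSpace, Fintype.card_fin] at hC
    have h1 : linConst D p * ∫ u : EuclideanSpace ℝ (Fin D), p (‖u‖ ^ 2 / 2) = 1 :=
      inv_mul_cancel₀ (hp.lin_pos rfl).ne'
    rw [h1] at hC
    exact ⟨C, hC⟩
  · obtain ⟨d, rfl⟩ : ∃ d, D = d + 1 := ⟨D - 1, by omega⟩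
    have he : ∫ r in Ioi (0 : ℝ), clampProfile p r * r ^ (((d + 1 : ℕ) : ℝ) / 2 - 1) =
        ∫ r in Ioi (0 : ℝ), p r * r ^ (((d + 1 : ℕ) : ℝ) / 2 - 1) :=
      setIntegral_congr_fun measurableSet_Ioi fun r hr => by
        simp only [clampProfile_of_nonneg (le_of_lt hr)]
    have hpos := hp.dir_integral_pos hD
    rw [← he] at hpos
    obtain ⟨C, hC⟩ := exists_approxKernel_sphere (d := d) hp.rapidDecay hp.rapidDecay hpos
      (x := x) (mem_sphere_zero_iff_norm.1 hx)
    rw [div_self hpos.ne'] at hC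
    refine ⟨C, ?_⟩
    unfold factorKernel
    simp only [normConst_directional d hp.rapidDecay.cont]
    exact hC

/-- The limiting mass is what defines `kernelRatio`, the minus sign making it positive. For a linear
kernel the order-one hypotheses carry surplus powers of `‖u‖`; these are removed outside the unit
ball, and continuity covers the inside. -/
theorem KernelCond.exists_approxKernel_deriv (hD : 1 ≤ D) (hp : KernelCond g D p) {x : Amb g D}
    (hx : x ∈ space g D) : ∃ C, ∀ᶠ h in 𝓝[>] (0 : ℝ),
      ApproxKernel (refMeasure g D) x D (factorKernelDeriv g D p h x)
        (kernelRatio g D p) C h := by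
  cases g
  · have hcl : ∀ u : EuclideanSpace ℝ (Fin D),
        clampProfile (derivWithin p (Ici 0)) (‖u‖ ^ 2 / 2) =
          derivWithin p (Ici 0) (‖u‖ ^ 2 / 2) := fun u =>
      clampProfile_of_nonneg (by positivity)
    have hcont := hp.continuous_radial_deriv
    have h3 := hp.lin_moment rfl 1 (by norm_num)
    have h4 := hp.lin_sq rfl 1 (by norm_num)
    simp only [hp.norm_fderiv_radial] at h3 h4
    have hmom : Integrable fun u : EuclideanSpace ℝ (Fin D) =>
        |derivWithin p (Ici 0) (‖u‖ ^ 2 / 2)| * ‖u‖ ^ 2 := by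
      refine integrable_of_le_outside_ball (by fun_prop) h3 (fun u => by positivity) fun u hu => ?_
      rw [abs_mul, abs_abs, abs_of_nonneg (by positivity : 0 ≤ ‖u‖ ^ 2)]
      calc _ = ‖u‖ ^ 2 * (|derivWithin p (Ici 0) (‖u‖ ^ 2 / 2)| * 1) := by ring
        _ ≤ _ := by gcongr
    have hsq2 : Integrable fun u : EuclideanSpace ℝ (Fin D) =>
        derivWithin p (Ici 0) (‖u‖ ^ 2 / 2) ^ 2 * ‖u‖ ^ 2 := by
      simpa only [mul_pow, sq_abs] using h4
    have hsq : Integrable fun u : EuclideanSpace ℝ (Fin D) =>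
        derivWithin p (Ici 0) (‖u‖ ^ 2 / 2) ^ 2 := by
      refine integrable_of_le_outside_ball (by fun_prop) hsq2 (fun u => by positivity)
        fun u hu => ?_
      rw [abs_of_nonneg (by positivity)]
      exact le_mul_of_one_le_right (by positivity) (one_le_pow₀ hu)
    obtain ⟨C, hC⟩ := exists_approxKernel_linear (E := EuclideanSpace ℝ (Fin D))
      (ψ := fun r => -clampProfile (derivWithin p (Ici 0)) r)
      (continuous_clampProfile hp.continuousOn_derivWithin).neg
      (by simp only [hcl]; exact hp.lin_integrable_deriv.neg)
      (by simpa only [hcl, abs_neg] using hmom)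
      (by simpa only [hcl, neg_sq] using hsq) (by simpa only [hcl, neg_sq] using hsq2)
      (linConst D p) x
    simp only [hcl, finrank_euclideanSpace, Fintype.card_fin, integral_neg, mul_neg] at hC
    refine ⟨C, ?_⟩
    simp only [kernelRatio, neg_mul]
    unfold factorKernelDeriv
    simp only [mul_neg]
    exact hC
  · obtain ⟨d, rfl⟩ : ∃ d, D = d + 1 := ⟨D - 1, by omega⟩
    have he : ∀ q : ℝ → ℝ, ∫ r in Ioi (0 : ℝ), clampProfile q r * r ^ (((d + 1 : ℕ) : ℝ) / 2 - 1) =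
        ∫ r in Ioi (0 : ℝ), q r * r ^ (((d + 1 : ℕ) : ℝ) / 2 - 1) := fun q =>
      setIntegral_congr_fun measurableSet_Ioi fun r hr => by
        simp only [clampProfile_of_nonneg (le_of_lt hr)]
    have hpos := hp.dir_integral_pos hD
    rw [← he] at hpos
    obtain ⟨C, hC⟩ := exists_approxKernel_sphere (d := d) hp.rapidDecay
      hp.rapidDecay_derivWithin.neg hpos (x := x) (mem_sphere_zero_iff_norm.1 hx)
    simp only [neg_mul, integral_neg, he, neg_div] at hC
    refine ⟨C, ?_⟩
    unfold factorKernelDeriv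
    simp only [normConst_directional d hp.rapidDecay.cont]
    exact hC

theorem KernelCond.kernelRatio_pos (hD : 1 ≤ D) (hp : KernelCond g D p) :
    0 < kernelRatio g D p := by
  cases g
  · have h1 := hp.lin_integral_deriv_neg hD
    have h2 : 0 < linConst D p := inv_pos.2 (hp.lin_pos rfl)
    simp only [kernelRatio]
    nlinarith
  · have h1 := hp.dir_integral_deriv_neg hD
    have h2 := hp.dir_integral_pos hD
    simp only [kernelRatio]
    rw [neg_pos]
    exact div_neg_of_neg_of_pos h1 h2

end FactorKernel

/-! ### Rotations in a plane. -/

section PlaneRotation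

variable {E : Type*} [NormedAddCommGroup E] [InnerProductSpace ℝ E]

/-- The map rotating by the angle `t` in the plane of two orthonormal vectors `x` and `u`. -/
noncomputable def planeRotation (x u : E) (t : ℝ) (y : E) : E :=
  y + ((Real.cos t - 1) * inner ℝ x y - Real.sin t * inner ℝ u y) • x +
    ((Real.cos t - 1) * inner ℝ u y + Real.sin t * inner ℝ x y) • u

theorem norm_planeRotation {x u : E} (hx : ‖x‖ = 1) (hu : ‖u‖ = 1) (hxu : inner ℝ x u = 0)
    (t : ℝ) (y : E) : ‖planeRotation x u t y‖ = ‖y‖ := by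
  have h : ‖planeRotation x u t y‖ ^ 2 = ‖y‖ ^ 2 := by
    rw [planeRotation, norm_add_sq_real, norm_add_sq_real, norm_smul, norm_smul, hx, hu,
      inner_add_left, inner_smul_left, inner_smul_right, inner_smul_right, inner_smul_right, hxu,
      mul_one, mul_one, Real.norm_eq_abs, Real.norm_eq_abs, sq_abs, sq_abs,
      real_inner_comm x y, real_inner_comm u y]
    simp only [conj_trivial, mul_zero, add_zero]
    linear_combination (inner ℝ x y ^ 2 + inner ℝ u y ^ 2) * Real.sin_sq_add_cos_sq t
  exact (sq_eq_sq₀ (norm_nonneg _) (norm_nonneg _)).1 h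

theorem hasDerivAt_planeRotation (x u y : E) (t : ℝ) :
    HasDerivAt (fun t => planeRotation x u t y)
      ((-Real.sin t * inner ℝ x y - Real.cos t * inner ℝ u y) • x +
        (-Real.sin t * inner ℝ u y + Real.cos t * inner ℝ x y) • u) t := by
  unfold planeRotation
  have hc := (Real.hasDerivAt_cos t).sub_const 1
  have hs := Real.hasDerivAt_sin t
  have h1 := ((hc.mul_const (inner ℝ x y)).sub (hs.mul_const (inner ℝ u y))).smul_const x
  have h2 := ((hc.mul_const (inner ℝ u y)).add (hs.mul_const (inner ℝ x y))).smul_const u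
  exact (h1.const_add y).add h2

end PlaneRotation

/-! ### Derivatives along isometric flows integrate to zero. -/

section Killing

variable {E : Type*} [NormedAddCommGroup E] [InnerProductSpace ℝ E]
  [MeasurableSpace E] [BorelSpace E] [FiniteDimensional ℝ E]

theorem aestronglyMeasurable_surfaceMeasure {F : E → ℝ}
    (hF : ContinuousOn F (Metric.sphere (0 : E) 1)) :
    AEStronglyMeasurable F (surfaceMeasure E) := by
  rw [← Measure.restrict_eq_self_of_ae_mem (ae_surfaceMeasure_mem_sphere (E := E))]
  exact hF.aestronglyMeasurable Metric.isClosed_sphere.measurableSet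

theorem integrable_surfaceMeasure {F : E → ℝ}
    (hF : ContinuousOn F (Metric.sphere (0 : E) 1)) :
    Integrable F (surfaceMeasure E) := by
  obtain ⟨C, hC⟩ := (isCompact_sphere (0 : E) 1).exists_bound_of_continuousOn hF
  refine Integrable.of_bound (aestronglyMeasurable_surfaceMeasure hF) C ?_
  filter_upwards [ae_surfaceMeasure_mem_sphere] with y hy using hC y hy

/-- Rotation by the angle `t` in the plane of two orthonormal vectors `x` and `u`. -/
noncomputable def planeRotationEquiv {x u : E} (hx : ‖x‖ = 1) (hu : ‖u‖ = 1)
    (hxu : inner ℝ x u = 0) (t : ℝ) : E ≃ₗᵢ[ℝ] E :=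
  LinearIsometry.toLinearIsometryEquiv
    { toFun := planeRotation x u t
      map_add' := fun y z => by
        simp only [planeRotation, inner_add_right]
        module
      map_smul' := fun c y => by
        simp only [planeRotation, inner_smul_right, RingHom.id_apply]
        module
      norm_map' := norm_planeRotation hx hu hxu t } rfl

/-- The derivative of a function along an infinitesimal rotation integrates to zero over the unit
sphere. -/
theorem integral_fderiv_rotation_unit [Nontrivial E] {F : E → ℝ} {U : Set E} (hU : IsOpen U)
    (hSU : Metric.sphere (0 : E) 1 ⊆ U) (hF : ContDiffOn ℝ 1 F U) {x u : E} (hx : ‖x‖ = 1)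
    (hu : ‖u‖ = 1) (hxu : inner ℝ x u = 0) :
    ∫ y, fderiv ℝ F y ((inner ℝ x y : ℝ) • u - (inner ℝ u y : ℝ) • x) ∂(surfaceMeasure E) = 0 := by
  have hFc : ContinuousOn F (Metric.sphere (0 : E) 1) := hF.continuousOn.mono hSU
  have hdF : ContinuousOn (fderiv ℝ F) (Metric.sphere (0 : E) 1) :=
    (hF.continuousOn_fderiv_of_isOpen hU le_rfl).mono hSU
  obtain ⟨B, hB⟩ := (isCompact_sphere (0 : E) 1).exists_bound_of_continuousOn hdF
  have hmaps : ∀ t, MapsTo (planeRotation x u t) (Metric.sphere (0 : E) 1)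
      (Metric.sphere (0 : E) 1) := fun t y hy => by
    rw [mem_sphere_zero_iff_norm] at hy ⊢
    rw [norm_planeRotation hx hu hxu, hy]
  have hrc : ∀ t, Continuous (planeRotation x u t) := fun t =>
    (planeRotationEquiv hx hu hxu t).continuous
  -- Rotation invariance makes this integral constant in `t`; differentiating under the integral
  -- sign at `t = 0` gives the claim.
  have hconst : ∀ t, ∫ y, F (planeRotation x u t y) ∂(surfaceMeasure E) =
      ∫ y, F y ∂(surfaceMeasure E) := fun t =>
    (measurePreserving_surfaceMeasure (planeRotationEquiv hx hu hxu t)).integral_comp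
      (planeRotationEquiv hx hu hxu t).toHomeomorph.measurableEmbedding F
  let V : ℝ → E → E := fun t y =>
    (-Real.sin t * inner ℝ x y - Real.cos t * inner ℝ u y) • x +
        (-Real.sin t * inner ℝ u y + Real.cos t * inner ℝ x y) • u
  -- `V t y` is the velocity of the rotated point. Its two coefficients consist of four products,
  -- each at most one in absolute value, which gives the dominating constant.
  have hV : ∀ t, ∀ y ∈ Metric.sphere (0 : E) 1, ‖V t y‖ ≤ 4 := by
    intro t y hy
    rw [mem_sphere_zero_iff_norm] at hy
    have h1 : |inner ℝ x y| ≤ 1 := by simpa [hx, hy] using abs_real_inner_le_norm x y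
    have h2 : |inner ℝ u y| ≤ 1 := by simpa [hu, hy] using abs_real_inner_le_norm u y
    have h3 := Real.abs_sin_le_one t
    have h4 := Real.abs_cos_le_one t
    have hm : ∀ a b : ℝ, |a| ≤ 1 → |b| ≤ 1 → |a * b| ≤ 1 := fun a b ha hb => by
      rw [abs_mul]
      exact mul_le_one₀ ha (abs_nonneg _) hb
    refine (norm_add_le _ _).trans ?_
    rw [norm_smul, norm_smul, hx, hu, mul_one, mul_one, Real.norm_eq_abs, Real.norm_eq_abs]
    have a1 := abs_sub (-Real.sin t * inner ℝ x y) (Real.cos t * inner ℝ u y)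
    have a2 := abs_add_le (-Real.sin t * inner ℝ u y) (Real.cos t * inner ℝ x y)
    have b1 := hm (-Real.sin t) _ (by rwa [abs_neg]) h1
    have b2 := hm (-Real.sin t) _ (by rwa [abs_neg]) h2
    have b3 := hm _ _ h4 h1
    have b4 := hm _ _ h4 h2
    linarith
  have hB0 : 0 ≤ B := (norm_nonneg _).trans (hB x (by simpa using hx))
  have hr0 : ∀ y, planeRotation x u 0 y = y := fun y => by simp [planeRotation]
  have hder := hasDerivAt_integral_of_dominated_loc_of_deriv_le (μ := surfaceMeasure E)
    (F := fun t y => F (planeRotation x u t y)) (x₀ := (0 : ℝ)) (s := univ)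
    (F' := fun t y => fderiv ℝ F (planeRotation x u t y) (V t y)) (bound := fun _ => B * 4)
    univ_mem
    (Eventually.of_forall fun t => aestronglyMeasurable_surfaceMeasure
      (hFc.comp (hrc t).continuousOn (hmaps t)))
    (by simpa only [hr0] using integrable_surfaceMeasure hFc)
    (by
      simp only [hr0]
      refine aestronglyMeasurable_surfaceMeasure (hdF.clm_apply ?_)
      simp only [V]
      fun_prop)
    (by
      filter_upwards [ae_surfaceMeasure_mem_sphere] with y hy t _
      refine (ContinuousLinearMap.le_opNorm _ _).trans ?_
      gcongr
      · exact hB _ (hmaps t hy)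
      · exact hV t y hy)
    (integrable_const _)
    (by
      filter_upwards [ae_surfaceMeasure_mem_sphere] with y hy t _
      have hd : HasFDerivAt F (fderiv ℝ F (planeRotation x u t y)) (planeRotation x u t y) :=
        ((hF.differentiableOn (by norm_num)).differentiableAt
          (hU.mem_nhds (hSU (hmaps t hy)))).hasFDerivAt
      exact hd.comp_hasDerivAt t (hasDerivAt_planeRotation x u y t))
  have h0 := hder.2
  simp only [hconst, hr0] at h0
  have h1 := h0.unique (hasDerivAt_const _ _)
  rw [← h1]
  refine integral_congr_ae (Eventually.of_forall fun y => ?_)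
  simp only [V, Real.sin_zero, Real.cos_zero]
  congr 1
  module

/-- The rotation field is linear in `v`, so the case of a unit vector scales to any vector
orthogonal to `x`. -/
theorem integral_fderiv_rotation [Nontrivial E] {F : E → ℝ} {U : Set E} (hU : IsOpen U)
    (hSU : Metric.sphere (0 : E) 1 ⊆ U) (hF : ContDiffOn ℝ 1 F U) {x v : E} (hx : ‖x‖ = 1)
    (hxv : inner ℝ x v = 0) :
    ∫ y, fderiv ℝ F y ((inner ℝ x y : ℝ) • v - (inner ℝ v y : ℝ) • x) ∂(surfaceMeasure E) = 0 := by
  by_cases hv : v = 0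
  · simp [hv]
  have hv' : ‖v‖ ≠ 0 := norm_ne_zero_iff.2 hv
  set u := ‖v‖⁻¹ • v with hu
  have hvu : v = ‖v‖ • u := by rw [hu, smul_smul, mul_inv_cancel₀ hv', one_smul]
  have hu1 : ‖u‖ = 1 := by rw [hu, norm_smul, norm_inv, norm_norm, inv_mul_cancel₀ hv']
  have hxu : inner ℝ x u = 0 := by rw [hu, inner_smul_right, hxv, mul_zero]
  have h := integral_fderiv_rotation_unit hU hSU hF hx hu1 hxu
  have e : ∀ y, fderiv ℝ F y ((inner ℝ x y : ℝ) • v - (inner ℝ v y : ℝ) • x) =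
      ‖v‖ * fderiv ℝ F y ((inner ℝ x y : ℝ) • u - (inner ℝ u y : ℝ) • x) := by
    intro y
    rw [← smul_eq_mul, ← map_smul]
    congr 1
    conv_lhs => rw [hvu]
    rw [inner_smul_left, conj_trivial]
    module
  simp only [e]
  rw [integral_const_mul, h, mul_zero]

/-- Integration by parts against the constant function one; the flat counterpart of
`integral_fderiv_rotation`. -/
theorem integral_fderiv_of_hasCompactSupport {F : E → ℝ} (hF : ContDiff ℝ 1 F)
    (hc : HasCompactSupport F) (v : E) : ∫ y, fderiv ℝ F y v = 0 := by
  have hd : Continuous fun y => fderiv ℝ F y v :=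
    (hF.continuous_fderiv (by norm_num)).clm_apply continuous_const
  have hdc : HasCompactSupport fun y => fderiv ℝ F y v := hc.fderiv_apply (𝕜 := ℝ) v
  have := integral_mul_fderiv_eq_neg_fderiv_mul_of_integrable (μ := (volume : Measure E))
    (f := fun _ : E => (1 : ℝ)) (g := F) (v := v) (by simp)
    (by simpa using hd.integrable_of_hasCompactSupport hdc)
    (by simpa using hF.continuous.integrable_of_hasCompactSupport hc)
    (fun x _ => by fun_prop) (fun x _ => hF.differentiable (by norm_num) x)
  simpa using this

end Killing

/-! ### Killing fields and integration by parts on one factor. -/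

section FactorKilling

variable {g : Geometry} {D : ℕ}

instance sigmaFinite_refMeasure (g : Geometry) (D : ℕ) : SigmaFinite (refMeasure g D) := by
  cases g
  · exact inferInstanceAs (SigmaFinite (volume : Measure (EuclideanSpace ℝ (Fin D))))
  · exact inferInstanceAs (SigmaFinite (surfaceMeasure (EuclideanSpace ℝ (Fin (D + 1)))))

theorem ae_mem_space (g : Geometry) (D : ℕ) : ∀ᵐ y ∂(refMeasure g D), y ∈ space g D := by
  cases g
  · exact Eventually.of_forall fun _ => mem_univ _
  · exact ae_surfaceMeasure_mem_sphere (E := EuclideanSpace ℝ (Fin (D + 1)))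

/-- `v` is a tangent vector at the point `x` of a factor. -/
def IsTangentVec : (g : Geometry) → (D : ℕ) → Amb g D → Amb g D → Prop
  | .linear, _, _, _ => True
  | .directional, _, x, v => inner ℝ x v = 0

/-- The Killing field of a factor with the value `v` at `x`: a translation of a Euclidean space or
an infinitesimal rotation of a sphere. -/
noncomputable def killingField : (g : Geometry) → (D : ℕ) → Amb g D → Amb g D → Amb g D → Amb g D
  | .linear, _, _, v, _ => v
  | .directional, _, x, v, y => (inner ℝ x y : ℝ) • v - (inner ℝ v y : ℝ) • x

theorem contDiff_killingField (x v : Amb g D) {n : WithTop ℕ∞} :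
    ContDiff ℝ n (killingField g D x v) := by
  cases g
  · exact contDiff_const
  · exact ((contDiff_const.inner ℝ contDiff_id).smul contDiff_const).sub
      ((contDiff_const.inner ℝ contDiff_id).smul contDiff_const)

theorem killingField_self {x v : Amb g D} (hx : x ∈ space g D) (hv : IsTangentVec g D x v) :
    killingField g D x v x = v := by
  cases g
  · rfl
  · have h1 : ‖x‖ = 1 := mem_sphere_zero_iff_norm.1 hx
    have h2 : inner ℝ x v = 0 := hv
    show (inner ℝ x x : ℝ) • v - (inner ℝ v x : ℝ) • x = v
    rw [real_inner_self_eq_norm_sq, h1, real_inner_comm, h2]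
    simp

/-- The reason for choosing Killing fields: the derivative of a kernel centred at `x` along the
field involves exactly `⟨v, y - x⟩`, with no curvature correction. On the sphere the field is
orthogonal to `y`, so only its pairing with `-x` remains. -/
theorem inner_sub_killingField {x v : Amb g D} (hx : x ∈ space g D) (hv : IsTangentVec g D x v)
    (y : Amb g D) : inner ℝ (y - x) (killingField g D x v y) = inner ℝ v (y - x) := by
  cases g
  · exact real_inner_comm _ _
  · have h1 : ‖x‖ = 1 := mem_sphere_zero_iff_norm.1 hx
    have h2 : inner ℝ x v = 0 := hv
    show inner ℝ (y - x) ((inner ℝ x y : ℝ) • v - (inner ℝ v y : ℝ) • x) = inner ℝ v (y - x)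
    rw [inner_sub_left, inner_sub_right, inner_sub_right, inner_sub_right, inner_smul_right,
      inner_smul_right, inner_smul_right, inner_smul_right, real_inner_self_eq_norm_sq, h1, h2,
      real_inner_comm x v, h2, real_inner_comm v y, real_inner_comm x y]
    ring

theorem isOpen_punctured (g : Geometry) (D : ℕ) : IsOpen (punctured g D) := by
  cases g
  · exact isOpen_univ
  · exact isOpen_ne

theorem space_subset_punctured (g : Geometry) (D : ℕ) : space g D ⊆ punctured g D := by
  cases g
  · exact subset_univ _
  · rintro x hx rfl
    have : ‖(0 : Amb .directional D)‖ = 1 := mem_sphere_zero_iff_norm.1 hx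
    simp at this

/-- The class of functions on a factor to which the divergence identity applies. -/
structure IsTestFunction (g : Geometry) (D : ℕ) (φ : Amb g D → ℝ) : Prop where
  contDiffOn : ContDiffOn ℝ 1 φ (punctured g D)
  compact : g = .linear → HasCompactSupport φ

/-- Translations and rotations preserve the reference measure, so their generators are divergence
free. -/
theorem IsTestFunction.integral_fderiv_killingField {φ : Amb g D → ℝ}
    (hφ : IsTestFunction g D φ) {x v : Amb g D} (hx : x ∈ space g D)
    (hv : IsTangentVec g D x v) :
    ∫ y, fderiv ℝ φ y (killingField g D x v y) ∂(refMeasure g D) = 0 := by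
  cases g
  · exact integral_fderiv_of_hasCompactSupport (E := EuclideanSpace ℝ (Fin D))
      (contDiffOn_univ.1 hφ.contDiffOn) (hφ.compact rfl) v
  · exact integral_fderiv_rotation (E := EuclideanSpace ℝ (Fin (D + 1))) isOpen_ne
      (space_subset_punctured .directional D) hφ.contDiffOn
      (mem_sphere_zero_iff_norm.1 hx) hv

theorem IsTestFunction.integrable {φ : Amb g D → ℝ} (hφ : IsTestFunction g D φ)
    {F : Amb g D → ℝ} (hF : ContinuousOn F (punctured g D))
    (hFφ : ∀ y, y ∉ tsupport φ → F y = 0) : Integrable F (refMeasure g D) := by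
  cases g
  · exact Continuous.integrable_of_hasCompactSupport (X := EuclideanSpace ℝ (Fin D))
      (μ := volume) (continuousOn_univ.1 hF)
      (HasCompactSupport.intro (hφ.compact rfl) fun y hy => hFφ y hy)
  · exact integrable_surfaceMeasure (E := EuclideanSpace ℝ (Fin (D + 1)))
      (hF.mono (space_subset_punctured .directional D))

variable {p : ℝ → ℝ}

theorem KernelCond.hasFDerivAt_factorKernel (hp : KernelCond g D p) (h : ℝ) (x y : Amb g D) :
    HasFDerivAt (factorKernel g D p h x)
      (-(factorKernelDeriv g D p h x y / h ^ 2) • innerSL ℝ (y - x)) y := by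
  have e : factorKernel g D p h x = fun y => normConst g D p h *
      (fun u : Amb g D => p (‖u‖ ^ 2 / 2)) (h⁻¹ • (x - y)) := by
    ext y
    simp only [factorKernel, norm_inv_smul_sq_div_two]
    rw [clampProfile_of_nonneg (by positivity)]
  have h1 : HasFDerivAt (fun y : Amb g D => h⁻¹ • (x - y))
      (h⁻¹ • -ContinuousLinearMap.id ℝ (Amb g D)) y :=
    ((hasFDerivAt_id y).const_sub x).const_smul h⁻¹
  have h2 := ((hp.hasFDerivAt_radial (h⁻¹ • (x - y))).comp y h1).const_mul (normConst g D p h)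
  rw [e]
  refine h2.congr_fderiv ?_
  rw [norm_inv_smul_sq_div_two]
  ext w
  simp only [factorKernelDeriv, _root_.smul_apply, ContinuousLinearMap.comp_apply,
    _root_.neg_apply, ContinuousLinearMap.id_apply, innerSL_apply_apply,
    inner_smul_left, inner_smul_right, inner_neg_right, smul_eq_mul, conj_trivial]
  rw [clampProfile_of_nonneg (by positivity), ← neg_sub x y, inner_neg_left]
  ring

theorem KernelCond.continuous_factorKernel (hp : KernelCond g D p) (h : ℝ) (x : Amb g D) :
    Continuous (factorKernel g D p h x) := by
  have := continuous_clampProfile hp.smooth.continuousOn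
  unfold factorKernel
  fun_prop

theorem KernelCond.continuous_factorKernelDeriv (hp : KernelCond g D p) (h : ℝ) (x : Amb g D) :
    Continuous (factorKernelDeriv g D p h x) := by
  have := continuous_clampProfile hp.continuousOn_derivWithin
  unfold factorKernelDeriv
  fun_prop

theorem KernelCond.contDiff_factorKernel (hp : KernelCond g D p) (h : ℝ) (x : Amb g D) :
    ContDiff ℝ 1 (factorKernel g D p h x) := by
  rw [contDiff_one_iff_fderiv]
  refine ⟨fun y => (hp.hasFDerivAt_factorKernel h x y).differentiableAt, ?_⟩
  have hf : fderiv ℝ (factorKernel g D p h x) = fun y =>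
      -(factorKernelDeriv g D p h x y / h ^ 2) • innerSL ℝ (y - x) :=
    funext fun y => (hp.hasFDerivAt_factorKernel h x y).fderiv
  rw [hf]
  have := hp.continuous_factorKernelDeriv h x
  fun_prop

/-- Integration by parts against the gradient of the kernel of a factor. -/
theorem IsTestFunction.integral_kernel_gradient {φ : Amb g D → ℝ} (hφ : IsTestFunction g D φ)
    (hp : KernelCond g D p) (h : ℝ) {x v : Amb g D} (hx : x ∈ space g D)
    (hv : IsTangentVec g D x v) :
    ∫ y, factorKernelDeriv g D p h x y * (inner ℝ v (y - x) / h ^ 2) * φ y ∂(refMeasure g D) =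
      ∫ y, factorKernel g D p h x y * fderiv ℝ φ y (killingField g D x v y)
        ∂(refMeasure g D) := by
  have hφc : ContinuousOn φ (punctured g D) := hφ.contDiffOn.continuousOn
  have hφd : ContinuousOn (fderiv ℝ φ) (punctured g D) :=
    hφ.contDiffOn.continuousOn_fderiv_of_isOpen (isOpen_punctured g D) le_rfl
  have hK := hp.continuous_factorKernel h x
  have hKD := hp.continuous_factorKernelDeriv h x
  have hVc : Continuous (killingField g D x v) := (contDiff_killingField (n := 0) x v).continuous
  have hi1 : Integrable (fun y => factorKernel g D p h x y *
      fderiv ℝ φ y (killingField g D x v y)) (refMeasure g D) := by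
    refine hφ.integrable (hK.continuousOn.mul (hφd.clm_apply hVc.continuousOn)) fun y hy => ?_
    rw [fderiv_of_notMem_tsupport (𝕜 := ℝ) hy]
    simp
  have hi2 : Integrable (fun y => factorKernelDeriv g D p h x y *
      (inner ℝ v (y - x) / h ^ 2) * φ y) (refMeasure g D) := by
    refine hφ.integrable (ContinuousOn.mul (Continuous.continuousOn (by fun_prop)) hφc)
      fun y hy => ?_
    rw [image_eq_zero_of_notMem_tsupport hy, mul_zero]
  -- The divergence identity is applied to the kernel times `φ`; the two terms of the Leibniz rule
  -- are the two sides of the claim.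
  have hprod : IsTestFunction g D fun y => factorKernel g D p h x y * φ y :=
    ⟨(hp.contDiff_factorKernel h x).contDiffOn.mul hφ.contDiffOn,
      fun hg => (hφ.compact hg).mul_left⟩
  have h0 := hprod.integral_fderiv_killingField hx hv
  have hae : ∀ᵐ y ∂(refMeasure g D), fderiv ℝ (fun y => factorKernel g D p h x y * φ y) y
      (killingField g D x v y) =
      factorKernel g D p h x y * fderiv ℝ φ y (killingField g D x v y) -
      factorKernelDeriv g D p h x y * (inner ℝ v (y - x) / h ^ 2) * φ y := by
    filter_upwards [ae_mem_space g D] with y hy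
    have hd : DifferentiableAt ℝ φ y := (hφ.contDiffOn.differentiableOn (by norm_num)).differentiableAt
      ((isOpen_punctured g D).mem_nhds (space_subset_punctured g D hy))
    have := (hp.hasFDerivAt_factorKernel h x y).fun_mul hd.hasFDerivAt
    rw [this.fderiv]
    simp only [_root_.add_apply, _root_.smul_apply, innerSL_apply_apply,
      smul_eq_mul]
    rw [inner_sub_killingField hx hv]
    ring
  rw [integral_congr_ae hae, integral_sub hi1 hi2] at h0
  linarith

end FactorKilling

/-! ### Taylor expansion against a product of approximate kernels. -/

section ProductBias

theorem ApproxKernel.nonneg_const {E₁ : Type*} [NormedAddCommGroup E₁]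
    [NormedSpace ℝ E₁] [MeasurableSpace E₁] {μ : Measure E₁} {x : E₁} {D : ℕ} {W : E₁ → ℝ} {w C h : ℝ}
    (hW : ApproxKernel μ x D W w C h) : 0 ≤ C :=
  (integral_nonneg fun _ => abs_nonneg _).trans hW.abs

theorem ApproxKernel.abs_integral_le {E₁ : Type*} [NormedAddCommGroup E₁]
    [NormedSpace ℝ E₁] [MeasurableSpace E₁] {μ : Measure E₁} {x : E₁} {D : ℕ} {W : E₁ → ℝ} {w C h : ℝ}
    (hW : ApproxKernel μ x D W w C h) : |∫ y, W y ∂μ| ≤ C :=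
  (abs_integral_le_integral_abs).trans hW.abs

variable {E₁ E₂ : Type*} [NormedAddCommGroup E₁] [NormedSpace ℝ E₁] [MeasurableSpace E₁]
  [BorelSpace E₁] [FiniteDimensional ℝ E₁]
  [NormedAddCommGroup E₂] [NormedSpace ℝ E₂] [MeasurableSpace E₂]
  [BorelSpace E₂] [FiniteDimensional ℝ E₂]

theorem ApproxKernel.integrable_first {μ : Measure E₁} {x : E₁} {D : ℕ} {W : E₁ → ℝ} {w C h : ℝ}
    (hW : ApproxKernel μ x D W w C h) : Integrable (fun y => W y • (y - x)) μ := by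
  have hc := hW.cont
  refine (hW.int.abs.add hW.int_second).mono' (Continuous.aestronglyMeasurable (by fun_prop))
    (Eventually.of_forall fun y => ?_)
  rw [norm_smul, Real.norm_eq_abs, Pi.add_apply]
  have : ‖y - x‖ ≤ 1 + ‖y - x‖ ^ 2 := by nlinarith [sq_nonneg (‖y - x‖ - 1)]
  calc _ ≤ |W y| * (1 + ‖y - x‖ ^ 2) := by gcongr
    _ = _ := by ring

theorem ApproxKernel.integral_clm {μ : Measure E₁} {x : E₁} {D : ℕ} {W : E₁ → ℝ} {w C h : ℝ}
    (hW : ApproxKernel μ x D W w C h) (a : E₁ →L[ℝ] ℝ) :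
    Integrable (fun y => W y * a (y - x)) μ ∧ |∫ y, W y * a (y - x) ∂μ| ≤ ‖a‖ * (C * h ^ 2) := by
  have e : ∀ y, W y * a (y - x) = a (W y • (y - x)) := fun y => by
    rw [map_smul, smul_eq_mul]
  simp only [e]
  refine ⟨a.integrable_comp hW.integrable_first, ?_⟩
  rw [a.integral_comp_comm hW.integrable_first, ← Real.norm_eq_abs]
  refine (a.le_opNorm _).trans ?_
  gcongr
  exact hW.first

variable {μ₁ : Measure E₁} {μ₂ : Measure E₂} [SigmaFinite μ₁] [SigmaFinite μ₂]

/-- Second-order bias bound for a product of two approximate kernels. -/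
theorem abs_integral_prod_kernel_sub_le {D₁ D₂ : ℕ} {W₁ : E₁ → ℝ} {W₂ : E₂ → ℝ}
    {w₁ w₂ C₁ C₂ h₁ h₂ : ℝ} {z : E₁ × E₂}
    (hW₁ : ApproxKernel μ₁ z.1 D₁ W₁ w₁ C₁ h₁) (hW₂ : ApproxKernel μ₂ z.2 D₂ W₂ w₂ C₂ h₂)
    {Φ : E₁ × E₂ → ℝ} (hΦm : AEStronglyMeasurable Φ (μ₁.prod μ₂)) (A : E₁ × E₂ →L[ℝ] ℝ) {M : ℝ}
    (hΦ : ∀ᵐ u ∂(μ₁.prod μ₂), |Φ u - Φ z - A (u - z)| ≤ M * ‖u - z‖ ^ 2) (hM : 0 ≤ M) :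
    |∫ u, W₁ u.1 * W₂ u.2 * Φ u ∂(μ₁.prod μ₂) - w₁ * w₂ * Φ z| ≤
      (|Φ z| * (C₁ * C₂ + |w₁| * C₂) + ‖A‖ * (C₁ * C₂) + M * (C₁ * C₂)) * (h₁ ^ 2 + h₂ ^ 2) := by
  have hC₁ := hW₁.nonneg_const
  have hC₂ := hW₂.nonneg_const
  set a₁ : E₁ →L[ℝ] ℝ := A.comp (ContinuousLinearMap.inl ℝ E₁ E₂)
  set a₂ : E₂ →L[ℝ] ℝ := A.comp (ContinuousLinearMap.inr ℝ E₁ E₂)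
  have ha₁ : ‖a₁‖ ≤ ‖A‖ := (ContinuousLinearMap.opNorm_comp_le _ _).trans
    (mul_le_of_le_one_right (norm_nonneg _) (ContinuousLinearMap.norm_inl_le_one ℝ E₁ E₂))
  have ha₂ : ‖a₂‖ ≤ ‖A‖ := (ContinuousLinearMap.opNorm_comp_le _ _).trans
    (mul_le_of_le_one_right (norm_nonneg _) (ContinuousLinearMap.norm_inr_le_one ℝ E₁ E₂))
  have hA : ∀ u : E₁ × E₂, A (u - z) = a₁ (u.1 - z.1) + a₂ (u.2 - z.2) := fun u => by
    simp only [a₁, a₂, ContinuousLinearMap.comp_apply, ← map_add]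
    congr 1
    ext <;> simp
  obtain ⟨i1, b1⟩ := hW₁.integral_clm a₁
  obtain ⟨i2, b2⟩ := hW₂.integral_clm a₂
  have hc1 := hW₁.cont
  have hc2 := hW₂.cont
  -- the four pieces
  have j0 : Integrable (fun u : E₁ × E₂ => W₁ u.1 * W₂ u.2) (μ₁.prod μ₂) :=
    hW₁.int.mul_prod hW₂.int
  have j1 : Integrable (fun u : E₁ × E₂ => W₁ u.1 * a₁ (u.1 - z.1) * W₂ u.2) (μ₁.prod μ₂) :=
    i1.mul_prod hW₂.int
  have j2 : Integrable (fun u : E₁ × E₂ => W₁ u.1 * (W₂ u.2 * a₂ (u.2 - z.2))) (μ₁.prod μ₂) :=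
    hW₁.int.mul_prod i2
  have k1 : Integrable (fun u : E₁ × E₂ => |W₁ u.1| * ‖u.1 - z.1‖ ^ 2 * |W₂ u.2|) (μ₁.prod μ₂) :=
    hW₁.int_second.mul_prod hW₂.int.abs
  have k2 : Integrable (fun u : E₁ × E₂ => |W₁ u.1| * (|W₂ u.2| * ‖u.2 - z.2‖ ^ 2)) (μ₁.prod μ₂) :=
    hW₁.int.abs.mul_prod hW₂.int_second
  have hR : ∀ᵐ u ∂(μ₁.prod μ₂), ‖W₁ u.1 * W₂ u.2 * (Φ u - Φ z - A (u - z))‖ ≤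
      M * (|W₁ u.1| * ‖u.1 - z.1‖ ^ 2 * |W₂ u.2| +
        |W₁ u.1| * (|W₂ u.2| * ‖u.2 - z.2‖ ^ 2)) := by
    filter_upwards [hΦ] with u hu
    -- The product carries the maximum norm, whose square is at most the sum of the two squares.
    have hn : ‖u - z‖ ^ 2 ≤ ‖u.1 - z.1‖ ^ 2 + ‖u.2 - z.2‖ ^ 2 := by
      rw [Prod.norm_def]
      rcases max_cases ‖(u - z).1‖ ‖(u - z).2‖ with ⟨h, _⟩ | ⟨h, _⟩ <;> rw [h]
      · exact le_add_of_nonneg_right (by positivity)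
      · exact le_add_of_nonneg_left (by positivity)
    rw [norm_mul, norm_mul, Real.norm_eq_abs, Real.norm_eq_abs, Real.norm_eq_abs]
    calc _ ≤ |W₁ u.1| * |W₂ u.2| * (M * (‖u.1 - z.1‖ ^ 2 + ‖u.2 - z.2‖ ^ 2)) := by
          gcongr
          exact hu.trans (by gcongr)
      _ = _ := by ring
  have kR : Integrable (fun u : E₁ × E₂ => M * (|W₁ u.1| * ‖u.1 - z.1‖ ^ 2 * |W₂ u.2| +
      |W₁ u.1| * (|W₂ u.2| * ‖u.2 - z.2‖ ^ 2))) (μ₁.prod μ₂) := (k1.add k2).const_mul M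
  have jR : Integrable (fun u : E₁ × E₂ => W₁ u.1 * W₂ u.2 * (Φ u - Φ z - A (u - z)))
      (μ₁.prod μ₂) := by
    refine kR.mono' ?_ hR
    refine AEStronglyMeasurable.mul (Continuous.aestronglyMeasurable (by fun_prop)) ?_
    exact (hΦm.sub aestronglyMeasurable_const).sub
      (Continuous.aestronglyMeasurable (by fun_prop))
  set R := ∫ u, W₁ u.1 * W₂ u.2 * (Φ u - Φ z - A (u - z)) ∂(μ₁.prod μ₂)
  have hRb : |R| ≤ M * (C₁ * h₁ ^ 2 * C₂ + C₁ * (C₂ * h₂ ^ 2)) := by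
    refine (norm_integral_le_of_norm_le kR hR).trans ?_
    rw [integral_const_mul, integral_add k1 k2,
      integral_prod_mul (fun x => |W₁ x| * ‖x - z.1‖ ^ 2) (fun y => |W₂ y|),
      integral_prod_mul (fun x => |W₁ x|) (fun y => |W₂ y| * ‖y - z.2‖ ^ 2)]
    have p1 : 0 ≤ ∫ x, |W₁ x| * ‖x - z.1‖ ^ 2 ∂μ₁ := integral_nonneg fun x => by positivity
    have p2 : 0 ≤ ∫ y, |W₂ y| ∂μ₂ := integral_nonneg fun x => by positivity
    have p3 : 0 ≤ ∫ y, |W₂ y| * ‖y - z.2‖ ^ 2 ∂μ₂ := integral_nonneg fun x => by positivity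
    have q1 := hW₁.second
    have q2 := hW₂.abs
    have q3 := hW₁.abs
    have q4 := hW₂.second
    gcongr
  have s1 : Integrable (fun u : E₁ × E₂ => W₁ u.1 * W₂ u.2 * (Φ u - Φ z - A (u - z)) +
      W₁ u.1 * W₂ u.2 * Φ z) (μ₁.prod μ₂) := jR.add (j0.mul_const _)
  have s2 : Integrable (fun u : E₁ × E₂ => W₁ u.1 * W₂ u.2 * (Φ u - Φ z - A (u - z)) +
      W₁ u.1 * W₂ u.2 * Φ z + W₁ u.1 * a₁ (u.1 - z.1) * W₂ u.2) (μ₁.prod μ₂) := s1.add j1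
  -- Remainder, constant term and one linear term per factor. By Fubini each linear term is a first
  -- moment of one kernel times the mass of the other, hence `O(h²)`.
  have hdecomp : ∫ u, W₁ u.1 * W₂ u.2 * Φ u ∂(μ₁.prod μ₂) =
      R + ((∫ x, W₁ x ∂μ₁) * ∫ y, W₂ y ∂μ₂) * Φ z +
        (∫ x, W₁ x * a₁ (x - z.1) ∂μ₁) * (∫ y, W₂ y ∂μ₂) +
        (∫ x, W₁ x ∂μ₁) * ∫ y, W₂ y * a₂ (y - z.2) ∂μ₂ := by
    rw [← integral_prod_mul W₁ W₂, ← integral_prod_mul (fun x => W₁ x * a₁ (x - z.1)) W₂,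
      ← integral_prod_mul W₁ (fun y => W₂ y * a₂ (y - z.2)), ← integral_mul_const,
      ← integral_add jR (j0.mul_const _), ← integral_add s1 j1, ← integral_add s2 j2]
    refine integral_congr_ae (Eventually.of_forall fun u => ?_)
    simp only [hA]
    ring
  rw [hdecomp]
  set m₁ := ∫ x, W₁ x ∂μ₁
  set m₂ := ∫ y, W₂ y ∂μ₂
  set t₁ := ∫ x, W₁ x * a₁ (x - z.1) ∂μ₁
  set t₂ := ∫ y, W₂ y * a₂ (y - z.2) ∂μ₂
  have hm₁ : |m₁| ≤ C₁ := hW₁.abs_integral_le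
  have hm₂ : |m₂| ≤ C₂ := hW₂.abs_integral_le
  have d₁ := hW₁.mass
  have d₂ := hW₂.mass
  have e0 : |(m₁ * m₂ - w₁ * w₂) * Φ z| ≤
      (C₁ * h₁ ^ 2 * C₂ + |w₁| * (C₂ * h₂ ^ 2)) * |Φ z| := by
    rw [abs_mul]
    gcongr
    calc |m₁ * m₂ - w₁ * w₂| = |(m₁ - w₁) * m₂ + w₁ * (m₂ - w₂)| := by congr 1; ring
      _ ≤ |m₁ - w₁| * |m₂| + |w₁| * |m₂ - w₂| :=
          (abs_add_le _ _).trans (by rw [abs_mul, abs_mul])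
      _ ≤ _ := by gcongr
  have e1 : |t₁ * m₂| ≤ ‖A‖ * (C₁ * h₁ ^ 2) * C₂ := by
    rw [abs_mul]
    gcongr
    exact b1.trans (by gcongr)
  have e2 : |m₁ * t₂| ≤ C₁ * (‖A‖ * (C₂ * h₂ ^ 2)) := by
    rw [abs_mul]
    gcongr
    exact b2.trans (by gcongr)
  calc |R + m₁ * m₂ * Φ z + t₁ * m₂ + m₁ * t₂ - w₁ * w₂ * Φ z|
      = |R + (m₁ * m₂ - w₁ * w₂) * Φ z + t₁ * m₂ + m₁ * t₂| := by congr 1; ring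
    _ ≤ |R| + |(m₁ * m₂ - w₁ * w₂) * Φ z| + |t₁ * m₂| + |m₁ * t₂| :=
        (abs_add_le _ _).trans (by gcongr; exact abs_add_three _ _ _)
    _ ≤ M * (C₁ * h₁ ^ 2 * C₂ + C₁ * (C₂ * h₂ ^ 2)) +
        (C₁ * h₁ ^ 2 * C₂ + |w₁| * (C₂ * h₂ ^ 2)) * |Φ z| +
        ‖A‖ * (C₁ * h₁ ^ 2) * C₂ + C₁ * (‖A‖ * (C₂ * h₂ ^ 2)) := by gcongr
    _ ≤ _ := by
        have : 0 ≤ |Φ z| * |w₁| * C₂ * h₁ ^ 2 + |Φ z| * C₁ * C₂ * h₂ ^ 2 := by positivity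
        nlinarith

/-- A function that is twice differentiable at `z` satisfies a second-order Taylor bound near
`z`. -/
theorem exists_taylor_bound_nhds {E : Type*} [NormedAddCommGroup E] [NormedSpace ℝ E]
    {Φ : E → ℝ} {U : Set E} (hU : IsOpen U) (hΦ : ContDiffOn ℝ 2 Φ U) {z : E} (hz : z ∈ U) :
    ∃ M, ∀ᶠ u in 𝓝 z, |Φ u - Φ z - fderiv ℝ Φ z (u - z)| ≤ M * ‖u - z‖ ^ 2 := by
  -- Differentiability of `fderiv ℝ Φ` at `z` gives a Lipschitz bound at that point; the mean value
  -- inequality on the ball of radius `‖u - z‖` then supplies the second power.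
  have hd : DifferentiableAt ℝ (fderiv ℝ Φ) z :=
    ((hΦ.fderiv_of_isOpen hU (m := 1) (by norm_num)).differentiableOn
      (by norm_num)).differentiableAt (hU.mem_nhds hz)
  obtain ⟨K, hK⟩ := hd.isBigO_sub.bound
  obtain ⟨δ, hδ, hball⟩ := Metric.eventually_nhds_iff_ball.1 (hK.and (hU.mem_nhds hz))
  refine ⟨K, Metric.eventually_nhds_iff_ball.2 ⟨δ, hδ, fun u hu => ?_⟩⟩
  have hsub : Metric.closedBall z ‖u - z‖ ⊆ Metric.ball z δ := fun w hw => by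
    rw [Metric.mem_closedBall] at hw
    rw [Metric.mem_ball, dist_eq_norm] at hu
    exact Metric.mem_ball.2 (hw.trans_lt hu)
  have hK0 : 0 ≤ K * ‖u - z‖ := (norm_nonneg _).trans (hball u hu).1
  have hbd : ∀ w ∈ Metric.closedBall z ‖u - z‖, ‖fderiv ℝ Φ w - fderiv ℝ Φ z‖ ≤ K * ‖u - z‖ := by
    intro w hw
    have h1 := (hball w (hsub hw)).1
    rcases eq_or_ne u z with rfl | hne
    · simp only [sub_self, norm_zero, Metric.closedBall_zero, mem_singleton_iff] at hw
      simp [hw]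
    · have hK : 0 ≤ K := nonneg_of_mul_nonneg_left hK0 (norm_pos_iff.2 (sub_ne_zero.2 hne))
      refine h1.trans ?_
      gcongr
      simpa [dist_eq_norm] using hw
  have := (convex_closedBall z ‖u - z‖).norm_image_sub_le_of_norm_fderiv_le' (𝕜 := ℝ)
    (fun w hw => (hΦ.differentiableOn (by norm_num)).differentiableAt
      (hU.mem_nhds (hball w (hsub hw)).2)) hbd
    (Metric.mem_closedBall_self (norm_nonneg _))
    (y := u) (by simp [dist_eq_norm])
  rw [Real.norm_eq_abs] at this
  exact this.trans (le_of_eq (by ring))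

/-- A locally twice differentiable function that is bounded on a set satisfies a global second-order
Taylor bound on this set. -/
theorem exists_taylor_bound {E : Type*} [NormedAddCommGroup E] [NormedSpace ℝ E]
    {Φ : E → ℝ} {U S : Set E} (hU : IsOpen U) (hΦ : ContDiffOn ℝ 2 Φ U) {z : E} (hz : z ∈ U)
    (hzS : z ∈ S) {B : ℝ} (hB : ∀ u ∈ S, |Φ u| ≤ B) :
    ∃ M, 0 ≤ M ∧ ∀ u ∈ S, |Φ u - Φ z - fderiv ℝ Φ z (u - z)| ≤ M * ‖u - z‖ ^ 2 := by
  obtain ⟨M, hM⟩ := exists_taylor_bound_nhds hU hΦ hz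
  obtain ⟨δ, hδ, hball⟩ := Metric.eventually_nhds_iff_ball.1 hM
  have hB0 : 0 ≤ B := (abs_nonneg _).trans (hB z hzS)
  -- Away from the ball `1 ≤ ‖u - z‖/δ`, and powers of this quotient absorb the bounds on the values
  -- and on the linear term.
  refine ⟨max M (2 * B / δ ^ 2 + ‖fderiv ℝ Φ z‖ / δ), le_max_of_le_right (by positivity),
    fun u hu => ?_⟩
  by_cases h : u ∈ Metric.ball z δ
  · refine (hball u h).trans ?_
    gcongr
    exact le_max_left _ _
  · have hd : δ ≤ ‖u - z‖ := by simpa [dist_eq_norm] using h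
    have h1 : 1 ≤ ‖u - z‖ / δ := (one_le_div hδ).2 hd
    calc _ ≤ |Φ u| + |Φ z| + ‖fderiv ℝ Φ z‖ * ‖u - z‖ := by
          refine (abs_sub _ _).trans (add_le_add (abs_sub _ _) ?_)
          rw [← Real.norm_eq_abs]
          exact ContinuousLinearMap.le_opNorm _ _
      _ ≤ B * 1 ^ 2 + B * 1 ^ 2 + ‖fderiv ℝ Φ z‖ * ‖u - z‖ * 1 := by
          have := hB u hu
          have := hB z hzS
          linarith
      _ ≤ B * (‖u - z‖ / δ) ^ 2 + B * (‖u - z‖ / δ) ^ 2 +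
          ‖fderiv ℝ Φ z‖ * ‖u - z‖ * (‖u - z‖ / δ) := by gcongr
      _ = (2 * B / δ ^ 2 + ‖fderiv ℝ Φ z‖ / δ) * ‖u - z‖ ^ 2 := by ring
      _ ≤ _ := by
          gcongr
          exact le_max_right _ _

end ProductBias

/-! ### Regularity of the density and integration by parts on the product. -/

section Density

variable {g₁ g₂ : Geometry} {D₁ D₂ : ℕ}

theorem retract_of_mem_space {g : Geometry} {D : ℕ} {x : Amb g D} (hx : x ∈ space g D) :
    retract g D x = x := by
  cases g
  · rfl
  · have h1 : ‖x‖ = 1 := mem_sphere_zero_iff_norm.1 hx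
    show ‖x‖⁻¹ • x = x
    rw [h1, inv_one, one_smul]

theorem retract_mem_space {g : Geometry} {D : ℕ} {x : Amb g D} (hx : x ∈ punctured g D) :
    retract g D x ∈ space g D := by
  cases g
  · exact mem_univ _
  · have h1 : ‖x‖ ≠ 0 := norm_ne_zero_iff.2 hx
    refine mem_sphere_zero_iff_norm.2 ?_
    show ‖‖x‖⁻¹ • x‖ = 1
    rw [norm_smul, norm_inv, norm_norm, inv_mul_cancel₀ h1]

theorem radialExt_of_mem {f : Amb g₁ D₁ × Amb g₂ D₂ → ℝ} {u : Amb g₁ D₁ × Amb g₂ D₂}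
    (hu : u ∈ prodSpace g₁ g₂ D₁ D₂) : radialExt f u = f u := by
  rw [radialExt, retract_of_mem_space hu.1, retract_of_mem_space hu.2]

/-- The open subset of the ambient space on which the radial extension is defined. -/
def puncturedProd (g₁ g₂ : Geometry) (D₁ D₂ : ℕ) : Set (Amb g₁ D₁ × Amb g₂ D₂) :=
  punctured g₁ D₁ ×ˢ punctured g₂ D₂

theorem isOpen_puncturedProd : IsOpen (puncturedProd g₁ g₂ D₁ D₂) :=
  (isOpen_punctured g₁ D₁).prod (isOpen_punctured g₂ D₂)

theorem prodSpace_subset_puncturedProd :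
    prodSpace g₁ g₂ D₁ D₂ ⊆ puncturedProd g₁ g₂ D₁ D₂ :=
  prod_mono (space_subset_punctured g₁ D₁) (space_subset_punctured g₂ D₂)

theorem ae_mem_prodSpace : ∀ᵐ u ∂(prodMeasure g₁ g₂ D₁ D₂), u ∈ prodSpace g₁ g₂ D₁ D₂ := by
  have h1 : ∀ᵐ u ∂(prodMeasure g₁ g₂ D₁ D₂), u.1 ∈ space g₁ D₁ :=
    Measure.quasiMeasurePreserving_fst.ae (ae_mem_space g₁ D₁)
  have h2 : ∀ᵐ u ∂(prodMeasure g₁ g₂ D₁ D₂), u.2 ∈ space g₂ D₂ :=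
    Measure.quasiMeasurePreserving_snd.ae (ae_mem_space g₂ D₂)
  filter_upwards [h1, h2] with u hu1 hu2 using ⟨hu1, hu2⟩

theorem aestronglyMeasurable_prodMeasure {Φ : Amb g₁ D₁ × Amb g₂ D₂ → ℝ}
    (hΦ : ContinuousOn Φ (puncturedProd g₁ g₂ D₁ D₂)) :
    AEStronglyMeasurable Φ (prodMeasure g₁ g₂ D₁ D₂) := by
  have h : ∀ᵐ u ∂(prodMeasure g₁ g₂ D₁ D₂), u ∈ puncturedProd g₁ g₂ D₁ D₂ :=
    ae_mem_prodSpace.mono fun u hu => prodSpace_subset_puncturedProd hu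
  rw [← Measure.restrict_eq_self_of_ae_mem h]
  exact hΦ.aestronglyMeasurable isOpen_puncturedProd.measurableSet

variable {f : Amb g₁ D₁ × Amb g₂ D₂ → ℝ}

namespace DensityCond

theorem contDiffOn (hf : DensityCond f) :
    ContDiffOn ℝ 3 (radialExt f) (puncturedProd g₁ g₂ D₁ D₂) := hf.smooth

theorem isTestFunction_fst (hf : DensityCond f) {y : Amb g₂ D₂} (hy : y ∈ space g₂ D₂) :
    IsTestFunction g₁ D₁ fun x => radialExt f (x, y) := by
  refine ⟨?_, fun hg => ?_⟩
  · exact (hf.contDiffOn.of_le (by norm_num)).comp (contDiffOn_id.prodMk contDiffOn_const)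
      fun x hx => ⟨hx, space_subset_punctured g₂ D₂ hy⟩
  · obtain ⟨K, hK, hKf⟩ := hf.compact₁ hg
    refine HasCompactSupport.intro hK fun x hx => ?_
    subst hg
    have hm : (x, y) ∈ prodSpace .linear g₂ D₁ D₂ := ⟨mem_univ _, hy⟩
    rw [radialExt_of_mem hm]
    exact hKf _ hm hx

theorem isTestFunction_snd (hf : DensityCond f) {x : Amb g₁ D₁} (hx : x ∈ space g₁ D₁) :
    IsTestFunction g₂ D₂ fun y => radialExt f (x, y) := by
  refine ⟨?_, fun hg => ?_⟩
  · exact (hf.contDiffOn.of_le (by norm_num)).comp (contDiffOn_const.prodMk contDiffOn_id)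
      fun y hy => ⟨space_subset_punctured g₁ D₁ hx, hy⟩
  · obtain ⟨K, hK, hKf⟩ := hf.compact₂ hg
    refine HasCompactSupport.intro hK fun y hy => ?_
    subst hg
    have hm : (x, y) ∈ prodSpace g₁ .linear D₁ D₂ := ⟨hx, mem_univ _⟩
    rw [radialExt_of_mem hm]
    exact hKf _ hm hy

/-- The density vanishes near every point of the product space outside a compact set. -/
theorem exists_compact (hf : DensityCond f) :
    ∃ Q : Set (Amb g₁ D₁ × Amb g₂ D₂), IsCompact Q ∧ Q ⊆ prodSpace g₁ g₂ D₁ D₂ ∧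
      ∀ u ∈ prodSpace g₁ g₂ D₁ D₂, u ∉ Q → radialExt f =ᶠ[𝓝 u] 0 := by
  -- A sphere is itself compact. For a Euclidean factor the complement of the compact set is open,
  -- so the density vanishes on a neighbourhood and its derivatives vanish too.
  have h1 : ∃ Q₁ : Set (Amb g₁ D₁), IsCompact Q₁ ∧ Q₁ ⊆ space g₁ D₁ ∧
      ∀ u ∈ prodSpace g₁ g₂ D₁ D₂, u.1 ∉ Q₁ → radialExt f =ᶠ[𝓝 u] 0 := by
    cases g₁
    · obtain ⟨K, hK, hKf⟩ := hf.compact₁ rfl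
      refine ⟨K, hK, subset_univ _, fun u hu hu1 => ?_⟩
      have ho : IsOpen (Prod.fst ⁻¹' Kᶜ : Set (Amb .linear D₁ × Amb g₂ D₂)) :=
        hK.isClosed.isOpen_compl.preimage continuous_fst
      filter_upwards [ho.mem_nhds hu1,
        isOpen_puncturedProd.mem_nhds (prodSpace_subset_puncturedProd hu)] with w hw1 hw2
      exact hKf (retract .linear D₁ w.1, retract g₂ D₂ w.2) ⟨mem_univ _, retract_mem_space hw2.2⟩
        hw1
    · exact ⟨space .directional D₁, isCompact_sphere (0 : EuclideanSpace ℝ (Fin (D₁ + 1))) 1,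
        subset_rfl, fun u hu hu1 => absurd hu.1 hu1⟩
  have h2 : ∃ Q₂ : Set (Amb g₂ D₂), IsCompact Q₂ ∧ Q₂ ⊆ space g₂ D₂ ∧
      ∀ u ∈ prodSpace g₁ g₂ D₁ D₂, u.2 ∉ Q₂ → radialExt f =ᶠ[𝓝 u] 0 := by
    cases g₂
    · obtain ⟨K, hK, hKf⟩ := hf.compact₂ rfl
      refine ⟨K, hK, subset_univ _, fun u hu hu1 => ?_⟩
      have ho : IsOpen (Prod.snd ⁻¹' Kᶜ : Set (Amb g₁ D₁ × Amb .linear D₂)) :=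
        hK.isClosed.isOpen_compl.preimage continuous_snd
      filter_upwards [ho.mem_nhds hu1,
        isOpen_puncturedProd.mem_nhds (prodSpace_subset_puncturedProd hu)] with w hw1 hw2
      exact hKf (retract g₁ D₁ w.1, retract .linear D₂ w.2) ⟨retract_mem_space hw2.1, mem_univ _⟩
        hw1
    · exact ⟨space .directional D₂, isCompact_sphere (0 : EuclideanSpace ℝ (Fin (D₂ + 1))) 1,
        subset_rfl, fun u hu hu1 => absurd hu.2 hu1⟩
  obtain ⟨Q₁, hQ₁, hs₁, hz₁⟩ := h1
  obtain ⟨Q₂, hQ₂, hs₂, hz₂⟩ := h2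
  refine ⟨Q₁ ×ˢ Q₂, hQ₁.prod hQ₂, prod_mono hs₁ hs₂, fun u hu huQ => ?_⟩
  by_cases h : u.1 ∈ Q₁
  · exact hz₂ u hu fun h' => huQ ⟨h, h'⟩
  · exact hz₁ u hu h

/-- Continuous functions that vanish where the density vanishes locally are bounded on the
product space. -/
theorem exists_bound (hf : DensityCond f) {Φ : Amb g₁ D₁ × Amb g₂ D₂ → ℝ}
    (hΦ : ContinuousOn Φ (puncturedProd g₁ g₂ D₁ D₂))
    (hΦ0 : ∀ u, radialExt f =ᶠ[𝓝 u] 0 → Φ u = 0) :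
    ∃ B, ∀ u ∈ prodSpace g₁ g₂ D₁ D₂, |Φ u| ≤ B := by
  obtain ⟨Q, hQ, hQs, hQ0⟩ := hf.exists_compact
  obtain ⟨B, hB⟩ := hQ.exists_bound_of_continuousOn
    (hΦ.mono (hQs.trans prodSpace_subset_puncturedProd))
  refine ⟨max B 0, fun u hu => ?_⟩
  by_cases h : u ∈ Q
  · exact (hB u h).trans (le_max_left _ _)
  · rw [hΦ0 u (hQ0 u hu h), abs_zero]
    exact le_max_right _ _

/-- The derivative of the extended density along a vector field. -/
noncomputable def _root_.ProdKDE.derivAlong (f : Amb g₁ D₁ × Amb g₂ D₂ → ℝ)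
    (V : Amb g₁ D₁ × Amb g₂ D₂ → Amb g₁ D₁ × Amb g₂ D₂) (u : Amb g₁ D₁ × Amb g₂ D₂) : ℝ :=
  fderiv ℝ (radialExt f) u (V u)

theorem contDiffOn_derivAlong (hf : DensityCond f)
    {V : Amb g₁ D₁ × Amb g₂ D₂ → Amb g₁ D₁ × Amb g₂ D₂} (hV : ContDiff ℝ 2 V) :
    ContDiffOn ℝ 2 (derivAlong f V) (puncturedProd g₁ g₂ D₁ D₂) :=
  (hf.contDiffOn.fderiv_of_isOpen isOpen_puncturedProd (m := 2) (by norm_num)).clm_apply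
    hV.contDiffOn

theorem derivAlong_eq_zero {V : Amb g₁ D₁ × Amb g₂ D₂ → Amb g₁ D₁ × Amb g₂ D₂}
    {u : Amb g₁ D₁ × Amb g₂ D₂} (hu : radialExt f =ᶠ[𝓝 u] 0) : derivAlong f V u = 0 := by
  rw [derivAlong, hu.fderiv_eq]
  simp

theorem exists_taylor (hf : DensityCond f) {z : Amb g₁ D₁ × Amb g₂ D₂}
    (hz : z ∈ prodSpace g₁ g₂ D₁ D₂) {Φ : Amb g₁ D₁ × Amb g₂ D₂ → ℝ}
    (hΦ : ContDiffOn ℝ 2 Φ (puncturedProd g₁ g₂ D₁ D₂))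
    (hΦ0 : ∀ u, radialExt f =ᶠ[𝓝 u] 0 → Φ u = 0) :
    ∃ M, 0 ≤ M ∧ ∀ᵐ u ∂(prodMeasure g₁ g₂ D₁ D₂),
      |Φ u - Φ z - fderiv ℝ Φ z (u - z)| ≤ M * ‖u - z‖ ^ 2 := by
  obtain ⟨B, hB⟩ := hf.exists_bound hΦ.continuousOn hΦ0
  obtain ⟨M, hM, h⟩ := exists_taylor_bound isOpen_puncturedProd hΦ
    (prodSpace_subset_puncturedProd hz) hz hB
  exact ⟨M, hM, ae_mem_prodSpace.mono h⟩

variable {p₁ p₂ : ℝ → ℝ}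

/-- Bias of product kernels. -/
theorem exists_bias (hf : DensityCond f) {z : Amb g₁ D₁ × Amb g₂ D₂}
    (hz : z ∈ prodSpace g₁ g₂ D₁ D₂) {Φ : Amb g₁ D₁ × Amb g₂ D₂ → ℝ}
    (hΦ : ContDiffOn ℝ 2 Φ (puncturedProd g₁ g₂ D₁ D₂))
    (hΦ0 : ∀ u, radialExt f =ᶠ[𝓝 u] 0 → Φ u = 0) (w₁ w₂ C₁ C₂ : ℝ) :
    ∃ C, ∀ h₁ h₂ W₁ W₂, ApproxKernel (refMeasure g₁ D₁) z.1 D₁ W₁ w₁ C₁ h₁ →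
      ApproxKernel (refMeasure g₂ D₂) z.2 D₂ W₂ w₂ C₂ h₂ →
      |∫ u, W₁ u.1 * W₂ u.2 * Φ u ∂(prodMeasure g₁ g₂ D₁ D₂) - w₁ * w₂ * Φ z| ≤
        C * (h₁ ^ 2 + h₂ ^ 2) := by
  -- The Taylor constant is fixed before bandwidths and weights are introduced, which makes the bias
  -- constant uniform in them.
  obtain ⟨M, hM, hT⟩ := hf.exists_taylor hz hΦ hΦ0
  exact ⟨_, fun h₁ h₂ W₁ W₂ hW₁ hW₂ => abs_integral_prod_kernel_sub_le hW₁ hW₂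
    (aestronglyMeasurable_prodMeasure hΦ.continuousOn) _ hT hM⟩

theorem exists_bound_radialExt (hf : DensityCond f) :
    ∃ B, ∀ᵐ u ∂(prodMeasure g₁ g₂ D₁ D₂), |radialExt f u| ≤ B := by
  obtain ⟨B, hB⟩ := hf.exists_bound hf.contDiffOn.continuousOn fun u hu => hu.self_of_nhds
  exact ⟨B, ae_mem_prodSpace.mono hB⟩

theorem integrable_mul (hf : DensityCond f) {G Φ : Amb g₁ D₁ × Amb g₂ D₂ → ℝ}
    (hG : Integrable G (prodMeasure g₁ g₂ D₁ D₂))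
    (hΦ : ContinuousOn Φ (puncturedProd g₁ g₂ D₁ D₂))
    (hΦ0 : ∀ u, radialExt f =ᶠ[𝓝 u] 0 → Φ u = 0) :
    Integrable (fun u => G u * Φ u) (prodMeasure g₁ g₂ D₁ D₂) := by
  obtain ⟨B, hB⟩ := hf.exists_bound hΦ hΦ0
  exact hG.mul_bdd (c := B) (aestronglyMeasurable_prodMeasure hΦ)
    (ae_mem_prodSpace.mono hB)

theorem integrable_mul_radialExt (hf : DensityCond f) {G : Amb g₁ D₁ × Amb g₂ D₂ → ℝ}
    (hG : Integrable G (prodMeasure g₁ g₂ D₁ D₂)) :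
    Integrable (fun u => G u * radialExt f u) (prodMeasure g₁ g₂ D₁ D₂) :=
  hf.integrable_mul hG hf.contDiffOn.continuousOn fun _ hu => hu.self_of_nhds

theorem hasFDerivAt (hf : DensityCond f) {z : Amb g₁ D₁ × Amb g₂ D₂}
    (hz : z ∈ prodSpace g₁ g₂ D₁ D₂) :
    HasFDerivAt (radialExt f) (fderiv ℝ (radialExt f) z) z :=
  ((hf.contDiffOn.differentiableOn (by norm_num)).differentiableAt
    (isOpen_puncturedProd.mem_nhds (prodSpace_subset_puncturedProd hz))).hasFDerivAt

theorem hasFDerivAt_fst (hf : DensityCond f) {z : Amb g₁ D₁ × Amb g₂ D₂}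
    (hz : z ∈ prodSpace g₁ g₂ D₁ D₂) : HasFDerivAt (fun x => radialExt f (x, z.2))
      ((fderiv ℝ (radialExt f) z).comp (ContinuousLinearMap.inl ℝ _ _)) z.1 :=
  HasFDerivAt.comp (g := radialExt f) (f := fun x => (x, z.2)) z.1 (hf.hasFDerivAt hz)
    (hasFDerivAt_prodMk_left z.1 z.2)

theorem hasFDerivAt_snd (hf : DensityCond f) {z : Amb g₁ D₁ × Amb g₂ D₂}
    (hz : z ∈ prodSpace g₁ g₂ D₁ D₂) : HasFDerivAt (fun y => radialExt f (z.1, y))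
      ((fderiv ℝ (radialExt f) z).comp (ContinuousLinearMap.inr ℝ _ _)) z.2 :=
  HasFDerivAt.comp (g := radialExt f) (f := fun y => (z.1, y)) z.2 (hf.hasFDerivAt hz)
    (hasFDerivAt_prodMk_right z.1 z.2)

/-- Integration by parts in the first factor. -/
theorem integral_gradient_fst (hf : DensityCond f) (hp₁ : KernelCond g₁ D₁ p₁)
    {x v : Amb g₁ D₁} (hx : x ∈ space g₁ D₁) (hv : IsTangentVec g₁ D₁ x v) (h : ℝ)
    {W : Amb g₂ D₂ → ℝ}
    (hi : Integrable (fun u => factorKernelDeriv g₁ D₁ p₁ h x u.1 *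
      (inner ℝ v (u.1 - x) / h ^ 2) * W u.2 * radialExt f u) (prodMeasure g₁ g₂ D₁ D₂))
    (hi' : Integrable (fun u => factorKernel g₁ D₁ p₁ h x u.1 * W u.2 *
      derivAlong f (fun u => (killingField g₁ D₁ x v u.1, 0)) u) (prodMeasure g₁ g₂ D₁ D₂)) :
    ∫ u, factorKernelDeriv g₁ D₁ p₁ h x u.1 * (inner ℝ v (u.1 - x) / h ^ 2) * W u.2 *
        radialExt f u ∂(prodMeasure g₁ g₂ D₁ D₂) =
      ∫ u, factorKernel g₁ D₁ p₁ h x u.1 * W u.2 *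
        derivAlong f (fun u => (killingField g₁ D₁ x v u.1, 0)) u
        ∂(prodMeasure g₁ g₂ D₁ D₂) := by
  unfold prodMeasure at *
  -- With the first variable innermost, the other kernel is a constant on each slice and the
  -- one-factor identity applies.
  rw [integral_prod_symm _ hi, integral_prod_symm _ hi']
  refine integral_congr_ae ?_
  filter_upwards [ae_mem_space g₂ D₂] with y hy
  have key := (hf.isTestFunction_fst hy).integral_kernel_gradient hp₁ h hx hv
  have e1 : ∫ a, factorKernelDeriv g₁ D₁ p₁ h x a * (inner ℝ v (a - x) / h ^ 2) * W y *
      radialExt f (a, y) ∂(refMeasure g₁ D₁) = W y * ∫ a, factorKernelDeriv g₁ D₁ p₁ h x a *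
        (inner ℝ v (a - x) / h ^ 2) * radialExt f (a, y) ∂(refMeasure g₁ D₁) := by
    rw [← integral_const_mul]
    congr 1
    ext a
    ring
  rw [e1, key, ← integral_const_mul]
  refine integral_congr_ae ?_
  filter_upwards [ae_mem_space g₁ D₁] with a ha
  have hm : (a, y) ∈ prodSpace g₁ g₂ D₁ D₂ := ⟨ha, hy⟩
  rw [(hf.hasFDerivAt_fst hm).fderiv, derivAlong]
  simp only [ContinuousLinearMap.comp_apply, ContinuousLinearMap.inl_apply]
  ring

/-- Integration by parts in the second factor. -/
theorem integral_gradient_snd (hf : DensityCond f) (hp₂ : KernelCond g₂ D₂ p₂)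
    {y v : Amb g₂ D₂} (hy : y ∈ space g₂ D₂) (hv : IsTangentVec g₂ D₂ y v) (h : ℝ)
    {W : Amb g₁ D₁ → ℝ}
    (hi : Integrable (fun u => W u.1 * (factorKernelDeriv g₂ D₂ p₂ h y u.2 *
      (inner ℝ v (u.2 - y) / h ^ 2)) * radialExt f u) (prodMeasure g₁ g₂ D₁ D₂))
    (hi' : Integrable (fun u => W u.1 * factorKernel g₂ D₂ p₂ h y u.2 *
      derivAlong f (fun u => (0, killingField g₂ D₂ y v u.2)) u) (prodMeasure g₁ g₂ D₁ D₂)) :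
    ∫ u, W u.1 * (factorKernelDeriv g₂ D₂ p₂ h y u.2 * (inner ℝ v (u.2 - y) / h ^ 2)) *
        radialExt f u ∂(prodMeasure g₁ g₂ D₁ D₂) =
      ∫ u, W u.1 * factorKernel g₂ D₂ p₂ h y u.2 *
        derivAlong f (fun u => (0, killingField g₂ D₂ y v u.2)) u
        ∂(prodMeasure g₁ g₂ D₁ D₂) := by
  unfold prodMeasure at *
  rw [integral_prod _ hi, integral_prod _ hi']
  refine integral_congr_ae ?_
  filter_upwards [ae_mem_space g₁ D₁] with x hx
  have key := (hf.isTestFunction_snd hx).integral_kernel_gradient hp₂ h hy hv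
  have e1 : ∫ b, W x * (factorKernelDeriv g₂ D₂ p₂ h y b * (inner ℝ v (b - y) / h ^ 2)) *
      radialExt f (x, b) ∂(refMeasure g₂ D₂) = W x * ∫ b, factorKernelDeriv g₂ D₂ p₂ h y b *
        (inner ℝ v (b - y) / h ^ 2) * radialExt f (x, b) ∂(refMeasure g₂ D₂) := by
    rw [← integral_const_mul]
    congr 1
    ext b
    ring
  rw [e1, key, ← integral_const_mul]
  refine integral_congr_ae ?_
  filter_upwards [ae_mem_space g₂ D₂] with b hb
  have hm : (x, b) ∈ prodSpace g₁ g₂ D₁ D₂ := ⟨hx, hb⟩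
  rw [(hf.hasFDerivAt_snd hm).fderiv, derivAlong]
  simp only [ContinuousLinearMap.comp_apply, ContinuousLinearMap.inr_apply]
  ring

end DensityCond

end Density

/-! ### Calculus of boundedness in probability. -/

section BoundedInProbability

variable {Ω : Type*} [MeasurableSpace Ω] {P : Measure Ω}

theorem IsBigOP.tendsto_measure {V : Type*} [Norm V] {X : ℕ → Ω → V} {r : ℕ → ℝ}
    (hX : IsBigOP P X r) (hr : Tendsto r atTop (𝓝 0)) {δ : ℝ} (hδ : 0 < δ) :
    Tendsto (fun n => P {ω | δ < ‖X n ω‖}) atTop (𝓝 0) := by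
  refine ENNReal.tendsto_nhds_zero.2 fun ε hε => ?_
  obtain ⟨ε', hε', hle⟩ : ∃ ε' : ℝ, 0 < ε' ∧ ENNReal.ofReal ε' ≤ ε := by
    rcases eq_or_ne ε ⊤ with rfl | h
    · exact ⟨1, one_pos, le_top⟩
    · exact ⟨ε.toReal, ENNReal.toReal_pos hε.ne' h, ENNReal.ofReal_toReal h |>.le⟩
  obtain ⟨M, hM⟩ := hX ε' hε'
  have h1 : Tendsto (fun n => M * r n) atTop (𝓝 0) := by simpa using hr.const_mul M
  filter_upwards [hM, h1.eventually (gt_mem_nhds hδ)] with n hn hn'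
  refine (measure_mono fun ω hω => ?_).trans (hn.trans hle)
  exact hn'.trans hω

/-- A sequence that is controlled by finitely many sequences bounded in probability, as long as
these are small, is bounded in probability. -/
theorem IsBigOP.of_finite_control {ι : Type*} [Fintype ι] {V : Type*} [Norm V]
    {X : ℕ → Ω → V} {Y : ι → ℕ → Ω → ℝ} {r : ℕ → ℝ} (hr0 : ∀ n, 0 ≤ r n)
    (hr : Tendsto r atTop (𝓝 0)) (hY : ∀ j, IsBigOP P (Y j) r) {δ C : ℝ} (hδ : 0 < δ)
    (hX : ∀ᶠ n in atTop, ∀ ω, ∀ s, 0 ≤ s → s ≤ δ → (∀ j, |Y j n ω| ≤ s) → ‖X n ω‖ ≤ C * s) :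
    IsBigOP P X r := by
  intro ε hε
  -- The probability budget is split evenly among the controlling sequences; the added one keeps the
  -- division valid for an empty index type.
  set N : ℝ := Fintype.card ι + 1
  have hN : 0 < N := by positivity
  choose M hM using fun j => hY j (ε / N) (by positivity)
  set M' := ∑ j, |M j|
  have hMM : ∀ j, M j ≤ M' := fun j => (le_abs_self _).trans
    (Finset.single_le_sum (f := fun j => |M j|) (fun j _ => abs_nonneg _) (Finset.mem_univ j))
  have hM'0 : 0 ≤ M' := Finset.sum_nonneg fun j _ => abs_nonneg _
  have h1 : Tendsto (fun n => M' * r n) atTop (𝓝 0) := by simpa using hr.const_mul M'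
  refine ⟨C * M', ?_⟩
  filter_upwards [eventually_all.2 hM, h1.eventually (gt_mem_nhds hδ), hX] with n hn hsmall hXn
  have hsub : {ω | C * M' * r n < ‖X n ω‖} ⊆ ⋃ j, {ω | M j * r n < ‖Y j n ω‖} := by
    intro ω hω
    by_contra hcon
    simp only [mem_iUnion, mem_ofPred_eq, not_exists, not_lt] at hcon
    have := hXn ω (M' * r n) (mul_nonneg hM'0 (hr0 n)) hsmall.le fun j =>
      (hcon j).trans (mul_le_mul_of_nonneg_right (hMM j) (hr0 n))
    have hω' : C * M' * r n < ‖X n ω‖ := hω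
    linarith
  calc _ ≤ ∑ j, P {ω | M j * r n < ‖Y j n ω‖} :=
        (measure_mono hsub).trans (measure_iUnion_fintype_le _ _)
    _ ≤ ∑ _j : ι, ENNReal.ofReal (ε / N) := Finset.sum_le_sum fun j _ => hn j
    _ = ENNReal.ofReal (Fintype.card ι * (ε / N)) := by
        rw [Finset.sum_const, nsmul_eq_mul, ENNReal.ofReal_mul (by positivity)]
        simp
    _ ≤ ENNReal.ofReal ε := by
        refine ENNReal.ofReal_le_ofReal ?_
        rw [mul_div_assoc', div_le_iff₀ hN]
        simp only [N]
        nlinarith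

end BoundedInProbability

/-! ### Chebyshev's inequality for empirical means. -/

section EmpiricalMeans

variable {Ω : Type*} [MeasurableSpace Ω] {P : Measure Ω} [IsProbabilityMeasure P]
  {S : Type*} [MeasurableSpace S]

/-- The empirical mean of `φ` over the first `n` points of the sample. -/
noncomputable def empMean (n : ℕ) (Z : ℕ → S) (φ : S → ℝ) : ℝ :=
  (1 / (n : ℝ)) * ∑ i ∈ Finset.range n, φ (Z i)

/-- Chebyshev's inequality for empirical means. -/
theorem measure_lt_abs_empMean_sub_le {Z : ℕ → Ω → S} (hZm : ∀ i, Measurable (Z i))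
    (hZ : iIndepFun Z P) {φ : S → ℝ} (hφ : Measurable φ) {m v : ℝ}
    (hint : ∀ i, Integrable (fun ω => φ (Z i ω) ^ 2) P)
    (hmean : ∀ i, ∫ ω, φ (Z i ω) ∂P = m) (hvar : ∀ i, ∫ ω, φ (Z i ω) ^ 2 ∂P ≤ v)
    {n : ℕ} (hn : 0 < n) {t : ℝ} (ht : 0 < t) :
    P {ω | t < |empMean n (fun i => Z i ω) φ - m|} ≤ ENNReal.ofReal (v / (n * t ^ 2)) := by
  have hn' : (0 : ℝ) < n := Nat.cast_pos.2 hn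
  have hmeas : ∀ i, AEStronglyMeasurable (fun ω => φ (Z i ω)) P := fun i =>
    (hφ.comp (hZm i)).aestronglyMeasurable
  have hLp : ∀ i, MemLp (fun ω => φ (Z i ω)) 2 P := fun i =>
    (memLp_two_iff_integrable_sq (hmeas i)).2 (hint i)
  have hLpsum : MemLp (∑ i ∈ Finset.range n, fun ω => φ (Z i ω)) 2 P :=
    memLp_finsetSum' _ fun i _ => hLp i
  have hvarsum : Var[∑ i ∈ Finset.range n, fun ω => φ (Z i ω); P] ≤ n * v := by
    rw [IndepFun.variance_sum (fun i _ => hLp i)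
      (fun i _ j _ hij => (hZ.indepFun hij).comp hφ hφ)]
    calc _ ≤ ∑ _i ∈ Finset.range n, v := Finset.sum_le_sum fun i _ =>
          (variance_le_expectation_sq (hmeas i)).trans (hvar i)
      _ = n * v := by simp
  have hmeansum : ∫ ω, (∑ i ∈ Finset.range n, fun ω => φ (Z i ω)) ω ∂P = n * m := by
    simp only [Finset.sum_apply]
    rw [integral_finsetSum _ fun i _ => (hLp i).integrable (by norm_num)]
    simp [hmean]
  have hch := meas_ge_le_variance_div_sq hLpsum (c := n * t) (by positivity)
  rw [hmeansum] at hch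
  refine (measure_mono fun ω hω => ?_).trans (hch.trans (ENNReal.ofReal_le_ofReal ?_))
  · have hω' : t < |empMean n (fun i => Z i ω) φ - m| := hω
    have e : (∑ i ∈ Finset.range n, fun ω => φ (Z i ω)) ω - n * m =
        n * (empMean n (fun i => Z i ω) φ - m) := by
      simp only [empMean, Finset.sum_apply]
      field_simp
    show n * t ≤ |(∑ i ∈ Finset.range n, fun ω => φ (Z i ω)) ω - n * m|
    rw [e, abs_mul, abs_of_pos hn']
    gcongr
  · calc _ ≤ n * v / (n * t) ^ 2 := by gcongr
      _ = v / (n * t ^ 2) := by field_simp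

/-- Empirical means deviate from their expectations at the rate given by the second moments. -/
theorem isBigOP_empMean_sub {Z : ℕ → Ω → S} (hZm : ∀ i, Measurable (Z i))
    (hZ : iIndepFun Z P) {φ : ℕ → S → ℝ} (hφ : ∀ n, Measurable (φ n)) {m a : ℕ → ℝ} {V : ℝ}
    (ha : ∀ n, 0 < a n) (h : ∀ᶠ n in atTop, ∀ i, Integrable (fun ω => φ n (Z i ω) ^ 2) P ∧
      ∫ ω, φ n (Z i ω) ∂P = m n ∧ ∫ ω, φ n (Z i ω) ^ 2 ∂P ≤ V / a n) :
    IsBigOP P (fun n ω => empMean n (fun i => Z i ω) (φ n) - m n)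
      (fun n => √(1 / (n * a n))) := by
  intro ε hε
  -- Chosen so that the Chebyshev bound becomes `ε V/(|V| + 1)`; the added one avoids division by
  -- zero.
  set M := √((|V| + 1) / ε) with hM
  have hM0 : 0 < M := Real.sqrt_pos.2 (by positivity)
  refine ⟨M, ?_⟩
  filter_upwards [h, eventually_gt_atTop 0] with n hn hn0
  have hn' : (0 : ℝ) < n := Nat.cast_pos.2 hn0
  have han := ha n
  refine (measure_lt_abs_empMean_sub_le hZm hZ (hφ n) (fun i => (hn i).1) (fun i => (hn i).2.1)
    (fun i => (hn i).2.2) hn0 (mul_pos hM0 (Real.sqrt_pos.2 (by positivity)))).trans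
    (ENNReal.ofReal_le_ofReal ?_)
  rw [mul_pow, hM, Real.sq_sqrt (by positivity), Real.sq_sqrt (by positivity)]
  have e : V / a n / (n * ((|V| + 1) / ε * (1 / (n * a n)))) = V / (|V| + 1) * ε := by
    field_simp
  rw [e]
  have : V / (|V| + 1) ≤ 1 := by
    rw [div_le_one (by positivity)]
    linarith [le_abs_self V]
  nlinarith

end EmpiricalMeans

/-! ### Expectations under the density. -/

section Law

variable {g₁ g₂ : Geometry} {D₁ D₂ : ℕ} {f : Amb g₁ D₁ × Amb g₂ D₂ → ℝ}

/-- Expectations of functions of a random point with density `f`. -/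
theorem DensityCond.integral_comp (hf : DensityCond f) {Ω : Type*} [MeasurableSpace Ω]
    {P : Measure Ω} {Z : Ω → Amb g₁ D₁ × Amb g₂ D₂} (hZ : Measurable Z)
    (hlaw : P.map Z =
      (prodMeasure g₁ g₂ D₁ D₂).withDensity (fun z => ENNReal.ofReal (f z)))
    {φ : Amb g₁ D₁ × Amb g₂ D₂ → ℝ} (hφ : Measurable φ) :
    (Integrable (fun u => φ u * radialExt f u) (prodMeasure g₁ g₂ D₁ D₂) →
      Integrable (fun ω => φ (Z ω)) P) ∧
    ∫ ω, φ (Z ω) ∂P = ∫ u, φ u * radialExt f u ∂(prodMeasure g₁ g₂ D₁ D₂) := by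
  -- Off the product space `f` is arbitrary and possibly non-measurable. `F` is a measurable
  -- substitute agreeing with it almost everywhere.
  set F := (puncturedProd g₁ g₂ D₁ D₂).indicator (radialExt f) with hF
  have hFm : Measurable F := by
    have hc : ContinuousOn (radialExt f) (puncturedProd g₁ g₂ D₁ D₂) :=
      hf.contDiffOn.continuousOn
    classical
    rw [hF, ← Set.piecewise_eq_indicator]
    exact hc.measurable_piecewise continuousOn_const
      isOpen_puncturedProd.measurableSet
  have hFf : ∀ᵐ u ∂(prodMeasure g₁ g₂ D₁ D₂), F u = radialExt f u ∧ f u = F u ∧ 0 ≤ F u := by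
    filter_upwards [ae_mem_prodSpace] with u hu
    have h1 : F u = radialExt f u := indicator_of_mem (prodSpace_subset_puncturedProd hu) _
    have h2 : radialExt f u = f u := radialExt_of_mem hu
    exact ⟨h1, by rw [h1, h2], by rw [h1, h2]; exact hf.nonneg u hu⟩
  have hlaw' : P.map Z =
      (prodMeasure g₁ g₂ D₁ D₂).withDensity (fun z => ENNReal.ofReal (F z)) := by
    rw [hlaw]
    exact withDensity_congr_ae (hFf.mono fun u hu => by simp only [hu.2.1])
  have hcongr : ∀ᵐ u ∂(prodMeasure g₁ g₂ D₁ D₂),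
      (ENNReal.ofReal (F u)).toReal • φ u = φ u * radialExt f u := by
    filter_upwards [hFf] with u hu
    rw [ENNReal.toReal_ofReal hu.2.2, hu.1, smul_eq_mul, mul_comm]
  refine ⟨fun hi => ?_, ?_⟩
  · have h1 : Integrable φ (P.map Z) := by
      rw [hlaw', integrable_withDensity_iff_integrable_smul' (by fun_prop) (by simp)]
      exact hi.congr (hcongr.mono fun u hu => hu.symm)
    exact h1.comp_measurable hZ
  · rw [← integral_map hZ.aemeasurable hφ.aestronglyMeasurable, hlaw',
      integral_withDensity_eq_integral_toReal_smul (by fun_prop) (by simp)]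
    exact integral_congr_ae hcongr

end Law

/-! ### Matrices that are scalar on each block. -/

section Blocks

variable {g₁ g₂ : Geometry} {D₁ D₂ : ℕ}

theorem twoBlock_mulVec (a b : ℝ) (v : Idx g₁ g₂ D₁ D₂ → ℝ) :
    twoBlock g₁ g₂ D₁ D₂ a b *ᵥ v =
      Sum.elim (fun i => a * v (Sum.inl i)) (fun i => b * v (Sum.inr i)) := by
  rw [twoBlock, fromBlocks_mulVec]
  ext (i | i) <;> simp [smul_mulVec]

theorem twoBlock_mul (a b c d : ℝ) :
    twoBlock g₁ g₂ D₁ D₂ a b * twoBlock g₁ g₂ D₁ D₂ c d =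
      twoBlock g₁ g₂ D₁ D₂ (a * c) (b * d) := by
  simp [twoBlock, fromBlocks_multiply, smul_smul, mul_comm]

/-- An empty block would have determinant one whatever its scalar, hence the lower bounds on the
dimensions. -/
theorem isUnit_det_twoBlock (hD₁ : 1 ≤ D₁) (hD₂ : 1 ≤ D₂) {a b : ℝ} :
    IsUnit (twoBlock g₁ g₂ D₁ D₂ a b).det ↔ a ≠ 0 ∧ b ≠ 0 := by
  have h : ∀ {g : Geometry} {D : ℕ}, 1 ≤ D → ambDim g D ≠ 0 := by
    rintro (_ | _) D hD <;> simp only [ambDim] <;> omega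
  rw [twoBlock, det_fromBlocks_zero₂₁, det_smul, det_smul, isUnit_iff_ne_zero]
  simp [h hD₁, h hD₂]

theorem inv_twoBlock {a b : ℝ} (ha : a ≠ 0) (hb : b ≠ 0) :
    (twoBlock g₁ g₂ D₁ D₂ a b)⁻¹ = twoBlock g₁ g₂ D₁ D₂ a⁻¹ b⁻¹ := by
  refine inv_eq_right_inv ?_
  rw [twoBlock_mul, mul_inv_cancel₀ ha, mul_inv_cancel₀ hb, twoBlock, one_smul, one_smul,
    fromBlocks_one]

theorem projMatrix_mul_twoBlock (z : Amb g₁ D₁ × Amb g₂ D₂) (a b : ℝ) :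
    projMatrix z * twoBlock g₁ g₂ D₁ D₂ a b = twoBlock g₁ g₂ D₁ D₂ a b * projMatrix z := by
  simp [twoBlock, projMatrix, fromBlocks_multiply]

end Blocks

/-! ### Riemannian gradients as tangential derivatives. -/

section RiemannianGradient

variable {g : Geometry} {D : ℕ}

/-- The projection of a coordinate vector onto the tangent space of a factor at `x`. -/
noncomputable def tangentVec : (g : Geometry) → (D : ℕ) → Amb g D → Fin (ambDim g D) → Amb g D
  | .linear, _, _, i => EuclideanSpace.single i 1
  | .directional, _, x, i => EuclideanSpace.single i 1 - x i • x

theorem isTangentVec_tangentVec {x : Amb g D} (hx : x ∈ space g D) (i : Fin (ambDim g D)) :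
    IsTangentVec g D x (tangentVec g D x i) := by
  cases g
  · trivial
  · have h1 : ‖x‖ = 1 := mem_sphere_zero_iff_norm.1 hx
    show inner ℝ x (EuclideanSpace.single i 1 - x i • x) = 0
    rw [inner_sub_right, inner_smul_right, real_inner_self_eq_norm_sq, h1,
      EuclideanSpace.inner_single_right]
    simp

/-- The projection is symmetric, so it can be moved onto the coordinate vector. Coordinates of the
Riemannian gradient become directional derivatives along tangent vectors, the form to which Killing
fields apply. -/
theorem tangentProj_mulVec (x w : Amb g D) (i : Fin (ambDim g D)) :
    (tangentProj g D x *ᵥ fun j => w j) i = inner ℝ (tangentVec g D x i) w := by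
  cases g
  · simp only [tangentProj, tangentVec, one_mulVec]
    rw [EuclideanSpace.inner_single_left]
    simp
  · have h : inner ℝ x w = ∑ j, x j * w j := by
      simp [PiLp.inner_apply, mul_comm]
    simp only [tangentProj, tangentVec, sub_mulVec, one_mulVec]
    rw [inner_sub_left, inner_smul_left, EuclideanSpace.inner_single_left, h]
    simp only [Pi.sub_apply, mulVec, dotProduct, vecMulVec_apply, Finset.mul_sum, map_one, one_mul,
      conj_trivial, mul_assoc]

theorem inner_gradient {E : Type*} [NormedAddCommGroup E] [InnerProductSpace ℝ E]
    [CompleteSpace E] {F : E → ℝ} {L : E →L[ℝ] ℝ} {x : E} (hF : HasFDerivAt F L x) (v : E) :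
    inner ℝ v (gradient F x) = L v := by
  rw [gradient, hF.fderiv, real_inner_comm, InnerProductSpace.toDual_symm_apply]

variable {g₁ g₂ : Geometry} {D₁ D₂ : ℕ} {F : Amb g₁ D₁ × Amb g₂ D₂ → ℝ}
  {z : Amb g₁ D₁ × Amb g₂ D₂}

theorem totalGrad_inl {L : Amb g₁ D₁ →L[ℝ] ℝ} (hF : HasFDerivAt (fun x => F (x, z.2)) L z.1)
    (i : Fin (ambDim g₁ D₁)) :
    totalGrad F z (Sum.inl i) = L (EuclideanSpace.single i 1) := by
  rw [← inner_gradient hF, EuclideanSpace.inner_single_left]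
  simp [totalGrad]

theorem totalGrad_inr {L : Amb g₂ D₂ →L[ℝ] ℝ} (hF : HasFDerivAt (fun y => F (z.1, y)) L z.2)
    (i : Fin (ambDim g₂ D₂)) :
    totalGrad F z (Sum.inr i) = L (EuclideanSpace.single i 1) := by
  rw [← inner_gradient hF, EuclideanSpace.inner_single_left]
  simp [totalGrad]

theorem riemGrad_inl {L : Amb g₁ D₁ →L[ℝ] ℝ} (hF : HasFDerivAt (fun x => F (x, z.2)) L z.1)
    (i : Fin (ambDim g₁ D₁)) :
    riemGrad F z (Sum.inl i) = L (tangentVec g₁ D₁ z.1 i) := by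
  rw [← inner_gradient hF, ← tangentProj_mulVec, riemGrad, projMatrix, fromBlocks_mulVec]
  simp only [Sum.elim_inl, zero_mulVec, add_zero]
  rfl

theorem riemGrad_inr {L : Amb g₂ D₂ →L[ℝ] ℝ} (hF : HasFDerivAt (fun y => F (z.1, y)) L z.2)
    (i : Fin (ambDim g₂ D₂)) :
    riemGrad F z (Sum.inr i) = L (tangentVec g₂ D₂ z.2 i) := by
  rw [← inner_gradient hF, ← tangentProj_mulVec, riemGrad, projMatrix, fromBlocks_mulVec]
  simp only [Sum.elim_inr, zero_mulVec, zero_add]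
  rfl

end RiemannianGradient

/-! ### The estimator, its gradient and the mean shift identity. -/

section Estimator

variable {g : Geometry} {D : ℕ} {p : ℝ → ℝ}

theorem factorKernel_comm (h : ℝ) (x y : Amb g D) :
    factorKernel g D p h x y = factorKernel g D p h y x := by
  rw [factorKernel, norm_sub_rev, factorKernel]

theorem factorKernelDeriv_comm (h : ℝ) (x y : Amb g D) :
    factorKernelDeriv g D p h x y = factorKernelDeriv g D p h y x := by
  rw [factorKernelDeriv, norm_sub_rev, factorKernelDeriv]

theorem kernelFn_inv_smul_sub (h : ℝ) (x y : Amb g D) :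
    kernelFn g D p h (h⁻¹ • (x - y)) = factorKernel g D p h x y := by
  rw [kernelFn, sqProfile, norm_inv_smul_sq_div_two, factorKernel,
    clampProfile_of_nonneg (by positivity)]

theorem KernelCond.sqProfileDeriv_eq (hp : KernelCond g D p) {s : ℝ} (hs : 0 ≤ s) :
    sqProfileDeriv p s = derivWithin p (Ici 0) (s / 2) / 2 := by
  have h1 := (hp.hasDerivWithinAt (r := s / 2) (by positivity)).comp s
    (h := fun s => s / 2) (((hasDerivAt_id s).div_const 2).hasDerivWithinAt (s := Ici 0))
    (fun t (ht : 0 ≤ t) => by simp only [mem_Ici]; positivity)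
  have h2 := h1.derivWithin (uniqueDiffOn_Ici 0 s hs)
  rw [sqProfileDeriv, div_eq_mul_inv (derivWithin p (Ici 0) (s / 2)), ← one_div]
  exact h2

/-- The factor two in `G_x` and `G_y` undoes the halved argument in `k_j(s) = p_j(s/2)`. -/
theorem KernelCond.factorKernelDeriv_eq (hp : KernelCond g D p) (h : ℝ) (x y : Amb g D) :
    factorKernelDeriv g D p h x y =
      -(2 * normConst g D p h) * sqProfileDeriv p (‖h⁻¹ • (x - y)‖ ^ 2) := by
  rw [hp.sqProfileDeriv_eq (by positivity), norm_inv_smul_sq_div_two, factorKernelDeriv,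
    clampProfile_of_nonneg (by positivity)]
  ring

variable {g₁ g₂ : Geometry} {D₁ D₂ : ℕ} {p₁ p₂ : ℝ → ℝ} {h₁ h₂ : ℝ} {n : ℕ}
  {Z : ℕ → Amb g₁ D₁ × Amb g₂ D₂} {z : Amb g₁ D₁ × Amb g₂ D₂}

theorem kde_eq_empMean : kde p₁ p₂ h₁ h₂ n Z z = empMean n Z fun u =>
    factorKernel g₁ D₁ p₁ h₁ z.1 u.1 * factorKernel g₂ D₂ p₂ h₂ z.2 u.2 := by
  simp only [kde, empMean, kernelFn_inv_smul_sub]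

theorem Gx_eq_sum_weightX : Gx p₁ p₂ h₁ h₂ n Z z =
    -(2 * normConst g₁ D₁ p₁ h₁ / (n * h₁ ^ 2)) *
      ∑ i ∈ Finset.range n, weightX p₁ p₂ h₁ h₂ z (Z i) := by
  simp only [Gx, weightX, kernelFn, Finset.mul_sum]
  refine Finset.sum_congr rfl fun i _ => ?_
  ring

theorem Gy_eq_sum_weightY : Gy p₁ p₂ h₁ h₂ n Z z =
    -(2 * normConst g₂ D₂ p₂ h₂ / (n * h₂ ^ 2)) *
      ∑ i ∈ Finset.range n, weightY p₁ p₂ h₁ h₂ z (Z i) := by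
  simp only [Gy, weightY, kernelFn, Finset.mul_sum]
  refine Finset.sum_congr rfl fun i _ => ?_
  ring

theorem KernelCond.weightX_eq (hp₁ : KernelCond g₁ D₁ p₁) (u : Amb g₁ D₁ × Amb g₂ D₂) :
    -(2 * normConst g₁ D₁ p₁ h₁) * weightX p₁ p₂ h₁ h₂ z u =
      factorKernelDeriv g₁ D₁ p₁ h₁ z.1 u.1 * factorKernel g₂ D₂ p₂ h₂ z.2 u.2 := by
  rw [weightX, kernelFn_inv_smul_sub, hp₁.factorKernelDeriv_eq]
  ring

theorem KernelCond.weightY_eq (hp₂ : KernelCond g₂ D₂ p₂) (u : Amb g₁ D₁ × Amb g₂ D₂) :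
    -(2 * normConst g₂ D₂ p₂ h₂) * weightY p₁ p₂ h₁ h₂ z u =
      factorKernel g₁ D₁ p₁ h₁ z.1 u.1 * factorKernelDeriv g₂ D₂ p₂ h₂ z.2 u.2 := by
  rw [weightY, kernelFn_inv_smul_sub, hp₂.factorKernelDeriv_eq]
  ring

/-- Isolates the factor `h₁⁻²`, which the bandwidth matrix removes; the empirical mean left over is
the quantity with a finite limit. -/
theorem Gx_eq_empMean (hp₁ : KernelCond g₁ D₁ p₁) : Gx p₁ p₂ h₁ h₂ n Z z =
    (h₁ ^ 2)⁻¹ * empMean n Z fun u =>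
      factorKernelDeriv g₁ D₁ p₁ h₁ z.1 u.1 * factorKernel g₂ D₂ p₂ h₂ z.2 u.2 := by
  simp only [Gx_eq_sum_weightX, ← hp₁.weightX_eq (z := z), empMean, ← Finset.mul_sum]
  rw [div_eq_mul_inv, mul_inv, one_div]
  ring

theorem Gy_eq_empMean (hp₂ : KernelCond g₂ D₂ p₂) : Gy p₁ p₂ h₁ h₂ n Z z =
    (h₂ ^ 2)⁻¹ * empMean n Z fun u =>
      factorKernel g₁ D₁ p₁ h₁ z.1 u.1 * factorKernelDeriv g₂ D₂ p₂ h₂ z.2 u.2 := by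
  simp only [Gy_eq_sum_weightY, ← hp₂.weightY_eq (z := z), empMean, ← Finset.mul_sum]
  rw [div_eq_mul_inv, mul_inv, one_div]
  ring

theorem KernelCond.hasFDerivAt_factorKernel_left (hp : KernelCond g D p) (h : ℝ)
    (x y : Amb g D) : HasFDerivAt (fun x => factorKernel g D p h x y)
      ((factorKernelDeriv g D p h x y / h ^ 2) • innerSL ℝ (y - x)) x := by
  have h1 := hp.hasFDerivAt_factorKernel h y x
  have e : (fun x => factorKernel g D p h x y) = factorKernel g D p h y :=
    funext fun x => factorKernel_comm h x y
  rw [e]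
  refine h1.congr_fderiv ?_
  rw [factorKernelDeriv_comm, ← neg_sub y x, map_neg, smul_neg, neg_smul, neg_neg]

theorem hasFDerivAt_empMean {E S : Type*} [NormedAddCommGroup E] [NormedSpace ℝ E]
    [MeasurableSpace S] {Y : ℕ → S} {φ : E → S → ℝ} {φ' : S → E →L[ℝ] ℝ} {x : E}
    (hφ : ∀ u, HasFDerivAt (fun x => φ x u) (φ' u) x) :
    ∃ L : E →L[ℝ] ℝ, HasFDerivAt (fun x => empMean n Y (φ x)) L x ∧
      ∀ v, L v = empMean n Y fun u => φ' u v := by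
  refine ⟨(1 / (n : ℝ)) • ∑ i ∈ Finset.range n, φ' (Y i),
    (HasFDerivAt.fun_sum fun i _ => hφ (Y i)).const_mul _, fun v => ?_⟩
  simp [empMean]

theorem exists_hasFDerivAt_kde_fst (hp₁ : KernelCond g₁ D₁ p₁) :
    ∃ L : Amb g₁ D₁ →L[ℝ] ℝ, HasFDerivAt (fun x => kde p₁ p₂ h₁ h₂ n Z (x, z.2)) L z.1 ∧
      ∀ v, L v = empMean n Z fun u => factorKernelDeriv g₁ D₁ p₁ h₁ z.1 u.1 *
        (inner ℝ v (u.1 - z.1) / h₁ ^ 2) * factorKernel g₂ D₂ p₂ h₂ z.2 u.2 := by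
  obtain ⟨L, hL, hLv⟩ := hasFDerivAt_empMean (n := n) (Y := Z) (x := z.1)
    (φ := fun x u => factorKernel g₁ D₁ p₁ h₁ x u.1 * factorKernel g₂ D₂ p₂ h₂ z.2 u.2)
    fun u => (hp₁.hasFDerivAt_factorKernel_left h₁ z.1 u.1).mul_const _
  refine ⟨L, by simpa only [kde_eq_empMean] using hL, fun v => (hLv v).trans ?_⟩
  congr 1
  ext u
  simp only [_root_.smul_apply, innerSL_apply_apply, smul_eq_mul]
  rw [real_inner_comm]
  ring

theorem exists_hasFDerivAt_kde_snd (hp₂ : KernelCond g₂ D₂ p₂) :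
    ∃ L : Amb g₂ D₂ →L[ℝ] ℝ, HasFDerivAt (fun y => kde p₁ p₂ h₁ h₂ n Z (z.1, y)) L z.2 ∧
      ∀ v, L v = empMean n Z fun u => factorKernel g₁ D₁ p₁ h₁ z.1 u.1 *
        (factorKernelDeriv g₂ D₂ p₂ h₂ z.2 u.2 * (inner ℝ v (u.2 - z.2) / h₂ ^ 2)) := by
  obtain ⟨L, hL, hLv⟩ := hasFDerivAt_empMean (n := n) (Y := Z) (x := z.2)
    (φ := fun y u => factorKernel g₁ D₁ p₁ h₁ z.1 u.1 * factorKernel g₂ D₂ p₂ h₂ y u.2)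
    fun u => (hp₂.hasFDerivAt_factorKernel_left h₂ z.2 u.2).const_mul _
  refine ⟨L, by simpa only [kde_eq_empMean] using hL, fun v => (hLv v).trans ?_⟩
  congr 1
  ext u
  simp only [_root_.smul_apply, innerSL_apply_apply, smul_eq_mul]
  rw [real_inner_comm]
  ring

theorem riemGrad_kde_inl (hp₁ : KernelCond g₁ D₁ p₁) (i : Fin (ambDim g₁ D₁)) :
    riemGrad (kde p₁ p₂ h₁ h₂ n Z) z (Sum.inl i) = empMean n Z fun u =>
      factorKernelDeriv g₁ D₁ p₁ h₁ z.1 u.1 *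
        (inner ℝ (tangentVec g₁ D₁ z.1 i) (u.1 - z.1) / h₁ ^ 2) *
        factorKernel g₂ D₂ p₂ h₂ z.2 u.2 := by
  obtain ⟨L, hL, hLv⟩ := exists_hasFDerivAt_kde_fst (p₂ := p₂) (h₁ := h₁) (h₂ := h₂) (n := n)
    (Z := Z) (z := z) hp₁
  exact (riemGrad_inl hL i).trans (hLv _)

theorem riemGrad_kde_inr (hp₂ : KernelCond g₂ D₂ p₂) (i : Fin (ambDim g₂ D₂)) :
    riemGrad (kde p₁ p₂ h₁ h₂ n Z) z (Sum.inr i) = empMean n Z fun u =>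
      factorKernel g₁ D₁ p₁ h₁ z.1 u.1 * (factorKernelDeriv g₂ D₂ p₂ h₂ z.2 u.2 *
        (inner ℝ (tangentVec g₂ D₂ z.2 i) (u.2 - z.2) / h₂ ^ 2)) := by
  obtain ⟨L, hL, hLv⟩ := exists_hasFDerivAt_kde_snd (p₁ := p₁) (h₁ := h₁) (h₂ := h₂) (n := n)
    (Z := Z) (z := z) hp₂
  exact (riemGrad_inr hL i).trans (hLv _)

/-- A common constant `c` does not affect a weighted mean. It is inserted so that `c * ∑ w` can be
`G_x` or `G_y`, and the other factor the matching gradient coordinate. -/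
theorem weighted_mean_sub {ι : Type*} {s : Finset ι} {w X : ι → ℝ} {c x : ℝ}
    (hc : c * ∑ i ∈ s, w i ≠ 0) :
    (∑ i ∈ s, X i * w i) / ∑ i ∈ s, w i - x =
      (c * ∑ i ∈ s, w i)⁻¹ * (c * ∑ i ∈ s, (X i - x) * w i) := by
  have h1 := left_ne_zero_of_mul hc
  have h2 := right_ne_zero_of_mul hc
  simp only [sub_mul, Finset.sum_sub_distrib, ← Finset.mul_sum]
  field_simp

/-- The mean shift vector is the rescaled gradient of the estimator. -/
theorem meanShift_eq (hD₁ : 1 ≤ D₁) (hD₂ : 1 ≤ D₂) (hp₁ : KernelCond g₁ D₁ p₁)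
    (hp₂ : KernelCond g₂ D₂ p₂) (hu : IsUnit (Dtilde p₁ p₂ h₁ h₂ n Z z).det) :
    meanShift p₁ p₂ h₁ h₂ n Z z =
      (Dtilde p₁ p₂ h₁ h₂ n Z z)⁻¹ *ᵥ totalGrad (kde p₁ p₂ h₁ h₂ n Z) z := by
  obtain ⟨hx, hy⟩ := (isUnit_det_twoBlock hD₁ hD₂).1 hu
  rw [Dtilde, inv_twoBlock hx hy, twoBlock_mulVec]
  obtain ⟨L₁, hL₁, hL₁v⟩ := exists_hasFDerivAt_kde_fst (p₂ := p₂) (h₁ := h₁) (h₂ := h₂) (n := n)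
    (Z := Z) (z := z) hp₁
  obtain ⟨L₂, hL₂, hL₂v⟩ := exists_hasFDerivAt_kde_snd (p₁ := p₁) (h₁ := h₁) (h₂ := h₂) (n := n)
    (Z := Z) (z := z) hp₂
  ext (j | j)
  · rw [Gx_eq_sum_weightX] at hx
    simp only [meanShift, Sum.elim_inl]
    rw [totalGrad_inl hL₁, hL₁v, weighted_mean_sub hx, Gx_eq_sum_weightX]
    congr 1
    simp only [empMean, Finset.mul_sum]
    refine Finset.sum_congr rfl fun i _ => ?_
    rw [mul_right_comm, ← hp₁.weightX_eq (z := z), EuclideanSpace.inner_single_left]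
    simp only [map_one, one_mul, PiLp.sub_apply]
    ring
  · rw [Gy_eq_sum_weightY] at hy
    simp only [meanShift, Sum.elim_inr]
    rw [totalGrad_inr hL₂, hL₂v, weighted_mean_sub hy, Gy_eq_sum_weightY]
    congr 1
    simp only [empMean, Finset.mul_sum]
    refine Finset.sum_congr rfl fun i _ => ?_
    rw [← mul_assoc (factorKernel _ _ _ _ _ _), ← hp₂.weightY_eq (z := z),
      EuclideanSpace.inner_single_left]
    simp only [map_one, one_mul, PiLp.sub_apply]
    ring

/-- The tangential projection commutes with the two rescalings. -/
theorem projMatrix_mul_inv_mulVec {a b c d : ℝ} (hD₁ : 1 ≤ D₁) (hD₂ : 1 ≤ D₂) (ha : a ≠ 0)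
    (hb : b ≠ 0) (v : Idx g₁ g₂ D₁ D₂ → ℝ) :
    (projMatrix z * (twoBlock g₁ g₂ D₁ D₂ a b)⁻¹ * (twoBlock g₁ g₂ D₁ D₂ c d)⁻¹) *ᵥ v =
      ((twoBlock g₁ g₂ D₁ D₂ c d)⁻¹ * (twoBlock g₁ g₂ D₁ D₂ a b)⁻¹) *ᵥ (projMatrix z *ᵥ v) := by
  by_cases hu : IsUnit (twoBlock g₁ g₂ D₁ D₂ c d).det
  · obtain ⟨hc, hd⟩ := (isUnit_det_twoBlock hD₁ hD₂).1 hu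
    rw [inv_twoBlock ha hb, inv_twoBlock hc hd, mul_assoc, twoBlock_mul, twoBlock_mul,
      projMatrix_mul_twoBlock, mulVec_mulVec, mul_comm a⁻¹, mul_comm b⁻¹]
  -- The inverse of a singular matrix is zero by convention, so both sides vanish.
  · rw [nonsing_inv_apply_not_isUnit _ hu]
    simp

end Estimator

/-! ### Bias and stochastic error of ratios. -/

section Ratios

/-- Division is Lipschitz where denominators are at least `c` and one numerator is at most `G`. It
serves both the deterministic and the random error. -/
theorem abs_inv_mul_sub_inv_mul_le {a a' g g' c G s : ℝ} (hc : 0 < c) (ha : c ≤ a) (ha' : c ≤ a')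
    (hg : |g'| ≤ G) (has : |a - a'| ≤ s) (hgs : |g - g'| ≤ s) :
    |a⁻¹ * g - a'⁻¹ * g'| ≤ (1 / c + G / c ^ 2) * s := by
  have ha0 : 0 < a := hc.trans_le ha
  have ha0' : 0 < a' := hc.trans_le ha'
  have hs : 0 ≤ s := (abs_nonneg _).trans has
  have hG : 0 ≤ G := (abs_nonneg _).trans hg
  have e : a⁻¹ * g - a'⁻¹ * g' = (g - g') / a - g' * (a - a') / (a * a') := by
    field_simp
    ring
  rw [e]
  calc _ ≤ |(g - g') / a| + |g' * (a - a') / (a * a')| := abs_sub _ _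
    _ = |g - g'| / a + |g'| * |a - a'| / (a * a') := by
        rw [abs_div, abs_div, abs_mul, abs_of_pos ha0, abs_of_pos (mul_pos ha0 ha0')]
    _ ≤ s / c + G * s / (c * c) := by gcongr
    _ = _ := by
        field_simp

variable {Ω : Type*} [MeasurableSpace Ω] {P : Measure Ω}

/-- Only subadditivity enters, so the events need not be measurable. -/
theorem tendsto_measure_of_compl [IsProbabilityMeasure P] {S : ℕ → Set Ω}
    (h : Tendsto (fun n => P (S n)ᶜ) atTop (𝓝 0)) : Tendsto (fun n => P (S n)) atTop (𝓝 1) := by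
  have h1 : Tendsto (fun n => 1 - P (S n)ᶜ) atTop (𝓝 1) := by
    simpa using ENNReal.Tendsto.sub (tendsto_const_nhds (x := (1 : ENNReal))) h
      (Or.inl ENNReal.one_ne_top)
  refine tendsto_of_tendsto_of_tendsto_of_le_of_le h1 tendsto_const_nhds (fun n => ?_)
    fun n => prob_le_one
  rw [tsub_le_iff_right, ← measure_univ (μ := P), ← union_compl_self (S n)]
  exact measure_union_le _ _

variable {κ ι : Type*} [Fintype κ] [Fintype ι] {A : κ → ℕ → Ω → ℝ} {mA : κ → ℕ → ℝ} {α : κ → ℝ}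
  {r η : ℕ → ℝ} {c : ℝ}

theorem exists_uniform_bound {F : κ → ℕ → ℝ} (hF : ∀ k, F k =O[atTop] η) :
    ∃ C, ∀ᶠ n in atTop, ∀ k, |F k n| ≤ C * |η n| := by
  obtain ⟨C, hC⟩ := (isBigO_pi (f := fun n k => F k n).2 hF).bound
  exact ⟨C, hC.mono fun n hn k => (norm_le_pi_norm (fun k => F k n) k).trans hn⟩

/-- For large `n` the centring terms exceed `c/2`, so a vanishing `A k n` forces a deviation larger
than `c/2`. A union bound over the finite index type concludes. -/
theorem tendsto_measure_ne_zero [IsProbabilityMeasure P] (hr : Tendsto r atTop (𝓝 0))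
    (hη : Tendsto η atTop (𝓝 0)) (hc : 0 < c) (hα : ∀ k, c ≤ α k)
    (hA : ∀ k, IsBigOP P (fun n ω => A k n ω - mA k n) r)
    (hmA : ∀ k, (fun n => mA k n - α k) =O[atTop] η) :
    Tendsto (fun n => P {ω | ∀ k, A k n ω ≠ 0}) atTop (𝓝 1) := by
  refine tendsto_measure_of_compl ?_
  have h1 : Tendsto (fun n => ∑ k, P {ω | c / 2 < ‖A k n ω - mA k n‖}) atTop (𝓝 0) := by
    simpa using tendsto_finsetSum Finset.univ fun k _ =>
      (hA k).tendsto_measure hr (half_pos hc)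
  obtain ⟨C, hC⟩ := exists_uniform_bound hmA
  have h2 : Tendsto (fun n => C * |η n|) atTop (𝓝 0) := by simpa using hη.abs.const_mul C
  refine tendsto_of_tendsto_of_tendsto_of_le_of_le' tendsto_const_nhds h1
    (Eventually.of_forall fun n => zero_le) ?_
  filter_upwards [hC, h2.eventually (gt_mem_nhds (half_pos hc))] with n hn hn'
  refine (measure_mono fun ω hω => ?_).trans (measure_iUnion_fintype_le _ _)
  simp only [mem_compl_iff, mem_ofPred_eq, not_forall, not_not] at hω
  obtain ⟨k, hk⟩ := hω
  refine mem_iUnion.2 ⟨k, ?_⟩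
  simp only [mem_ofPred_eq, hk, zero_sub, Real.norm_eq_abs, abs_neg]
  have := (abs_lt.1 ((hn k).trans_lt hn')).1
  exact lt_of_lt_of_le (by linarith [hα k]) (le_abs_self _)

variable {G : ι → ℕ → Ω → ℝ} {mG : ι → ℕ → ℝ} {γ : ι → ℝ} {σ : ι → κ}

/-- Ratios of quantities with a bias of order `η` and a stochastic error of order `r` have a bias
of order `η` and a stochastic error of order `r`, if the denominators have positive limits. -/
theorem exists_bias_isBigOP_ratio (hr0 : ∀ n, 0 ≤ r n) (hr : Tendsto r atTop (𝓝 0))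
    (hη : Tendsto η atTop (𝓝 0)) (hc : 0 < c) (hα : ∀ k, c ≤ α k)
    (hA : ∀ k, IsBigOP P (fun n ω => A k n ω - mA k n) r)
    (hmA : ∀ k, (fun n => mA k n - α k) =O[atTop] η)
    (hG : ∀ i, IsBigOP P (fun n ω => G i n ω - mG i n) r)
    (hmG : ∀ i, (fun n => mG i n - γ i) =O[atTop] η)
    {X : ℕ → Ω → ι → ℝ}
    (hX : ∀ n ω, (∀ k, A k n ω ≠ 0) → X n ω = fun i => (A (σ i) n ω)⁻¹ * G i n ω)
    {x : ι → ℝ} (hx : x = fun i => (α (σ i))⁻¹ * γ i) :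
    ∃ b : ℕ → ι → ℝ, b =O[atTop] η ∧ IsBigOP P (fun n ω => X n ω - x - b n) r := by
  subst hx
  obtain ⟨C₁, hC₁⟩ := exists_uniform_bound hmA
  obtain ⟨C₂, hC₂⟩ := exists_uniform_bound hmG
  set C := max C₁ C₂
  have hCη : Tendsto (fun n => C * |η n|) atTop (𝓝 0) := by simpa using hη.abs.const_mul C
  set Γ : ℝ := ∑ i, |γ i| with hΓ
  have hΓi : ∀ i, |γ i| ≤ Γ := fun i =>
    Finset.single_le_sum (f := fun i => |γ i|) (fun j _ => abs_nonneg _) (Finset.mem_univ i)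
  have hΓ0 : 0 ≤ Γ := Finset.sum_nonneg fun i _ => abs_nonneg _
  have hA' : ∀ᶠ n in atTop, ∀ k, |mA k n - α k| ≤ C * |η n| :=
    hC₁.mono fun n hn k => (hn k).trans (by gcongr; exact le_max_left _ _)
  have hG' : ∀ᶠ n in atTop, ∀ i, |mG i n - γ i| ≤ C * |η n| :=
    hC₂.mono fun n hn i => (hn i).trans (by gcongr; exact le_max_right _ _)
  have hsmall : ∀ᶠ n in atTop, C * |η n| < min (c / 2) 1 :=
    hCη.eventually (gt_mem_nhds (lt_min (half_pos hc) one_pos))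
  have hlow : ∀ᶠ n in atTop, ∀ k, c / 2 ≤ mA k n := by
    filter_upwards [hA', hsmall] with n hn hs k
    linarith [(abs_le.1 (hn k)).1, hα k, min_le_left (c / 2) 1]
  -- The bias is the ratio of the centring terms minus the ratio of the limits, hence nonrandom.
  refine ⟨fun n i => (mA (σ i) n)⁻¹ * mG i n - (α (σ i))⁻¹ * γ i, ?_, ?_⟩
  · refine isBigO_pi.2 fun i => IsBigO.of_bound ((1 / (c / 2) + Γ / (c / 2) ^ 2) * C) ?_
    filter_upwards [hA', hG', hlow] with n h1 h2 h3
    rw [mul_assoc]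
    exact abs_inv_mul_sub_inv_mul_le (half_pos hc) (h3 _) ((half_le_self hc.le).trans (hα _))
      (hΓi i) (h1 _) (h2 i)
  · refine IsBigOP.of_finite_control (ι := κ ⊕ ι)
      (Y := Sum.elim (fun k n ω => A k n ω - mA k n) (fun i n ω => G i n ω - mG i n)) hr0 hr
      -- The centring denominators are eventually at least `c/2`, so deviations up to `c/4` leave at
      -- least `c/4`. The centring numerators are at most `Γ + 1`, their bias being eventually below
      -- one.
      (fun j => by cases j; exacts [hA _, hG _]) (δ := c / 4)
      (C := 1 / (c / 4) + (Γ + 1) / (c / 4) ^ 2) (by positivity) ?_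
    filter_upwards [hG', hlow, hsmall] with n h2 h3 h4 ω s hs hsc hY
    have hYA : ∀ k, |A k n ω - mA k n| ≤ s := fun k => hY (Sum.inl k)
    have hYG : ∀ i, |G i n ω - mG i n| ≤ s := fun i => hY (Sum.inr i)
    have hAl : ∀ k, c / 4 ≤ A k n ω := fun k => by
      linarith [(abs_le.1 (hYA k)).1, h3 k]
    rw [hX n ω fun k => (lt_of_lt_of_le (by positivity) (hAl k)).ne']
    refine (pi_norm_le_iff_of_nonneg (by positivity)).2 fun i => ?_
    have e : ((fun i => (A (σ i) n ω)⁻¹ * G i n ω) - (fun i => (α (σ i))⁻¹ * γ i) -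
        fun i => (mA (σ i) n)⁻¹ * mG i n - (α (σ i))⁻¹ * γ i) i =
        (A (σ i) n ω)⁻¹ * G i n ω - (mA (σ i) n)⁻¹ * mG i n := by
      simp only [Pi.sub_apply]
      ring
    rw [e, Real.norm_eq_abs]
    refine abs_inv_mul_sub_inv_mul_le (by positivity) (hAl _) (by linarith [h3 (σ i)]) ?_
      (hYA _) (hYG i)
    have h5 := h2 i
    have h6 : |mG i n| ≤ |mG i n - γ i| + |γ i| := by
      simpa using abs_add_le (mG i n - γ i) (γ i)
    linarith [hΓi i, min_le_right (c / 2) (1 : ℝ)]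

end Ratios

/-! ### Second moments of the weights. -/

section Moments

variable {E : Type*} [NormedAddCommGroup E] [InnerProductSpace ℝ E] [MeasurableSpace E]

/-- Integrability and a bound of order `h⁻ᵉ` on the second moment of a weight function. -/
structure MomentBound (μ : Measure E) (U : E → ℝ) (c h : ℝ) (e : ℕ) : Prop where
  int : Integrable U μ
  int_sq : Integrable (fun y => U y ^ 2) μ
  sq : ∫ y, U y ^ 2 ∂μ ≤ c / h ^ e

variable {μ : Measure E} {x : E} {D : ℕ} {W : E → ℝ} {w₀ C h : ℝ}

theorem ApproxKernel.momentBound (hW : ApproxKernel μ x D W w₀ C h) : MomentBound μ W C h D :=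
  ⟨hW.int, hW.int_sq, hW.sq⟩

/-- The squared weight gains `h⁻⁴` from the prefactor and `h²` from the squared distance. The net
loss of `h⁻²` is the `+ 2` in the final rate. -/
theorem ApproxKernel.momentBound_inner [BorelSpace E] [FiniteDimensional ℝ E]
    (hW : ApproxKernel μ x D W w₀ C h) (hh : 0 < h) (v : E) :
    MomentBound μ (fun y => W y * (inner ℝ v (y - x) / h ^ 2)) (‖v‖ ^ 2 * C) h (D + 2) := by
  have hc := hW.cont
  have hle : ∀ y, (W y * (inner ℝ v (y - x) / h ^ 2)) ^ 2 ≤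
      ‖v‖ ^ 2 / h ^ 4 * (W y ^ 2 * ‖y - x‖ ^ 2) := fun y => by
    have h1 : (inner ℝ v (y - x) : ℝ) ^ 2 ≤ (‖v‖ * ‖y - x‖) ^ 2 :=
      sq_le_sq' (by linarith [(abs_le.1 (abs_real_inner_le_norm v (y - x))).1])
        (real_inner_le_norm _ _)
    calc _ = W y ^ 2 / h ^ 4 * (inner ℝ v (y - x) : ℝ) ^ 2 := by ring
      _ ≤ W y ^ 2 / h ^ 4 * (‖v‖ * ‖y - x‖) ^ 2 := by gcongr
      _ = _ := by ring
  have hint : Integrable (fun y => (W y * (inner ℝ v (y - x) / h ^ 2)) ^ 2) μ :=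
    (hW.int_sq_second.const_mul (‖v‖ ^ 2 / h ^ 4)).mono'
      (Continuous.aestronglyMeasurable (by fun_prop)) (Eventually.of_forall fun y => by
        rw [Real.norm_of_nonneg (by positivity)]
        exact hle y)
  refine ⟨?_, hint, ?_⟩
  · have := (hW.integrable_first.const_inner v).div_const (h ^ 2)
    refine this.congr (Eventually.of_forall fun y => ?_)
    simp only [inner_smul_right]
    ring
  · calc _ ≤ ∫ y, ‖v‖ ^ 2 / h ^ 4 * (W y ^ 2 * ‖y - x‖ ^ 2) ∂μ :=
          integral_mono hint (hW.int_sq_second.const_mul _) hle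
      _ = ‖v‖ ^ 2 / h ^ 4 * ∫ y, W y ^ 2 * ‖y - x‖ ^ 2 ∂μ := integral_const_mul _ _
      _ ≤ ‖v‖ ^ 2 / h ^ 4 * (C * h ^ 2 / h ^ D) := by
          have := hW.sq_second
          gcongr
      _ = ‖v‖ ^ 2 * C / h ^ (D + 2) := by
          field_simp
          ring

end Moments

/-! ### Comparison of bandwidths. -/

section Bandwidths

theorem tendsto_bandwidth {h h' : ℕ → ℝ} (h0' : ∀ n, 0 < h' n) (hh : h' =Θ[atTop] h)
    (hlim : Tendsto h atTop (𝓝 0)) : Tendsto h' atTop (𝓝[>] 0) :=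
  tendsto_nhdsWithin_iff.2 ⟨hh.1.trans_tendsto hlim, Eventually.of_forall h0'⟩

theorem exists_le_mul_bandwidth {h h' : ℕ → ℝ} (h0 : ∀ n, 0 < h n) (h0' : ∀ n, 0 < h' n)
    (hh : h =O[atTop] h') : ∃ A, 0 < A ∧ ∀ᶠ n in atTop, h n ≤ A * h' n := by
  obtain ⟨A, hA, hb⟩ := hh.exists_pos
  refine ⟨A, hA, hb.bound.mono fun n hn => ?_⟩
  rwa [Real.norm_of_nonneg (h0 n).le, Real.norm_of_nonneg (h0' n).le] at hn

theorem div_pow_le_of_le_mul {a b c A : ℝ} (ha : 0 < a) (hb : 0 < b) (hab : a ≤ A * b) (e : ℕ) :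
    c / b ^ e ≤ |c| * A ^ e / a ^ e := by
  rw [div_le_div_iff₀ (by positivity) (by positivity)]
  calc c * a ^ e ≤ |c| * (A * b) ^ e := by
        gcongr
        exact le_abs_self c
    _ = _ := by ring

end Bandwidths

/-! ### Stochastic error of product weights. -/

section Fluctuations

variable {g₁ g₂ : Geometry} {D₁ D₂ : ℕ} {f : Amb g₁ D₁ × Amb g₂ D₂ → ℝ}

/-- Second moments of product weights at a random point with density `f`. -/
theorem DensityCond.exists_second_moment_le (hf : DensityCond f) :
    ∃ B, 0 ≤ B ∧ ∀ (U₁ : Amb g₁ D₁ → ℝ) (U₂ : Amb g₂ D₂ → ℝ) (c₁ c₂ h₁ h₂ : ℝ) (e₁ e₂ : ℕ),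
      MomentBound (refMeasure g₁ D₁) U₁ c₁ h₁ e₁ → MomentBound (refMeasure g₂ D₂) U₂ c₂ h₂ e₂ →
      Integrable (fun u => U₁ u.1 * U₂ u.2 * radialExt f u) (prodMeasure g₁ g₂ D₁ D₂) ∧
      Integrable (fun u => (U₁ u.1 * U₂ u.2) ^ 2 * radialExt f u) (prodMeasure g₁ g₂ D₁ D₂) ∧
      ∫ u, (U₁ u.1 * U₂ u.2) ^ 2 * radialExt f u ∂(prodMeasure g₁ g₂ D₁ D₂) ≤
        c₁ / h₁ ^ e₁ * (c₂ / h₂ ^ e₂) * B := by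
  obtain ⟨B, hB⟩ := hf.exists_bound_radialExt
  refine ⟨|B|, abs_nonneg B, fun U₁ U₂ c₁ c₂ h₁ h₂ e₁ e₂ m₁ m₂ => ?_⟩
  have hi : Integrable (fun u => (U₁ u.1 * U₂ u.2) ^ 2) (prodMeasure g₁ g₂ D₁ D₂) := by
    simp only [mul_pow]
    exact m₁.int_sq.mul_prod m₂.int_sq
  refine ⟨hf.integrable_mul_radialExt (m₁.int.mul_prod m₂.int), hf.integrable_mul_radialExt hi, ?_⟩
  calc _ ≤ ∫ u, (U₁ u.1 * U₂ u.2) ^ 2 * |B| ∂(prodMeasure g₁ g₂ D₁ D₂) := by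
        refine integral_mono_ae (hf.integrable_mul_radialExt hi) (hi.mul_const _) ?_
        filter_upwards [hB] with u hu
        have := (le_abs_self _).trans (hu.trans (le_abs_self B))
        show (U₁ u.1 * U₂ u.2) ^ 2 * radialExt f u ≤ (U₁ u.1 * U₂ u.2) ^ 2 * |B|
        gcongr
    _ = (∫ x, U₁ x ^ 2 ∂(refMeasure g₁ D₁)) * (∫ y, U₂ y ^ 2 ∂(refMeasure g₂ D₂)) * |B| := by
        rw [integral_mul_const]
        simp only [mul_pow]
        congr 1
        exact integral_prod_mul (fun x => U₁ x ^ 2) (fun y => U₂ y ^ 2)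
    _ ≤ _ := by
        have h1 := m₁.sq
        have h2 := m₂.sq
        have h3 : 0 ≤ ∫ x, U₁ x ^ 2 ∂(refMeasure g₁ D₁) := integral_nonneg fun _ => by positivity
        have h4 : 0 ≤ ∫ y, U₂ y ^ 2 ∂(refMeasure g₂ D₂) := integral_nonneg fun _ => by positivity
        gcongr
        exact h3.trans h1

/-- Stochastic error of the empirical mean of a product weight. -/
theorem DensityCond.isBigOP_product (hf : DensityCond f) {Ω : Type*} [MeasurableSpace Ω]
    {P : Measure Ω} [IsProbabilityMeasure P] {Z : ℕ → Ω → Amb g₁ D₁ × Amb g₂ D₂}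
    (hZ_meas : ∀ i, Measurable (Z i)) (hZ_indep : iIndepFun Z P)
    (hZ_law : ∀ i, P.map (Z i) =
      (prodMeasure g₁ g₂ D₁ D₂).withDensity (fun z => ENNReal.ofReal (f z)))
    {h h₁ h₂ : ℕ → ℝ} (h0 : ∀ n, 0 < h n) (h0₁ : ∀ n, 0 < h₁ n) (h0₂ : ∀ n, 0 < h₂ n)
    (hh₁ : h₁ =Θ[atTop] h) (hh₂ : h₂ =Θ[atTop] h) (hlim : Tendsto h atTop (𝓝 0))
    {U₁ : ℕ → Amb g₁ D₁ → ℝ} {U₂ : ℕ → Amb g₂ D₂ → ℝ} (hU₁ : ∀ n, Continuous (U₁ n))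
    (hU₂ : ∀ n, Continuous (U₂ n)) {c₁ c₂ : ℝ} {e₁ e₂ d : ℕ}
    (hm₁ : ∀ᶠ n in atTop, MomentBound (refMeasure g₁ D₁) (U₁ n) c₁ (h₁ n) e₁)
    (hm₂ : ∀ᶠ n in atTop, MomentBound (refMeasure g₂ D₂) (U₂ n) c₂ (h₂ n) e₂)
    (he : e₁ + e₂ ≤ d) :
    IsBigOP P (fun n ω => empMean n (fun i => Z i ω) (fun u => U₁ n u.1 * U₂ n u.2) -
        ∫ u, U₁ n u.1 * U₂ n u.2 * radialExt f u ∂(prodMeasure g₁ g₂ D₁ D₂))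
      (fun n => √(1 / (n * h n ^ d))) := by
  obtain ⟨B, hB0, hB⟩ := hf.exists_second_moment_le
  obtain ⟨A₁, hA₁0, hA₁⟩ := exists_le_mul_bandwidth h0 h0₁ hh₁.2
  obtain ⟨A₂, hA₂0, hA₂⟩ := exists_le_mul_bandwidth h0 h0₂ hh₂.2
  have hmeas : ∀ n, Measurable fun u : Amb g₁ D₁ × Amb g₂ D₂ => U₁ n u.1 * U₂ n u.2 := fun n => by
    have := (hU₁ n).measurable
    have := (hU₂ n).measurable
    fun_prop
  refine isBigOP_empMean_sub hZ_meas hZ_indep hmeas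
    (V := |c₁| * A₁ ^ e₁ * (|c₂| * A₂ ^ e₂) * B) (fun n => pow_pos (h0 n) d) ?_
  filter_upwards [hm₁, hm₂, hA₁, hA₂, hlim.eventually (gt_mem_nhds one_pos)]
    with n m₁ m₂ ha₁ ha₂ hn i
  obtain ⟨hi, hi2, hle⟩ := hB _ _ _ _ _ _ _ _ m₁ m₂
  have h3 := hf.integral_comp (hZ_meas i) (hZ_law i) (hmeas n)
  have h4 := hf.integral_comp (hZ_meas i) (hZ_law i) ((hmeas n).pow_const 2)
  refine ⟨h4.1 hi2, h3.2, h4.2.le.trans (hle.trans ?_)⟩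
  have hpos := h0 n
  have hnn : 0 ≤ c₂ / h₂ n ^ e₂ := (integral_nonneg fun _ => by positivity).trans m₂.sq
  calc _ ≤ |c₁| * A₁ ^ e₁ / h n ^ e₁ * (|c₂| * A₂ ^ e₂ / h n ^ e₂) * B := by
        exact mul_le_mul_of_nonneg_right (mul_le_mul (div_pow_le_of_le_mul hpos (h0₁ n) ha₁ e₁)
          (div_pow_le_of_le_mul hpos (h0₂ n) ha₂ e₂) hnn (by positivity)) hB0
    _ = |c₁| * A₁ ^ e₁ * (|c₂| * A₂ ^ e₂) * B / h n ^ (e₁ + e₂) := by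
        rw [pow_add]
        field_simp
    _ ≤ _ := by
        -- Since eventually `h n < 1`, a larger exponent only weakens the bound; the scalar weights
        -- thus fit the slower rate of the gradient.
        refine div_le_div_of_nonneg_left (by positivity) (by positivity) ?_
        exact pow_le_pow_of_le_one hpos.le hn.le he

end Fluctuations

/-! ### Bias of the scalar weights. -/

section Expectations

variable {g₁ g₂ : Geometry} {D₁ D₂ : ℕ} {f : Amb g₁ D₁ × Amb g₂ D₂ → ℝ}
  {z : Amb g₁ D₁ × Amb g₂ D₂} {h h₁ h₂ : ℕ → ℝ} {C₁ C₂ w₁ w₂ : ℝ}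
  {W₁ : ℕ → Amb g₁ D₁ → ℝ} {W₂ : ℕ → Amb g₂ D₂ → ℝ}

theorem DensityCond.isBigO_bias (hf : DensityCond f) (hz : z ∈ prodSpace g₁ g₂ D₁ D₂)
    {Φ : Amb g₁ D₁ × Amb g₂ D₂ → ℝ} (hΦ : ContDiffOn ℝ 2 Φ (puncturedProd g₁ g₂ D₁ D₂))
    (hΦ0 : ∀ u, radialExt f =ᶠ[𝓝 u] 0 → Φ u = 0) (hh₁ : h₁ =O[atTop] h) (hh₂ : h₂ =O[atTop] h)
    (hW₁ : ∀ᶠ n in atTop, ApproxKernel (refMeasure g₁ D₁) z.1 D₁ (W₁ n) w₁ C₁ (h₁ n))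
    (hW₂ : ∀ᶠ n in atTop, ApproxKernel (refMeasure g₂ D₂) z.2 D₂ (W₂ n) w₂ C₂ (h₂ n)) :
    (fun n => ∫ u, W₁ n u.1 * W₂ n u.2 * Φ u ∂(prodMeasure g₁ g₂ D₁ D₂) - w₁ * w₂ * Φ z)
      =O[atTop] fun n => h n ^ 2 := by
  obtain ⟨C, hC⟩ := hf.exists_bias hz hΦ hΦ0 w₁ w₂ C₁ C₂
  refine IsBigO.trans (g := fun n => h₁ n ^ 2 + h₂ n ^ 2) (IsBigO.of_bound C ?_)
    ((hh₁.pow 2).add (hh₂.pow 2))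
  filter_upwards [hW₁, hW₂] with n k₁ k₂
  rw [Real.norm_eq_abs, Real.norm_of_nonneg (by positivity)]
  exact hC _ _ _ _ k₁ k₂

end Expectations

/-! ### Bias of the gradient coordinates. -/

section GradientMeans

variable {g₁ g₂ : Geometry} {D₁ D₂ : ℕ} {f : Amb g₁ D₁ × Amb g₂ D₂ → ℝ}
  {z : Amb g₁ D₁ × Amb g₂ D₂} {h h₁ h₂ : ℕ → ℝ} {C₁ C₂ C₁' C₂' w₁ w₂ : ℝ} {p₁ p₂ : ℝ → ℝ}

/-- Despite the factor `h₁⁻²` the bias stays `O(h²)`. Integration by parts leaves a plain kernel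
average of the derivative of `f` along the Killing field; this is twice continuously differentiable
because `f` is three times so, and its value at `z` is the gradient coordinate. -/
theorem DensityCond.isBigO_bias_gradient_fst (hf : DensityCond f)
    (hz : z ∈ prodSpace g₁ g₂ D₁ D₂) (hp₁ : KernelCond g₁ D₁ p₁)
    (h0₁ : ∀ n, 0 < h₁ n) (hh₁ : h₁ =O[atTop] h) (hh₂ : h₂ =O[atTop] h)
    (hK₁ : ∀ᶠ n in atTop, ApproxKernel (refMeasure g₁ D₁) z.1 D₁
      (factorKernel g₁ D₁ p₁ (h₁ n) z.1) 1 C₁ (h₁ n))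
    (hKD₁ : ∀ᶠ n in atTop, ApproxKernel (refMeasure g₁ D₁) z.1 D₁
      (factorKernelDeriv g₁ D₁ p₁ (h₁ n) z.1) w₁ C₁' (h₁ n))
    (hK₂ : ∀ᶠ n in atTop, ApproxKernel (refMeasure g₂ D₂) z.2 D₂
      (factorKernel g₂ D₂ p₂ (h₂ n) z.2) 1 C₂ (h₂ n)) (i : Fin (ambDim g₁ D₁)) :
    (fun n => ∫ u, factorKernelDeriv g₁ D₁ p₁ (h₁ n) z.1 u.1 *
        (inner ℝ (tangentVec g₁ D₁ z.1 i) (u.1 - z.1) / h₁ n ^ 2) *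
        factorKernel g₂ D₂ p₂ (h₂ n) z.2 u.2 * radialExt f u ∂(prodMeasure g₁ g₂ D₁ D₂) -
      riemGrad (radialExt f) z (Sum.inl i)) =O[atTop] fun n => h n ^ 2 := by
  set v := tangentVec g₁ D₁ z.1 i
  have hv : IsTangentVec g₁ D₁ z.1 v := isTangentVec_tangentVec hz.1 i
  have hcd : ContDiff ℝ 2 fun u : Amb g₁ D₁ × Amb g₂ D₂ =>
      (killingField g₁ D₁ z.1 v u.1, (0 : Amb g₂ D₂)) :=
    ((contDiff_killingField z.1 v).comp contDiff_fst).prodMk contDiff_const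
  have hc := hf.contDiffOn_derivAlong hcd
  have h00 := fun u (hu : radialExt f =ᶠ[𝓝 u] 0) => DensityCond.derivAlong_eq_zero (V :=
    fun u : Amb g₁ D₁ × Amb g₂ D₂ => (killingField g₁ D₁ z.1 v u.1, (0 : Amb g₂ D₂))) hu
  have hd := hf.hasFDerivAt_fst hz
  have key := hf.isBigO_bias hz hc h00 hh₁ hh₂ hK₁ hK₂
  have hval : derivAlong f (fun u => (killingField g₁ D₁ z.1 v u.1, 0)) z =
      riemGrad (radialExt f) z (Sum.inl i) := by
    rw [riemGrad_inl hd, derivAlong, killingField_self hz.1 hv]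
    rfl
  rw [hval, one_mul, one_mul] at key
  refine key.congr' ?_ EventuallyEq.rfl
  filter_upwards [hK₁, hKD₁, hK₂] with n k₁ k₁' k₂
  rw [hf.integral_gradient_fst hp₁ hz.1 hv (h₁ n)
    (hf.integrable_mul_radialExt ((k₁'.momentBound_inner (h0₁ n) v).int.mul_prod k₂.int))
    (hf.integrable_mul (k₁.int.mul_prod k₂.int) hc.continuousOn h00)]

theorem DensityCond.isBigO_bias_gradient_snd (hf : DensityCond f)
    (hz : z ∈ prodSpace g₁ g₂ D₁ D₂) (hp₂ : KernelCond g₂ D₂ p₂)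
    (h0₂ : ∀ n, 0 < h₂ n) (hh₁ : h₁ =O[atTop] h) (hh₂ : h₂ =O[atTop] h)
    (hK₁ : ∀ᶠ n in atTop, ApproxKernel (refMeasure g₁ D₁) z.1 D₁
      (factorKernel g₁ D₁ p₁ (h₁ n) z.1) 1 C₁ (h₁ n))
    (hK₂ : ∀ᶠ n in atTop, ApproxKernel (refMeasure g₂ D₂) z.2 D₂
      (factorKernel g₂ D₂ p₂ (h₂ n) z.2) 1 C₂ (h₂ n))
    (hKD₂ : ∀ᶠ n in atTop, ApproxKernel (refMeasure g₂ D₂) z.2 D₂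
      (factorKernelDeriv g₂ D₂ p₂ (h₂ n) z.2) w₂ C₂' (h₂ n)) (i : Fin (ambDim g₂ D₂)) :
    (fun n => ∫ u, factorKernel g₁ D₁ p₁ (h₁ n) z.1 u.1 *
        (factorKernelDeriv g₂ D₂ p₂ (h₂ n) z.2 u.2 *
        (inner ℝ (tangentVec g₂ D₂ z.2 i) (u.2 - z.2) / h₂ n ^ 2)) * radialExt f u
          ∂(prodMeasure g₁ g₂ D₁ D₂) -
      riemGrad (radialExt f) z (Sum.inr i)) =O[atTop] fun n => h n ^ 2 := by
  set v := tangentVec g₂ D₂ z.2 i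
  have hv : IsTangentVec g₂ D₂ z.2 v := isTangentVec_tangentVec hz.2 i
  have hcd : ContDiff ℝ 2 fun u : Amb g₁ D₁ × Amb g₂ D₂ =>
      ((0 : Amb g₁ D₁), killingField g₂ D₂ z.2 v u.2) :=
    contDiff_const.prodMk ((contDiff_killingField z.2 v).comp contDiff_snd)
  have hc := hf.contDiffOn_derivAlong hcd
  have h00 := fun u (hu : radialExt f =ᶠ[𝓝 u] 0) => DensityCond.derivAlong_eq_zero (V :=
    fun u : Amb g₁ D₁ × Amb g₂ D₂ => ((0 : Amb g₁ D₁), killingField g₂ D₂ z.2 v u.2)) hu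
  have hd := hf.hasFDerivAt_snd hz
  have key := hf.isBigO_bias hz hc h00 hh₁ hh₂ hK₁ hK₂
  have hval : derivAlong f (fun u => (0, killingField g₂ D₂ z.2 v u.2)) z =
      riemGrad (radialExt f) z (Sum.inr i) := by
    rw [riemGrad_inr hd, derivAlong, killingField_self hz.2 hv]
    rfl
  rw [hval, one_mul, one_mul] at key
  refine key.congr' ?_ EventuallyEq.rfl
  filter_upwards [hK₁, hK₂, hKD₂] with n k₁ k₂ k₂'
  rw [hf.integral_gradient_snd hp₂ hz.2 hv (h₂ n)
    (hf.integrable_mul_radialExt (k₁.int.mul_prod (k₂'.momentBound_inner (h0₂ n) v).int))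
    (hf.integrable_mul (k₁.int.mul_prod k₂.int) hc.continuousOn h00)]

end GradientMeans

end ProdKDE

/-! ### Assembly of the identities and the rate. -/

theorem proposition3
    (g₁ g₂ : Geometry) (D₁ D₂ : ℕ) (hD₁ : 1 ≤ D₁) (hD₂ : 1 ≤ D₂)
    (p₁ p₂ : ℝ → ℝ) (hp₁ : KernelCond g₁ D₁ p₁) (hp₂ : KernelCond g₂ D₂ p₂)
    (f : Amb g₁ D₁ × Amb g₂ D₂ → ℝ) (hf : DensityCond f)
    {Ω : Type*} [MeasurableSpace Ω] (P : Measure Ω) [IsProbabilityMeasure P]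
    (Z : ℕ → Ω → Amb g₁ D₁ × Amb g₂ D₂) (hZ_meas : ∀ i, Measurable (Z i))
    (hZ_indep : iIndepFun Z P)
    (hZ_law : ∀ i, P.map (Z i) =
      (prodMeasure g₁ g₂ D₁ D₂).withDensity (fun z => ENNReal.ofReal (f z)))
    (z : Amb g₁ D₁ × Amb g₂ D₂) (hz : z ∈ prodSpace g₁ g₂ D₁ D₂) (hfz : 0 < f z) :
    -- exact identities, for every sample and all bandwidths
    (∀ (n : ℕ) (h₁ h₂ : ℝ), 0 < h₁ → 0 < h₂ → ∀ ω : Ω,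
      (IsUnit (Dtilde p₁ p₂ h₁ h₂ n (fun i => Z i ω) z).det →
        meanShift p₁ p₂ h₁ h₂ n (fun i => Z i ω) z =
          (Dtilde p₁ p₂ h₁ h₂ n (fun i => Z i ω) z)⁻¹ *ᵥ
            totalGrad (kde p₁ p₂ h₁ h₂ n (fun i => Z i ω)) z) ∧
      (projMatrix z * (bandwidthMatrix g₁ g₂ D₁ D₂ h₁ h₂)⁻¹ *
          (Dtilde p₁ p₂ h₁ h₂ n (fun i => Z i ω) z)⁻¹) *ᵥ
            totalGrad (kde p₁ p₂ h₁ h₂ n (fun i => Z i ω)) z =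
        ((Dtilde p₁ p₂ h₁ h₂ n (fun i => Z i ω) z)⁻¹ *
          (bandwidthMatrix g₁ g₂ D₁ D₂ h₁ h₂)⁻¹) *ᵥ
            riemGrad (kde p₁ p₂ h₁ h₂ n (fun i => Z i ω)) z) ∧
    -- the limit matrix is invertible
    IsUnit (Ftilde p₁ p₂ f z).det ∧
    -- pointwise rate of convergence
    (∀ h h₁ h₂ : ℕ → ℝ, (∀ n, 0 < h n) → (∀ n, 0 < h₁ n) → (∀ n, 0 < h₂ n) →
      h₁ =Θ[atTop] h → h₂ =Θ[atTop] h → Tendsto h atTop (𝓝 0) →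
      Tendsto (fun n : ℕ => (n : ℝ) * h n ^ (D₁ + D₂ + 2)) atTop atTop →
      Tendsto (fun n => P {ω | IsUnit
        (Dtilde p₁ p₂ (h₁ n) (h₂ n) n (fun i => Z i ω) z).det}) atTop (𝓝 1) ∧
      ∃ b : ℕ → Idx g₁ g₂ D₁ D₂ → ℝ,
        b =O[atTop] (fun n => h n ^ 2) ∧
        IsBigOP P (fun n ω =>
          (bandwidthMatrix g₁ g₂ D₁ D₂ (h₁ n) (h₂ n) *
              Dtilde p₁ p₂ (h₁ n) (h₂ n) n (fun i => Z i ω) z)⁻¹ *ᵥ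
                riemGrad (kde p₁ p₂ (h₁ n) (h₂ n) n (fun i => Z i ω)) z
            - (Ftilde p₁ p₂ f z)⁻¹ *ᵥ riemGrad (radialExt f) z - b n)
          (fun n => Real.sqrt (1 / ((n : ℝ) * h n ^ (D₁ + D₂ + 2))))) := by
  have hκ₁ : 0 < kernelRatio g₁ D₁ p₁ * f z := mul_pos (hp₁.kernelRatio_pos hD₁) hfz
  have hκ₂ : 0 < kernelRatio g₂ D₂ p₂ * f z := mul_pos (hp₂.kernelRatio_pos hD₂) hfz
  refine ⟨fun n h₁ h₂ hh₁ hh₂ ω => ⟨meanShift_eq hD₁ hD₂ hp₁ hp₂,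
    projMatrix_mul_inv_mulVec hD₁ hD₂ (by positivity) (by positivity) _⟩,
    (isUnit_det_twoBlock hD₁ hD₂).2 ⟨hκ₁.ne', hκ₂.ne'⟩, ?_⟩
  intro h h₁ h₂ h0 h0₁ h0₂ hh₁ hh₂ hlim hrate
  have ht₁ := tendsto_bandwidth h0₁ hh₁ hlim
  have ht₂ := tendsto_bandwidth h0₂ hh₂ hlim
  obtain ⟨C₁, hC₁⟩ := hp₁.exists_approxKernel hD₁ hz.1
  obtain ⟨C₂, hC₂⟩ := hp₂.exists_approxKernel hD₂ hz.2
  obtain ⟨C₁', hC₁'⟩ := hp₁.exists_approxKernel_deriv hD₁ hz.1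
  obtain ⟨C₂', hC₂'⟩ := hp₂.exists_approxKernel_deriv hD₂ hz.2
  have hK₁ := ht₁.eventually hC₁
  have hK₂ := ht₂.eventually hC₂
  have hKD₁ := ht₁.eventually hC₁'
  have hKD₂ := ht₂.eventually hC₂'
  have hc₁ := fun n => hp₁.continuous_factorKernel (h₁ n) z.1
  have hc₂ := fun n => hp₂.continuous_factorKernel (h₂ n) z.2
  have hcd₁ := fun n => hp₁.continuous_factorKernelDeriv (h₁ n) z.1
  have hcd₂ := fun n => hp₂.continuous_factorKernelDeriv (h₂ n) z.2
  set r : ℕ → ℝ := fun n => √(1 / ((n : ℝ) * h n ^ (D₁ + D₂ + 2)))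
  have hr : Tendsto r atTop (𝓝 0) := by
    simpa [r] using (tendsto_inv_atTop_zero.comp hrate).sqrt
  have hη : Tendsto (fun n => h n ^ 2) atTop (𝓝 0) := by simpa using hlim.pow 2
  let aX : ℕ → Ω → ℝ := fun n ω => empMean n (fun i => Z i ω) fun u =>
    factorKernelDeriv g₁ D₁ p₁ (h₁ n) z.1 u.1 * factorKernel g₂ D₂ p₂ (h₂ n) z.2 u.2
  let aY : ℕ → Ω → ℝ := fun n ω => empMean n (fun i => Z i ω) fun u =>
    factorKernel g₁ D₁ p₁ (h₁ n) z.1 u.1 * factorKernelDeriv g₂ D₂ p₂ (h₂ n) z.2 u.2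
  -- The two denominators: `false` belongs to the first block, `true` to the second.
  let A : Bool → ℕ → Ω → ℝ := fun k => cond k aY aX
  let mA : Bool → ℕ → ℝ := fun k => cond k
    (fun n => ∫ u, factorKernel g₁ D₁ p₁ (h₁ n) z.1 u.1 *
      factorKernelDeriv g₂ D₂ p₂ (h₂ n) z.2 u.2 * radialExt f u ∂(prodMeasure g₁ g₂ D₁ D₂))
    (fun n => ∫ u, factorKernelDeriv g₁ D₁ p₁ (h₁ n) z.1 u.1 *
      factorKernel g₂ D₂ p₂ (h₂ n) z.2 u.2 * radialExt f u ∂(prodMeasure g₁ g₂ D₁ D₂))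
  let α : Bool → ℝ := fun k => cond k (kernelRatio g₂ D₂ p₂ * f z) (kernelRatio g₁ D₁ p₁ * f z)
  let G : Idx g₁ g₂ D₁ D₂ → ℕ → Ω → ℝ := fun i n ω =>
    riemGrad (kde p₁ p₂ (h₁ n) (h₂ n) n fun i => Z i ω) z i
  let mG : Idx g₁ g₂ D₁ D₂ → ℕ → ℝ := Sum.elim
    (fun i n => ∫ u, factorKernelDeriv g₁ D₁ p₁ (h₁ n) z.1 u.1 *
      (inner ℝ (tangentVec g₁ D₁ z.1 i) (u.1 - z.1) / h₁ n ^ 2) *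
      factorKernel g₂ D₂ p₂ (h₂ n) z.2 u.2 * radialExt f u ∂(prodMeasure g₁ g₂ D₁ D₂))
    (fun i n => ∫ u, factorKernel g₁ D₁ p₁ (h₁ n) z.1 u.1 *
      (factorKernelDeriv g₂ D₂ p₂ (h₂ n) z.2 u.2 *
      (inner ℝ (tangentVec g₂ D₂ z.2 i) (u.2 - z.2) / h₂ n ^ 2)) * radialExt f u
        ∂(prodMeasure g₁ g₂ D₁ D₂))
  have hα : ∀ k, min (kernelRatio g₁ D₁ p₁ * f z) (kernelRatio g₂ D₂ p₂ * f z) ≤ α k :=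
    Bool.forall_bool.2 ⟨min_le_left _ _, min_le_right _ _⟩
  have hA : ∀ k, IsBigOP P (fun n ω => A k n ω - mA k n) r := Bool.forall_bool.2
    ⟨hf.isBigOP_product hZ_meas hZ_indep hZ_law h0 h0₁ h0₂ hh₁ hh₂ hlim hcd₁ hc₂
      (hKD₁.mono fun _ hk => hk.momentBound) (hK₂.mono fun _ hk => hk.momentBound) (by omega),
    hf.isBigOP_product hZ_meas hZ_indep hZ_law h0 h0₁ h0₂ hh₁ hh₂ hlim hc₁ hcd₂
      (hK₁.mono fun _ hk => hk.momentBound) (hKD₂.mono fun _ hk => hk.momentBound) (by omega)⟩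
  have hf2 : ContDiffOn ℝ 2 (radialExt f) (puncturedProd g₁ g₂ D₁ D₂) :=
    hf.contDiffOn.of_le (by norm_num)
  have hf0 : ∀ u, radialExt f =ᶠ[𝓝 u] 0 → radialExt f u = 0 := fun _ hu => hu.self_of_nhds
  have hmA : ∀ k, (fun n => mA k n - α k) =O[atTop] fun n => h n ^ 2 := by
    refine Bool.forall_bool.2 ⟨?_, ?_⟩
    · have hb := hf.isBigO_bias hz hf2 hf0 hh₁.1 hh₂.1 hKD₁ hK₂
      rw [mul_one, radialExt_of_mem hz] at hb
      exact hb
    · have hb := hf.isBigO_bias hz hf2 hf0 hh₁.1 hh₂.1 hK₁ hKD₂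
      rw [one_mul, radialExt_of_mem hz] at hb
      exact hb
  have hG : ∀ i, IsBigOP P (fun n ω => G i n ω - mG i n) r := by
    rintro (i | i)
    · simp only [G, riemGrad_kde_inl hp₁]
      exact hf.isBigOP_product hZ_meas hZ_indep hZ_law h0 h0₁ h0₂ hh₁ hh₂ hlim
        (U₁ := fun n x => factorKernelDeriv g₁ D₁ p₁ (h₁ n) z.1 x *
          (inner ℝ (tangentVec g₁ D₁ z.1 i) (x - z.1) / h₁ n ^ 2))
        (fun n => (hcd₁ n).mul (by fun_prop)) hc₂
        (hKD₁.mono fun n hk => hk.momentBound_inner (h0₁ n) _)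
        (hK₂.mono fun _ hk => hk.momentBound) (by omega)
    · simp only [G, riemGrad_kde_inr hp₂]
      exact hf.isBigOP_product hZ_meas hZ_indep hZ_law h0 h0₁ h0₂ hh₁ hh₂ hlim hc₁
        (U₂ := fun n y => factorKernelDeriv g₂ D₂ p₂ (h₂ n) z.2 y *
          (inner ℝ (tangentVec g₂ D₂ z.2 i) (y - z.2) / h₂ n ^ 2))
        (fun n => (hcd₂ n).mul (by fun_prop)) (hK₁.mono fun _ hk => hk.momentBound)
        (hKD₂.mono fun n hk => hk.momentBound_inner (h0₂ n) _) (by omega)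
  have hmG : ∀ i, (fun n => mG i n - riemGrad (radialExt f) z i) =O[atTop] fun n => h n ^ 2 := by
    rintro (i | i)
    · exact hf.isBigO_bias_gradient_fst hz hp₁ h0₁ hh₁.1 hh₂.1 hK₁ hKD₁ hK₂ i
    · exact hf.isBigO_bias_gradient_snd hz hp₂ h0₂ hh₁.1 hh₂.1 hK₁ hK₂ hKD₂ i
  have hGx : ∀ n ω, Gx p₁ p₂ (h₁ n) (h₂ n) n (fun i => Z i ω) z = (h₁ n ^ 2)⁻¹ * aX n ω :=
    fun n ω => Gx_eq_empMean hp₁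
  have hGy : ∀ n ω, Gy p₁ p₂ (h₁ n) (h₂ n) n (fun i => Z i ω) z = (h₂ n ^ 2)⁻¹ * aY n ω :=
    fun n ω => Gy_eq_empMean hp₂
  have hs₁ : ∀ n, h₁ n ^ 2 ≠ 0 := fun n => (pow_pos (h0₁ n) 2).ne'
  have hs₂ : ∀ n, h₂ n ^ 2 ≠ 0 := fun n => (pow_pos (h0₂ n) 2).ne'
  refine ⟨?_, exists_bias_isBigOP_ratio (σ := Sum.elim (fun _ => false) fun _ => true)
    (fun n => Real.sqrt_nonneg _) hr hη (lt_min hκ₁ hκ₂) hα hA hmA hG hmG (fun n ω hA0 => ?_) ?_⟩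
  · have := tendsto_measure_ne_zero hr hη (lt_min hκ₁ hκ₂) hα hA hmA
    refine this.congr fun n => congrArg P (Set.ext fun ω => ?_)
    simp only [mem_ofPred_eq, Dtilde, isUnit_det_twoBlock hD₁ hD₂, hGx, hGy]
    rw [Bool.forall_bool, mul_ne_zero_iff, mul_ne_zero_iff]
    simp only [ne_eq, inv_eq_zero, hs₁, hs₂, not_false_eq_true, true_and]
    rfl
  · have hX : aX n ω ≠ 0 := hA0 false
    have hY : aY n ω ≠ 0 := hA0 true
    -- Here the bandwidth matrix cancels the factors `h₁⁻²` and `h₂⁻²`, leaving ratios of gradient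
    -- coordinates to the two empirical means.
    rw [bandwidthMatrix, Dtilde, twoBlock_mul, hGx, hGy, mul_inv_cancel_left₀ (hs₁ n),
      mul_inv_cancel_left₀ (hs₂ n), inv_twoBlock hX hY, twoBlock_mulVec]
    ext (i | i) <;> rfl
  · rw [Ftilde, inv_twoBlock hκ₁.ne' hκ₂.ne', twoBlock_mulVec]
    ext (i | i) <;> rfl
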